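/- **Tube formula for fractal sprays.** Let $d\ge 1$. *Setting.* For $A\subset\mathbb R^d$ and $\varepsilon>0$ let $V(A,\varepsilon)$ be the $d$-dimensional Lebesgue measure of $\{x\in A:\operatorname{dist}(x,\partial A)\le\varepsilon\}$. Let $G\subset\mathbb R^d$ be a nonempty bounded open set with inradius $g=\sup\{r>0: G \text{ contains a ball of radius } r\}$. Assume that $G$ is *monophase*: there are real constants $\kappa_0,\dots,\kappa_{d-1}$ with $V(G,\varepsilon)=\sum_{k=0}^{d-1}\kappa_k\varepsilon^{d-k}$ for $0<\varepsilon<g$; put $\kappa_d=-\operatorname{vol}_d(G)$. Let $T$ be a *fractal spray* on $G$ with scaling ratios $\ell_1,\ell_2,\dots>0$: a bounded set which is the disjoint union of sets $\Omega_n$, $n\ge1$, with $\Omega_n$ congruent to $\ell_nG$. Its scaling measure is $\eta_s=\sum_n\delta_{1/\ell_n}$. Let $f:\mathbb R\to\mathbb R$ be bounded and Lipschitz, $S=\{f(t)+it:t\in\mathbb R\}$ the *screen* (oriented upwards), $\sup S=\sup_t f(t)$, and $W=\{z\in\mathbb C:\operatorname{Re}z\ge f(\operatorname{Im}z)\}$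 the *window*. Assume that the scaling zeta function $\zeta_s(s)=\int_0^\infty x^{-s}\,d\eta_s(x)=\sum_n\ell_n^s$ has a meromorphic continuation, again denoted $\zeta_s$, to a neighbourhood of $W$. Let $D_s(W)$ be the set of its poles in $W$, and $$D_T(W)=D_s(W)\cup\big(\{0,1,\dots,d-1\}\cap W\big).$$ Call a sequence $(T_n)_{n\in\mathbb Z}$ of reals *admissible* if $T_{-n}<0<T_n$ for $n\ge1$, $T_n\to\infty$, $T_{-n}\to-\infty$ and $T_n/|T_{-n}|\to1$ as $n\to\infty$, and there are constants $M\in\mathbb R$, $c>0$ with * $|\zeta_s(\sigma+iT_n)|\le c\,(|T_n|+1)^M$ for all $n\in\mathbb Z$ and all $\sigma\ge f(T_n)$, * $|\zeta_s(f(t)+it)|\le c\,|t|^M$ for all $|t|\ge1$. Assume that $\zeta_s$ is *languid* on $S$, i.e. that an admissible sequence exists, that $S$ contains no point of $D_T(W)$, and that $f(0)<d$ (the screen passes to the left of the point $d$). Put $$\zeta_T(\varepsilon,s)=\varepsilon^{d-s}\,\zeta_s(s)\sum_{k=0}^d\frac{g^{s-k}}{s-k}\,\kappa_k ,$$ regarded,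 for fixed $s$, as a distribution $\langle\zeta_T(\cdot,s),\varphi\rangle=\int_0^\infty\zeta_T(\varepsilon,s)\varphi(\varepsilon)\,d\varepsilon$ on $C_c^\infty(0,\infty)$. *Conclusion.* As distributions on $C_c^\infty(0,\infty)$, $$V(T,\varepsilon)=\sum_{\omega\in D_T(W)}\operatorname{res}\big(\zeta_T(\varepsilon,s);\,s=\omega\big)+\mathcal R(\varepsilon),\qquad \mathcal R(\varepsilon)=\frac1{2\pi i}\int_S\zeta_T(\varepsilon,s)\,ds .$$ In detail: $V(T,\cdot)$ is locally integrable on $(0,\infty)$; for each $\omega\in D_T(W)$ the functional $\varphi\mapsto\operatorname{res}(\langle\zeta_T(\cdot,s),\varphi\rangle;\,s=\omega)$ is a distribution; the integral $\langle\mathcal R,\varphi\rangle=\frac1{2\pi i}\int_S\langle\zeta_T(\cdot,s),\varphi\rangle\,ds$ converges absolutely for every test function $\varphi$ and defines a distribution; and for every admissible sequence $(T_n)$ the sets $\{\omega\in D_T(W):T_{-n}<\operatorname{Im}\omega<T_n\}$ are finite and, for every test function $\varphi$, $$\int_0^\infty V(T,\varepsilon)\varphi(\varepsilon)\,d\varepsilon=\lim_{n\to\infty}\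 \sum_{\substack{\omega\in D_T(W)\\ T_{-n}<\operatorname{Im}\omega<T_n}}\operatorname{res}\big(\langle\zeta_T(\cdot,s),\varphi\rangle;\,s=\omega\big)+\langle\mathcal R,\varphi\rangle .$$ Moreover $\mathcal R(\varepsilon)=O(\varepsilon^{d-\sup S})$ as $\varepsilon\to0^+$ in the distributional sense: for every test function $\varphi$, with $\varphi_a(x)=\frac1a\varphi(\frac xa)$, one has $\langle\mathcal R,\varphi_a\rangle=O(a^{d-\sup S})$ as $a\to0^+$, where the implied constant may depend on $\varphi$. -/

import Mathlib

open Set Filter Topology MeasureTheory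
open scoped Pointwise Distributions

noncomputable section

namespace FractalSpray

/-! ### Inner tubes, inradius, generators and sprays -/

/-- The volume `V(A, ε)` of the inner `ε`-neighbourhood `{x ∈ A | dist (x, ∂A) ≤ ε}` of `A`. -/
def innerTubeVolume {d : ℕ} (A : Set (EuclideanSpace ℝ (Fin d))) (ε : ℝ) : ℝ :=
  (volume : Measure (EuclideanSpace ℝ (Fin d))).real
    {x ∈ A | Metric.infDist x (frontier A) ≤ ε}

/-- The inradius: the supremum of the radii of the balls contained in `A`. -/
def inradius {d : ℕ} (A : Set (EuclideanSpace ℝ (Fin d))) : ℝ :=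
  sSup {ε : ℝ | 0 < ε ∧ ∃ x, Metric.ball x ε ⊆ A}

/-- A generator: a nonempty bounded open subset of `ℝᵈ`. -/
structure IsGenerator {d : ℕ} (G : Set (EuclideanSpace ℝ (Fin d))) : Prop where
  nonempty : G.Nonempty
  isOpen : IsOpen G
  isBounded : Bornology.IsBounded G

/-- `G` is monophase with coefficients `κ 0, …, κ d`: for `ε` below the inradius the inner tube
volume is the polynomial `∑ k < d, κ k * ε ^ (d - k)`; and `κ d` is by convention minus the
volume of `G`. (The values `κ k` with `k > d` are irrelevant.) -/
structure IsMonophase {d : ℕ} (G : Set (EuclideanSpace ℝ (Fin d))) (κ : ℕ → ℝ) : Prop where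
  tube : ∀ ε : ℝ, 0 < ε → ε < inradius G →
    innerTubeVolume G ε = ∑ k ∈ Finset.range d, κ k * ε ^ (d - k)
  top : κ d = -(volume : Measure (EuclideanSpace ℝ (Fin d))).real G

/-- `T` is a fractal spray on the generator `G` with scaling ratios `ℓ n > 0`: a bounded set which
is the disjoint union of (automatically open) sets `Ω n`, where `Ω n` is congruent to `ℓ n • G`. -/
structure IsFractalSpray {d : ℕ} (T G : Set (EuclideanSpace ℝ (Fin d))) (ℓ : ℕ → ℝ) : Prop where
  isBounded : Bornology.IsBounded T
  ratio_pos : ∀ n, 0 < ℓ n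
  tiles : ∃ Ω : ℕ → Set (EuclideanSpace ℝ (Fin d)),
    Pairwise (fun m n => Disjoint (Ω m) (Ω n)) ∧ T = ⋃ n, Ω n ∧
    ∀ n, ∃ e : EuclideanSpace ℝ (Fin d) ≃ᵢ EuclideanSpace ℝ (Fin d), Ω n = e '' (ℓ n • G)

/-! ### Scaling measure, scaling zeta function, screen and window -/

/-- The scaling measure: the sum of the Dirac masses at the reciprocal scaling ratios. -/
def scalingMeasure (ℓ : ℕ → ℝ) : Measure ℝ :=
  Measure.sum fun n => Measure.dirac (1 / ℓ n)

/-- `f` defines a screen `{f t + i t | t ∈ ℝ}`: it is bounded and Lipschitz. -/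
structure IsScreen (f : ℝ → ℝ) : Prop where
  lipschitz : ∃ K, LipschitzWith K f
  bounded : ∃ C, ∀ t, |f t| ≤ C

/-- The point of the screen at height `t`. -/
def screenPoint (f : ℝ → ℝ) (t : ℝ) : ℂ := (f t : ℂ) + (t : ℂ) * Complex.I

/-- The supremum of the real parts of the points of the screen. -/
def supScreen (f : ℝ → ℝ) : ℝ := ⨆ t, f t

/-- The window: the closed region to the right of the screen. -/
def window (f : ℝ → ℝ) : Set ℂ := {z | f z.im ≤ z.re}

/-- The integrand of the contour integral of `F` along the screen, parametrized by the height `t`.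
The Lipschitz function `f` is differentiable almost everywhere. -/
def screenIntegrand (f : ℝ → ℝ) (F : ℂ → ℂ) (t : ℝ) : ℂ :=
  F (screenPoint f t) * (((deriv f t : ℝ) : ℂ) + Complex.I)

/-- The contour integral along the screen, oriented upwards. -/
def screenIntegral (f : ℝ → ℝ) (F : ℂ → ℂ) : ℂ := ∫ t : ℝ, screenIntegrand f F t

/-- `ζ` is the scaling zeta function of the scaling ratios `ℓ` on `W`: it is meromorphic at every point of
`W` and extends the Mellin transform `∫ x ^ (-s) dη(x)` of the scaling measure, from the set of
those `s` for which this integral converges. -/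
structure IsScalingZeta (ℓ : ℕ → ℝ) (W : Set ℂ) (ζ : ℂ → ℂ) : Prop where
  meromorphic : MeromorphicOn ζ W
  eq_mellin : ∀ s : ℂ,
    IntegrableOn (fun x : ℝ => (x : ℂ) ^ (-s)) (Ioi 0) (scalingMeasure ℓ) →
    ζ s = ∫ x in Ioi (0 : ℝ), (x : ℂ) ^ (-s) ∂(scalingMeasure ℓ)

/-- The visible scaling dimensions: the poles of `ζ` in the window. -/
def scalingDims (ζ : ℂ → ℂ) (f : ℝ → ℝ) : Set ℂ :=
  {ω | ω ∈ window f ∧ Tendsto (fun s => ‖ζ s‖) (𝓝[≠] ω) atTop}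

/-- The visible complex dimensions of a spray in `ℝᵈ`: the visible scaling dimensions, together
with those of the integral dimensions `0, 1, …, d - 1` which lie in the window. -/
def visibleDims (d : ℕ) (ζ : ℂ → ℂ) (f : ℝ → ℝ) : Set ℂ :=
  scalingDims ζ f ∪ {ω | ω ∈ window f ∧ ∃ k : ℕ, k < d ∧ ω = (k : ℂ)}

/-! ### Languidity -/

/-- The sequences of heights that may occur in the definition of languidity. -/
structure IsHeightSeq (T : ℤ → ℝ) : Prop where
  pos : ∀ n : ℕ, 1 ≤ n → 0 < T n
  neg : ∀ n : ℕ, 1 ≤ n → T (-n) < 0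
  tendsto_top : Tendsto (fun n : ℕ => T n) atTop atTop
  tendsto_bot : Tendsto (fun n : ℕ => T (-n)) atTop atBot
  ratio : Tendsto (fun n : ℕ => T n / |T (-n)|) atTop (𝓝 1)

/-- The growth conditions L1 and L2 with exponent `M` along the heights `T`. In L1 the bound on a
whole horizontal half-line forbids poles of `ζ` on it, since `‖ζ‖` is unbounded near a pole. -/
def IsLanguidAlong (ζ : ℂ → ℂ) (f : ℝ → ℝ) (M : ℝ) (T : ℤ → ℝ) : Prop :=
  ∃ c : ℝ, 0 < c ∧
    (∀ (n : ℤ) (σ : ℝ), f (T n) ≤ σ →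
      ‖ζ ((σ : ℂ) + (T n : ℂ) * Complex.I)‖ ≤ c * (|T n| + 1) ^ M) ∧
    (∀ t : ℝ, 1 ≤ |t| → ‖ζ (screenPoint f t)‖ ≤ c * |t| ^ M)

/-- `ζ` is languid on the screen given by `f`, of some order. -/
def IsLanguid (ζ : ℂ → ℂ) (f : ℝ → ℝ) : Prop :=
  ∃ (M : ℝ) (T : ℤ → ℝ), IsHeightSeq T ∧ IsLanguidAlong ζ f M T

/-! ### The tubular zeta function and distributions on `(0, ∞)` -/

/-- The tubular zeta function
`ζ_T(ε, s) = ε ^ (d - s) * ζ(s) * ∑ k ≤ d, g ^ (s - k) / (s - k) * κ k`. -/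
def tubularZeta (d : ℕ) (g : ℝ) (κ : ℕ → ℝ) (ζ : ℂ → ℂ) (ε : ℝ) (s : ℂ) : ℂ :=
  (ε : ℂ) ^ ((d : ℂ) - s) * ζ s *
    ∑ k ∈ Finset.range (d + 1), (g : ℂ) ^ (s - (k : ℂ)) / (s - (k : ℂ)) * (κ k : ℂ)

/-- The residue of a meromorphic function at `ω`, i.e. the value of `(2πi)⁻¹ ∮ F` over all
sufficiently small positively oriented circles around `ω`. -/
def residue (F : ℂ → ℂ) (ω : ℂ) : ℂ :=
  limUnder (𝓝[>] (0 : ℝ)) fun r =>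
    (2 * (Real.pi : ℂ) * Complex.I)⁻¹ * ∮ s in C(ω, r), F s

/-- The open half-line `(0, ∞)`. -/
def posReals : TopologicalSpace.Opens ℝ := ⟨Ioi 0, isOpen_Ioi⟩

/-- The action of a function on a test function: `∫_0^∞ u(ε) φ(ε) dε`. -/
def pairing (u φ : ℝ → ℂ) : ℂ := ∫ ε in Ioi (0 : ℝ), u ε * φ ε

/-- The action on `φ` of the residue at `ω` of the distribution-valued function
`s ↦ ζ_T(·, s)`. -/
def residueAction (d : ℕ) (g : ℝ) (κ : ℕ → ℝ) (ζ : ℂ → ℂ) (ω : ℂ) (φ : ℝ → ℂ) : ℂ :=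
  residue (fun s => pairing (fun ε => tubularZeta d g κ ζ ε s) φ) ω

/-- The action on `φ` of the error term `(2πi)⁻¹ ∫_S ζ_T(·, s) ds`. -/
def errorAction (d : ℕ) (g : ℝ) (κ : ℕ → ℝ) (ζ : ℂ → ℂ) (f : ℝ → ℝ) (φ : ℝ → ℂ) : ℂ :=
  (2 * (Real.pi : ℂ) * Complex.I)⁻¹ *
    screenIntegral f fun s => pairing (fun ε => tubularZeta d g κ ζ ε s) φ

/-- `R` acts on `C_c^∞(0, ∞)` as a distribution, i.e. as a continuous linear functional. -/
def IsDistribution (R : (ℝ → ℂ) → ℂ) : Prop :=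
  ∃ L : 𝓓(posReals, ℂ) →L[ℂ] ℂ, ∀ φ : 𝓓(posReals, ℂ), L φ = R φ

/-- `R(x) = O(x ^ α)` as `x → 0⁺` in the distributional sense: for each test function `φ`,
with `φ_a(x) = a⁻¹ φ(x / a)`, one has `⟨R, φ_a⟩ = O(a ^ α)` as `a → 0⁺`. -/
def IsDistributionalBigO (R : (ℝ → ℂ) → ℂ) (α : ℝ) : Prop :=
  ∀ φ : 𝓓(posReals, ℂ),
    (fun a : ℝ => R fun x => (a : ℂ)⁻¹ * φ (x / a)) =O[𝓝[>] (0 : ℝ)] fun a => a ^ α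

end FractalSpray

end

namespace FractalSpray

/-! ### The fundamental theorem of calculus along Lipschitz curves -/

/-! Subtract the total volume: the defect `V(T, ε) - vol T` is the sum over the tiles of `ℓ n ^ d`
times the defect of `G` at `ε / ℓ n`. The defect of `G` is the polynomial `∑ k ≤ d, κ k ε^(d-k)` cut
off at the inradius, so its Mellin transform at `s - d` is the elementary function `tubeTransform`,
and each dilation contributes a factor `ℓ n ^ s`. Hence for `Re s > d` the defect of `T` has Mellin
transform `ζ(s) * tubeTransform(s)` at `s - d` (`mellin_tubeDefect`). Pairing `tubularZeta` with `φ`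
gives the same product times `mellin φ (d + 1 - s)` (`pairing_tubularZeta`), and Parseval's formula
(`integral_mellin_mul_mellin`) expresses the action of the defect on `φ` as `(2πi)⁻¹` times the
integral of this function over a line `Re s = c > d`.

The line is then moved to the screen. The poles crossed are among the visible dimensions and the
point `d`. At `d` the zeta function is regular with value `∑ ℓ n ^ d`, so the residue there is `-vol
T * ∫ φ` (`hasResidueAt_dimension`); it cancels the volume subtracted at the start, which is why `d`
does not occur in the formula.

Convergence rests on one estimate: in vertical strips `mellin φ` decays faster than any power of the
height, with constants given by sup norms of `φ` and of a derivative
(`exists_norm_mellin_testFunction_le`). This beats the polynomial growth allowed by languidity, so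
the screen integral converges absolutely, is continuous in `φ`, and the horizontal sides disappear
in the limit. Replacing `φ` by `φ_a` multiplies the integrand at the screen point of height `t` by a
factor of modulus `a ^ (d - f t)`, whence the error estimate.

Since the screen is only Lipschitz, moving the contour needs a residue theorem for the region beside
a Lipschitz graph (`boundaryIntegral_eq_sum_residues`). It is obtained from a straight-line homotopy
for the analytic part and from explicit primitives for the polar parts. -/

theorem absolutelyContinuousOnInterval_comp_of_lipschitzWith {E F : Type*} [NormedAddCommGroup E]
    [NormedAddCommGroup F] {u : ℝ → E} {a b : ℝ}
    (hu : AbsolutelyContinuousOnInterval u a b) (p : E → F) (hp : LipschitzWith 1 p) :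
    AbsolutelyContinuousOnInterval (fun t => p (u t)) a b := by
  rw [absolutelyContinuousOnInterval_iff] at hu ⊢
  intro ε hε
  obtain ⟨δ, hδ, h⟩ := hu ε hε
  refine ⟨δ, hδ, fun E hE hE' => (Finset.sum_le_sum fun i _ => ?_).trans_lt (h E hE hE')⟩
  simpa using hp.dist_le_mul (u (E.2 i).1) (u (E.2 i).2)

/-- Real and imaginary parts are 1-Lipschitz images of `u`, so the real fundamental theorem of
calculus applies to each. Almost everywhere differentiability suffices, which is all that a
Lipschitz screen provides. -/
theorem intervalIntegrable_and_integral_eq_sub_of_absolutelyContinuousOnInterval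
    {u u' : ℝ → ℂ} {a b : ℝ}
    (hu : AbsolutelyContinuousOnInterval u a b)
    (hd : ∀ᵐ t, t ∈ uIcc a b → HasDerivAt u (u' t) t) :
    IntervalIntegrable u' volume a b ∧ ∫ t in a..b, u' t = u b - u a := by
  have hre := absolutelyContinuousOnInterval_comp_of_lipschitzWith hu Complex.re
    (LipschitzWith.of_dist_le_mul fun x y => by
      simpa [dist_eq_norm, Real.dist_eq] using Complex.abs_re_le_norm (x - y))
  have him := absolutelyContinuousOnInterval_comp_of_lipschitzWith hu Complex.im
    (LipschitzWith.of_dist_le_mul fun x y => by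
      simpa [dist_eq_norm, Real.dist_eq] using Complex.abs_im_le_norm (x - y))
  have hae : ∀ᵐ t, t ∈ uIcc a b → u' t = ((deriv (fun t => (u t).re) t : ℝ) : ℂ)
      + ((deriv (fun t => (u t).im) t : ℝ) : ℂ) * Complex.I := by
    filter_upwards [hd] with t ht hmem
    have h := ht hmem
    have h1 : HasDerivAt (fun t => (u t).re) (u' t).re t :=
      Complex.reCLM.hasFDerivAt.comp_hasDerivAt t h
    have h2 : HasDerivAt (fun t => (u t).im) (u' t).im t :=
      Complex.imCLM.hasFDerivAt.comp_hasDerivAt t h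
    rw [h1.deriv, h2.deriv, Complex.re_add_im]
  have hI1 : IntervalIntegrable (fun t => ((deriv (fun t => (u t).re) t : ℝ) : ℂ)) volume a b :=
    ⟨hre.intervalIntegrable_deriv.1.ofReal, hre.intervalIntegrable_deriv.2.ofReal⟩
  have hI2 : IntervalIntegrable (fun t => ((deriv (fun t => (u t).im) t : ℝ) : ℂ)) volume a b :=
    ⟨him.intervalIntegrable_deriv.1.ofReal, him.intervalIntegrable_deriv.2.ofReal⟩
  constructor
  · refine (hI1.add (hI2.mul_const Complex.I)).congr_ae ?_
    rw [Filter.EventuallyEq, ae_restrict_iff' measurableSet_uIoc]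
    filter_upwards [hae] with t ht hmem
    exact (ht (uIoc_subset_uIcc hmem)).symm
  · rw [intervalIntegral.integral_congr_ae
      (g := fun t => ((deriv (fun t => (u t).re) t : ℝ) : ℂ)
      + ((deriv (fun t => (u t).im) t : ℝ) : ℂ) * Complex.I),
      intervalIntegral.integral_add hI1 (hI2.mul_const _),
      intervalIntegral.integral_mul_const, intervalIntegral.integral_ofReal,
      intervalIntegral.integral_ofReal, hre.integral_deriv_eq_sub, him.integral_deriv_eq_sub]
    · apply Complex.ext <;> simp
    · filter_upwards [hae] with t ht hmem
      exact ht (uIoc_subset_uIcc hmem)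

/-- Analytic functions are C¹, hence locally Lipschitz, and compactness of the interval makes the
composite Lipschitz. -/
theorem absolutelyContinuousOnInterval_comp_of_analyticAt {G : ℂ → ℂ} {γ : ℝ → ℂ} {a b : ℝ}
    {C : NNReal} (hγ : LipschitzWith C γ) (hG : ∀ t ∈ uIcc a b, AnalyticAt ℂ G (γ t)) :
    AbsolutelyContinuousOnInterval (fun t => G (γ t)) a b := by
  have : LocallyLipschitzOn (uIcc a b) fun t => G (γ t) := by
    intro t ht
    obtain ⟨K, s, hs, hK⟩ :=
      ((hG t ht).contDiffAt (n := 1)).exists_lipschitzOnWith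
    refine ⟨K * C, γ ⁻¹' s, ?_, hK.comp hγ.lipschitzOnWith fun x hx => hx⟩
    exact mem_nhdsWithin_of_mem_nhds (hγ.continuous.continuousAt hs)
  obtain ⟨K, hK⟩ := this.exists_lipschitzOnWith_of_compact isCompact_uIcc
  exact hK.absolutelyContinuousOnInterval

/-- The curve interpolating linearly between the graph of `f` and the vertical line `Re = c`. -/
noncomputable def interpolatedCurve (f : ℝ → ℝ) (c l t : ℝ) : ℂ :=
  ((f t + l * (c - f t) : ℝ) : ℂ) + (t : ℂ) * Complex.I

@[simp] theorem interpolatedCurve_re (f : ℝ → ℝ) (c l t : ℝ) :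
    (interpolatedCurve f c l t).re = f t + l * (c - f t) := by
  simp [interpolatedCurve, -Complex.ofReal_add]

@[simp] theorem interpolatedCurve_im (f : ℝ → ℝ) (c l t : ℝ) :
    (interpolatedCurve f c l t).im = t := by
  simp [interpolatedCurve, -Complex.ofReal_add]

theorem interpolatedCurve_zero (f : ℝ → ℝ) (c t : ℝ) :
    interpolatedCurve f c 0 t = screenPoint f t := by
  simp [interpolatedCurve, screenPoint]

theorem interpolatedCurve_one (f : ℝ → ℝ) (c t : ℝ) :
    interpolatedCurve f c 1 t = (c : ℂ) + (t : ℂ) * Complex.I := by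
  simp [interpolatedCurve]

theorem lipschitzWith_interpolatedCurve {f : ℝ → ℝ} {K : NNReal} (hf : LipschitzWith K f)
    (c l : ℝ) : ∃ C, LipschitzWith C (interpolatedCurve f c l) := by
  refine ⟨⟨|1 - l| * K + 1, by positivity⟩, LipschitzWith.of_dist_le_mul fun x y => ?_⟩
  have h1 := hf.dist_le_mul x y
  rw [Real.dist_eq, Real.dist_eq] at h1
  have h2 : interpolatedCurve f c l x - interpolatedCurve f c l y =
      (((1 - l) * (f x - f y) : ℝ) : ℂ) + ((x - y : ℝ) : ℂ) * Complex.I := by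
    simp only [interpolatedCurve]; push_cast; ring
  rw [dist_eq_norm, h2, Real.dist_eq]
  refine (norm_add_le _ _).trans ?_
  rw [norm_mul, Complex.norm_real, Complex.norm_real, Complex.norm_I, Real.norm_eq_abs,
    Real.norm_eq_abs, abs_mul]
  change _ ≤ (|1 - l| * (K : ℝ) + 1) * |x - y|
  nlinarith [mul_le_mul_of_nonneg_left h1 (abs_nonneg (1 - l))]

theorem hasDerivAt_interpolatedCurve {f : ℝ → ℝ} {c l t : ℝ} (hf : DifferentiableAt ℝ f t) :
    HasDerivAt (interpolatedCurve f c l) (((1 - l : ℝ) : ℂ) * ((deriv f t : ℝ) : ℂ) + Complex.I) t := by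
  have h1 : HasDerivAt (fun t => f t + l * (c - f t)) (deriv f t + l * (0 - deriv f t)) t :=
    hf.hasDerivAt.add (((hasDerivAt_const t c).sub hf.hasDerivAt).const_mul l)
  have h2 := h1.ofReal_comp.add ((hasDerivAt_id t).ofReal_comp.mul_const Complex.I)
  refine h2.congr_deriv ?_
  push_cast; ring

theorem integral_screenIntegrand_of_hasDerivAt {f : ℝ → ℝ} {K : NNReal} (hf : LipschitzWith K f)
    {G g : ℂ → ℂ} {a b : ℝ} (hG : ∀ t ∈ uIcc a b, AnalyticAt ℂ G (screenPoint f t))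
    (hg : ∀ t ∈ uIcc a b, HasDerivAt G (g (screenPoint f t)) (screenPoint f t)) :
    IntervalIntegrable (screenIntegrand f g) volume a b ∧
      ∫ t in a..b, screenIntegrand f g t = G (screenPoint f b) - G (screenPoint f a) := by
  obtain ⟨C, hC⟩ := lipschitzWith_interpolatedCurve hf 0 0
  have e : interpolatedCurve f 0 0 = screenPoint f := funext (interpolatedCurve_zero f 0)
  rw [e] at hC
  refine intervalIntegrable_and_integral_eq_sub_of_absolutelyContinuousOnInterval
    (absolutelyContinuousOnInterval_comp_of_analyticAt hC hG) ?_
  filter_upwards [hf.ae_differentiableAt_real] with t ht hmem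
  have h := hasDerivAt_interpolatedCurve (c := 0) (l := 0) ht
  rw [e] at h
  have := (hg t hmem).scomp t h
  refine this.congr_deriv ?_
  simp [screenIntegrand, mul_comm]

end FractalSpray


namespace FractalSpray

/-! ### Cauchy's theorem for the region between a Lipschitz graph and a vertical line -/

/-- The region between the graph of `f` and the line `Re = c`, at heights between `a` and `b`. -/
def graphRegion (f : ℝ → ℝ) (a b c : ℝ) : Set ℂ :=
  {z | a ≤ z.im ∧ z.im ≤ b ∧ f z.im ≤ z.re ∧ z.re ≤ c}

/-- Integrability of `F` along the four sides of `graphRegion f a b c`. -/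
structure BoundaryIntegrable (f : ℝ → ℝ) (a b c : ℝ) (F : ℂ → ℂ) : Prop where
  bottom : IntervalIntegrable (fun σ : ℝ => F (σ + a * Complex.I)) volume (f a) c
  top : IntervalIntegrable (fun σ : ℝ => F (σ + b * Complex.I)) volume (f b) c
  right : IntervalIntegrable (fun t : ℝ => F (c + t * Complex.I)) volume a b
  screen : IntervalIntegrable (screenIntegrand f F) volume a b

/-- The integral of `F` along the positively oriented boundary of `graphRegion f a b c`. -/
noncomputable def boundaryIntegral (f : ℝ → ℝ) (a b c : ℝ) (F : ℂ → ℂ) : ℂ :=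
  (∫ σ in f a..c, F (σ + a * Complex.I)) + (∫ t in a..b, F (c + t * Complex.I)) * Complex.I
    - (∫ σ in f b..c, F (σ + b * Complex.I)) - ∫ t in a..b, screenIntegrand f F t

section Boundary

variable {f : ℝ → ℝ} {a b c : ℝ} {F G : ℂ → ℂ}

theorem BoundaryIntegrable.add (hF : BoundaryIntegrable f a b c F)
    (hG : BoundaryIntegrable f a b c G) : BoundaryIntegrable f a b c (fun z => F z + G z) where
  bottom := hF.bottom.add hG.bottom
  top := hF.top.add hG.top
  right := hF.right.add hG.right
  screen := (hF.screen.add hG.screen).congr fun t _ => by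
    simp only [screenIntegrand, add_mul]

theorem boundaryIntegral_add (hF : BoundaryIntegrable f a b c F)
    (hG : BoundaryIntegrable f a b c G) : boundaryIntegral f a b c (fun z => F z + G z) =
      boundaryIntegral f a b c F + boundaryIntegral f a b c G := by
  have h := intervalIntegral.integral_add hF.screen hG.screen
  simp only [screenIntegrand] at h
  simp only [boundaryIntegral, intervalIntegral.integral_add hF.bottom hG.bottom,
    intervalIntegral.integral_add hF.top hG.top, intervalIntegral.integral_add hF.right hG.right,
    screenIntegrand, add_mul, h]
  ring

theorem BoundaryIntegrable.const_mul (hF : BoundaryIntegrable f a b c F) (r : ℂ) :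
    BoundaryIntegrable f a b c (fun z => r * F z) where
  bottom := hF.bottom.const_mul r
  top := hF.top.const_mul r
  right := hF.right.const_mul r
  screen := (hF.screen.const_mul r).congr fun t _ => by
    simp only [screenIntegrand, mul_assoc]

theorem boundaryIntegral_const_mul (r : ℂ) : boundaryIntegral f a b c (fun z => r * F z) =
    r * boundaryIntegral f a b c F := by
  simp only [boundaryIntegral, intervalIntegral.integral_const_mul, screenIntegrand, mul_assoc]
  ring

/-- An injective curve meets a finite set at finitely many parameters, a null set. This is what
allows arbitrary values of a meromorphic function at isolated points to be ignored in all contour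
integrals. -/
theorem ae_comp_of_finite_ne {E : Set ℂ} (hE : E.Finite) {p : ℝ → ℂ} (hp : Function.Injective p)
    {s : Set ℝ} (hEq : ∀ t ∈ s, p t ∉ E → F (p t) = G (p t)) :
    ∀ᵐ t, t ∈ s → F (p t) = G (p t) := by
  have : (p ⁻¹' E).Finite := hE.preimage hp.injOn
  filter_upwards [this.countable.ae_notMem volume] with t ht hs
  exact hEq t hs ht

theorem injective_horizontal (y : ℝ) :
    Function.Injective fun σ : ℝ => (σ : ℂ) + (y : ℂ) * Complex.I := fun s t h => by
  simpa using congrArg Complex.re h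

theorem injective_vertical (x : ℝ) :
    Function.Injective fun t : ℝ => (x : ℂ) + (t : ℂ) * Complex.I := fun s t h => by
  simpa using congrArg Complex.im h

@[simp] theorem screenPoint_re (t : ℝ) : (screenPoint f t).re = f t := by simp [screenPoint]

@[simp] theorem screenPoint_im (t : ℝ) : (screenPoint f t).im = t := by simp [screenPoint]

theorem injective_screenPoint : Function.Injective (screenPoint f) := fun s t h => by
  simpa using congrArg Complex.im h

theorem ae_boundary_eq (hab : a ≤ b) (hfc : ∀ t ∈ Icc a b, f t ≤ c) {E : Set ℂ} (hE : E.Finite)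
    (hFG : ∀ z ∈ graphRegion f a b c, z ∉ E → F z = G z) :
    (∀ᵐ σ : ℝ, σ ∈ uIoc (f a) c → F (σ + a * Complex.I) = G (σ + a * Complex.I)) ∧
    (∀ᵐ σ : ℝ, σ ∈ uIoc (f b) c → F (σ + b * Complex.I) = G (σ + b * Complex.I)) ∧
    (∀ᵐ t : ℝ, t ∈ uIoc a b → F (c + t * Complex.I) = G (c + t * Complex.I)) ∧
    (∀ᵐ t : ℝ, t ∈ uIoc a b → screenIntegrand f F t = screenIntegrand f G t) := by
  have ha := hfc a ⟨le_rfl, hab⟩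
  have hb := hfc b ⟨hab, le_rfl⟩
  refine ⟨ae_comp_of_finite_ne hE (injective_horizontal a) fun t ht => hFG _ ?_,
    ae_comp_of_finite_ne hE (injective_horizontal b) fun t ht => hFG _ ?_,
    ae_comp_of_finite_ne hE (injective_vertical c) fun t ht => hFG _ ?_, ?_⟩
  · rw [uIoc_of_le ha] at ht
    simp [graphRegion, hab, ht.1.le, ht.2]
  · rw [uIoc_of_le hb] at ht
    simp [graphRegion, hab, ht.1.le, ht.2]
  · rw [uIoc_of_le hab] at ht
    simp [graphRegion, ht.1.le, ht.2, hfc t ⟨ht.1.le, ht.2⟩]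
  · have := ae_comp_of_finite_ne hE (injective_screenPoint (f := f)) (s := uIoc a b) (F := F)
      (G := G) fun t ht => hFG _ ?_
    · filter_upwards [this] with t ht hmem
      simp only [screenIntegrand, ht hmem]
    · rw [uIoc_of_le hab] at ht
      simp [graphRegion, ht.1.le, ht.2, hfc t ⟨ht.1.le, ht.2⟩]

theorem BoundaryIntegrable.congr_of_finite (hab : a ≤ b) (hfc : ∀ t ∈ Icc a b, f t ≤ c)
    {E : Set ℂ} (hE : E.Finite) (hFG : ∀ z ∈ graphRegion f a b c, z ∉ E → F z = G z)
    (hF : BoundaryIntegrable f a b c F) : BoundaryIntegrable f a b c G := by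
  obtain ⟨h1, h2, h3, h4⟩ := ae_boundary_eq hab hfc hE hFG
  exact ⟨hF.bottom.congr_ae ((ae_restrict_iff' measurableSet_uIoc).2 h1),
    hF.top.congr_ae ((ae_restrict_iff' measurableSet_uIoc).2 h2),
    hF.right.congr_ae ((ae_restrict_iff' measurableSet_uIoc).2 h3),
    hF.screen.congr_ae ((ae_restrict_iff' measurableSet_uIoc).2 h4)⟩

theorem boundaryIntegral_congr_of_finite (hab : a ≤ b) (hfc : ∀ t ∈ Icc a b, f t ≤ c)
    {E : Set ℂ} (hE : E.Finite) (hFG : ∀ z ∈ graphRegion f a b c, z ∉ E → F z = G z) :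
    boundaryIntegral f a b c F = boundaryIntegral f a b c G := by
  obtain ⟨h1, h2, h3, h4⟩ := ae_boundary_eq hab hfc hE hFG
  simp only [boundaryIntegral]
  rw [intervalIntegral.integral_congr_ae h1, intervalIntegral.integral_congr_ae h2,
    intervalIntegral.integral_congr_ae h3, intervalIntegral.integral_congr_ae h4]

theorem continuous_screenPoint (hf : Continuous f) : Continuous (screenPoint f) := by
  unfold screenPoint; fun_prop

theorem norm_deriv_add_I_le {K : NNReal} (hf : LipschitzWith K f) (t : ℝ) :
    ‖((deriv f t : ℝ) : ℂ) + Complex.I‖ ≤ K + 1 := by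
  refine (norm_add_le _ _).trans ?_
  rw [Complex.norm_I, Complex.norm_real]
  gcongr
  exact norm_deriv_le_of_lipschitz hf

theorem measurable_deriv_add_I : Measurable fun t => ((deriv f t : ℝ) : ℂ) + Complex.I :=
  (Complex.measurable_ofReal.comp (measurable_deriv f)).add_const _

theorem boundaryIntegrable_of_continuousOn {K : NNReal} (hf : LipschitzWith K f)
    (hab : a ≤ b) (hfc : ∀ t ∈ Icc a b, f t ≤ c)
    (hbot : ∀ σ ∈ Icc (f a) c, ContinuousAt F (σ + a * Complex.I))
    (htop : ∀ σ ∈ Icc (f b) c, ContinuousAt F (σ + b * Complex.I))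
    (hright : ∀ t ∈ Icc a b, ContinuousAt F (c + t * Complex.I))
    (hscreen : ∀ t ∈ Icc a b, ContinuousAt F (screenPoint f t)) :
    BoundaryIntegrable f a b c F := by
  have ha := hfc a ⟨le_rfl, hab⟩
  have hb := hfc b ⟨hab, le_rfl⟩
  refine ⟨ContinuousOn.intervalIntegrable fun t ht => ?_,
    ContinuousOn.intervalIntegrable fun t ht => ?_,
    ContinuousOn.intervalIntegrable fun t ht => ?_, ?_⟩
  · rw [uIcc_of_le ha] at ht
    exact ((hbot t ht).comp (f := fun σ : ℝ => (σ : ℂ) + a * Complex.I)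
      (by fun_prop)).continuousWithinAt
  · rw [uIcc_of_le hb] at ht
    exact ((htop t ht).comp (f := fun σ : ℝ => (σ : ℂ) + b * Complex.I)
      (by fun_prop)).continuousWithinAt
  · rw [uIcc_of_le hab] at ht
    exact ((hright t ht).comp (f := fun t : ℝ => (c : ℂ) + t * Complex.I)
      (by fun_prop)).continuousWithinAt
  · have h1 : IntervalIntegrable (fun t => F (screenPoint f t)) volume a b := by
      refine ContinuousOn.intervalIntegrable fun t ht => ?_
      rw [uIcc_of_le hab] at ht
      exact ((hscreen t ht).comp
        (continuous_screenPoint hf.continuous).continuousAt).continuousWithinAt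
    exact ⟨h1.1.mul_bdd (c := K + 1) measurable_deriv_add_I.aestronglyMeasurable
        (Eventually.of_forall (norm_deriv_add_I_le hf)),
      h1.2.mul_bdd (c := K + 1) measurable_deriv_add_I.aestronglyMeasurable
        (Eventually.of_forall (norm_deriv_add_I_le hf))⟩

theorem boundaryIntegrable_of_continuousAt {K : NNReal} (hf : LipschitzWith K f)
    (hab : a ≤ b) (hfc : ∀ t ∈ Icc a b, f t ≤ c)
    (hF : ∀ z ∈ graphRegion f a b c, ContinuousAt F z) :
    BoundaryIntegrable f a b c F := by
  refine boundaryIntegrable_of_continuousOn hf hab hfc (fun t ht => hF _ ?_) (fun t ht => hF _ ?_)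
    (fun t ht => hF _ ?_) (fun t ht => hF _ ?_)
  · simpa [graphRegion, hab] using ht
  · simpa [graphRegion, hab] using ht
  · simpa [graphRegion, hfc t ht] using ht
  · simpa [graphRegion, hfc t ht] using ht

theorem interpolatedCurve_mem_graphRegion {l t : ℝ} (hl : l ∈ Icc (0 : ℝ) 1) (ht : t ∈ Icc a b)
    (hfc : f t ≤ c) : interpolatedCurve f c l t ∈ graphRegion f a b c := by
  simp only [graphRegion, mem_ofPred_eq, interpolatedCurve_im, interpolatedCurve_re]
  refine ⟨ht.1, ht.2, ?_, ?_⟩ <;> nlinarith [hl.1, hl.2]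

theorem integral_interpolatedCurve_zero_one (F : ℂ → ℂ) (t : ℝ) :
    ∫ l in (0 : ℝ)..1, F (interpolatedCurve f c l t) * ((c - f t : ℝ) : ℂ) =
      ∫ σ in f t..c, F (σ + t * Complex.I) := by
  have := intervalIntegral.smul_integral_comp_mul_add (a := 0) (b := 1)
    (fun σ : ℝ => F (σ + t * Complex.I)) (c - f t) (f t)
  simp only [mul_zero, zero_add, mul_one, sub_add_cancel] at this
  rw [← this, intervalIntegral.integral_mul_const, Complex.real_smul, mul_comm]
  congr 1
  refine intervalIntegral.integral_congr fun l _ => ?_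
  simp only [interpolatedCurve]
  congr 3
  ring

/-- Let `Γ(l, t)` be the straight-line homotopy from the screen (`l = 0`) to the line `Re = c` (`l =
1`). Then `∂_l (F(Γ) ∂_t Γ)` and `∂_t (F(Γ) ∂_l Γ)` are the same function `m`; integrating it over
`[0,1] × [a,b]` in the two orders gives Cauchy's theorem. The only derivative of `f` involved is the
first, so Lipschitz regularity is enough. -/
theorem boundaryIntegral_eq_zero_of_analyticAt {K : NNReal} (hf : LipschitzWith K f)
    (hab : a ≤ b) (hfc : ∀ t ∈ Icc a b, f t ≤ c)
    (hF : ∀ z ∈ graphRegion f a b c, AnalyticAt ℂ F z) :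
    boundaryIntegral f a b c F = 0 := by
  set m : ℝ → ℝ → ℂ := fun l t =>
    deriv F (interpolatedCurve f c l t) *
      (((1 - l : ℝ) : ℂ) * ((deriv f t : ℝ) : ℂ) + Complex.I) * ((c - f t : ℝ) : ℂ)
      - F (interpolatedCurve f c l t) * ((deriv f t : ℝ) : ℂ) with hm
  have hint := boundaryIntegrable_of_continuousAt hf hab hfc fun z hz => (hF z hz).continuousAt
  have hΓ : Continuous fun p : ℝ × ℝ => interpolatedCurve f c p.1 p.2 := by
    have := hf.continuous
    unfold interpolatedCurve; fun_prop
  have hFc : ContinuousOn (fun p : ℝ × ℝ => F (interpolatedCurve f c p.1 p.2))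
      (Icc 0 1 ×ˢ Icc a b) := fun p hp =>
    ((hF _ (interpolatedCurve_mem_graphRegion hp.1 hp.2 (hfc _ hp.2))).continuousAt.comp
      (f := fun p : ℝ × ℝ => interpolatedCurve f c p.1 p.2) hΓ.continuousAt).continuousWithinAt
  have hF'c : ContinuousOn (fun p : ℝ × ℝ => deriv F (interpolatedCurve f c p.1 p.2))
      (Icc 0 1 ×ˢ Icc a b) := fun p hp =>
    ((hF _ (interpolatedCurve_mem_graphRegion hp.1 hp.2 (hfc _ hp.2))).deriv.continuousAt.comp
      (f := fun p : ℝ × ℝ => interpolatedCurve f c p.1 p.2) hΓ.continuousAt).continuousWithinAt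
  -- The derivative of `f` is merely bounded and measurable, so `m` is split into a continuous
  -- function plus a continuous function times that derivative.
  have hmint : IntegrableOn (Function.uncurry m) (Icc 0 1 ×ˢ Icc a b) := by
    have hcomp : IsCompact (Icc (0 : ℝ) 1 ×ˢ Icc a b) := isCompact_Icc.prod isCompact_Icc
    have hfcont := hf.continuous
    have h1 : IntegrableOn (fun p : ℝ × ℝ => deriv F (interpolatedCurve f c p.1 p.2) * Complex.I *
        ((c - f p.2 : ℝ) : ℂ)) (Icc 0 1 ×ˢ Icc a b) :=
      ContinuousOn.integrableOn_compact hcomp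
        ((hF'c.mul continuousOn_const).mul (by fun_prop))
    have h2 : IntegrableOn (fun p : ℝ × ℝ => deriv F (interpolatedCurve f c p.1 p.2) *
        ((1 - p.1 : ℝ) : ℂ) * ((c - f p.2 : ℝ) : ℂ) - F (interpolatedCurve f c p.1 p.2))
        (Icc 0 1 ×ˢ Icc a b) :=
      ContinuousOn.integrableOn_compact hcomp
        (((hF'c.mul (by fun_prop)).mul (by fun_prop)).sub hFc)
    have h3 := h2.mul_bdd (g := fun p : ℝ × ℝ => ((deriv f p.2 : ℝ) : ℂ)) (c := K)
      (Complex.measurable_ofReal.comp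
        ((measurable_deriv f).comp measurable_snd)).aestronglyMeasurable
      (Eventually.of_forall fun p => by
        rw [Complex.norm_real]; exact norm_deriv_le_of_lipschitz hf)
    refine (h1.add h3).congr (Eventually.of_forall fun p => ?_)
    simp only [hm, Function.uncurry, Pi.add_apply]
    ring
  have hmem {t : ℝ} (ht : t ∈ uIcc a b) : t ∈ Icc a b := by rwa [uIcc_of_le hab] at ht
  have hmem' {t : ℝ} (ht : t ∈ uIcc (0 : ℝ) 1) : t ∈ Icc (0 : ℝ) 1 := by
    rwa [uIcc_of_le zero_le_one] at ht
  have hinner : ∀ t ∈ Icc a b, ∫ l in (0 : ℝ)..1, m l t =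
      F (c + t * Complex.I) * Complex.I - screenIntegrand f F t := by
    intro t ht
    have hd : ∀ l ∈ uIcc (0 : ℝ) 1, HasDerivAt (fun l => F (interpolatedCurve f c l t) *
        (((1 - l : ℝ) : ℂ) * ((deriv f t : ℝ) : ℂ) + Complex.I)) (m l t) l := by
      intro l hl
      have hz := interpolatedCurve_mem_graphRegion (hmem' hl) ht (hfc t ht)
      have h1 : HasDerivAt (fun l => interpolatedCurve f c l t) ((c - f t : ℝ) : ℂ) l := by
        have := ((((hasDerivAt_id l).mul_const (c - f t)).const_add (f t)).ofReal_comp).add_const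
          ((t : ℂ) * Complex.I)
        simpa [interpolatedCurve] using this
      have h2 := ((hF _ hz).differentiableAt.hasDerivAt.scomp l h1)
      have h3 : HasDerivAt (fun l : ℝ => ((1 - l : ℝ) : ℂ) * ((deriv f t : ℝ) : ℂ) + Complex.I)
          (-((deriv f t : ℝ) : ℂ)) l := by
        have := ((((hasDerivAt_id l).const_sub 1).ofReal_comp).mul_const
          ((deriv f t : ℝ) : ℂ)).add_const Complex.I
        simpa using this
      refine (h2.mul h3).congr_deriv ?_
      simp only [hm, Function.comp, smul_eq_mul]
      ring
    have hcont : ContinuousOn (fun l => m l t) (uIcc (0 : ℝ) 1) := by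
      have hpair : Continuous fun l : ℝ => (l, t) := by fun_prop
      have hmaps : MapsTo (fun l : ℝ => (l, t)) (uIcc (0 : ℝ) 1) (Icc 0 1 ×ˢ Icc a b) :=
        fun l hl => ⟨hmem' hl, ht⟩
      have e1 := hFc.comp hpair.continuousOn hmaps
      have e2 := hF'c.comp hpair.continuousOn hmaps
      exact ((e2.mul (by fun_prop)).mul continuousOn_const).sub (e1.mul continuousOn_const)
    rw [intervalIntegral.integral_eq_sub_of_hasDerivAt hd hcont.intervalIntegrable]
    simp [interpolatedCurve_one, interpolatedCurve_zero, screenIntegrand]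
  have houter : ∀ l ∈ Icc (0 : ℝ) 1, ∫ t in a..b, m l t =
      F (interpolatedCurve f c l b) * ((c - f b : ℝ) : ℂ)
        - F (interpolatedCurve f c l a) * ((c - f a : ℝ) : ℂ) := by
    intro l hl
    obtain ⟨C, hC⟩ := lipschitzWith_interpolatedCurve hf c l
    have h1 := absolutelyContinuousOnInterval_comp_of_analyticAt (a := a) (b := b) hC
      fun t ht => hF _ (interpolatedCurve_mem_graphRegion hl (hmem ht) (hfc t (hmem ht)))
    have h2 : AbsolutelyContinuousOnInterval (fun t => ((c - f t : ℝ) : ℂ)) a b := by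
      have : LipschitzWith K fun t => ((c - f t : ℝ) : ℂ) :=
        LipschitzWith.of_dist_le_mul fun x y => by
          have := hf.dist_le_mul x y
          rw [dist_eq_norm, ← Complex.ofReal_sub, Complex.norm_real, ← dist_eq_norm]
          rwa [dist_eq_norm (c - f x), show c - f x - (c - f y) = -(f x - f y) by ring, norm_neg,
            ← dist_eq_norm]
      exact this.lipschitzOnWith.absolutelyContinuousOnInterval
    refine (intervalIntegrable_and_integral_eq_sub_of_absolutelyContinuousOnInterval
      (h1.smul h2) ?_).2
    filter_upwards [hf.ae_differentiableAt_real] with t ht htm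
    have hz := interpolatedCurve_mem_graphRegion hl (hmem htm) (hfc t (hmem htm))
    have e1 := (hF _ hz).differentiableAt.hasDerivAt.scomp t
      (hasDerivAt_interpolatedCurve (c := c) (l := l) ht)
    have e2 := (ht.hasDerivAt.const_sub c).ofReal_comp
    refine (e1.mul e2).congr_deriv ?_
    simp only [hm, Function.comp, smul_eq_mul, Complex.ofReal_neg]
    ring
  have hswap : ∫ t in a..b, ∫ l in (0 : ℝ)..1, m l t = ∫ l in (0 : ℝ)..1, ∫ t in a..b, m l t := by
    refine (intervalIntegral_intervalIntegral_swap ?_).symm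
    rw [uIoc_of_le zero_le_one, uIoc_of_le hab]
    exact hmint.mono_set (prod_mono Ioc_subset_Icc_self Ioc_subset_Icc_self)
  rw [intervalIntegral.integral_congr fun t ht => hinner t (hmem ht),
    intervalIntegral.integral_congr fun l hl => houter l (hmem' hl),
    intervalIntegral.integral_sub (hint.right.mul_const _) hint.screen,
    intervalIntegral.integral_mul_const, intervalIntegral.integral_sub,
    integral_interpolatedCurve_zero_one, integral_interpolatedCurve_zero_one] at hswap
  · simp only [boundaryIntegral]
    linear_combination hswap
  all_goals
    refine ContinuousOn.intervalIntegrable fun l hl => ?_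
    refine ContinuousWithinAt.mul ?_ continuousWithinAt_const
    have hpt : ∀ t ∈ Icc a b, ContinuousWithinAt (fun l => F (interpolatedCurve f c l t))
        (uIcc 0 1) l := fun t ht =>
      ((hF _ (interpolatedCurve_mem_graphRegion (hmem' hl) ht (hfc t ht))).continuousAt.comp
        (f := fun l : ℝ => interpolatedCurve f c l t)
        (hΓ.comp (by fun_prop : Continuous fun l : ℝ => (l, t))).continuousAt).continuousWithinAt
    first | exact hpt b ⟨hab, le_rfl⟩ | exact hpt a ⟨le_rfl, hab⟩

end Boundary

end FractalSpray


namespace FractalSpray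

/-! ### Residues -/

/-- Near `ω`, the function `F` is the sum of `r / (z - ω)`, of the derivative of a function that is
analytic away from `ω`, and of a function analytic at `ω`. -/
def HasResidueAt (F : ℂ → ℂ) (ω r : ℂ) : Prop :=
  ∃ Q h : ℂ → ℂ, (∀ z, z ≠ ω → AnalyticAt ℂ Q z) ∧ AnalyticAt ℂ h ω ∧
    ∀ᶠ z in 𝓝[≠] ω, F z = r * (z - ω)⁻¹ + deriv Q z + h z

/-- Induction on the pole order, through `g z = g ω + (z - ω) * dslope g ω z`. The leading term `g ω
* (z - ω)^(-(n+1))` is the derivative of `-(g ω / n) * (z - ω)^(-n)` when `n ≥ 1`, and contributes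
to the residue when `n = 0`. -/
theorem exists_hasResidueAt_inv_pow_mul (ω : ℂ) (n : ℕ) : ∀ g : ℂ → ℂ, AnalyticAt ℂ g ω →
    ∃ r, HasResidueAt (fun z => ((z - ω)⁻¹) ^ n * g z) ω r := by
  induction n with
  | zero =>
    intro g hg
    exact ⟨0, 0, g, fun _ _ => analyticAt_const, hg, Eventually.of_forall fun z => by simp⟩
  | succ n ih =>
    intro g hg
    have hg1 : AnalyticAt ℂ (dslope g ω) ω := by
      obtain ⟨p, hp⟩ := hg
      exact hp.has_fpower_series_dslope_fslope.analyticAt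
    obtain ⟨r, Q, h, hQ, hh, hev⟩ := ih _ hg1
    have key : ∀ z, z ≠ ω → ((z - ω)⁻¹) ^ (n + 1) * g z =
        ((z - ω)⁻¹) ^ (n + 1) * g ω + ((z - ω)⁻¹) ^ n * dslope g ω z := by
      intro z hz
      have hz' : z - ω ≠ 0 := sub_ne_zero.2 hz
      have := sub_smul_dslope g ω z
      rw [smul_eq_mul] at this
      have hp : ((z - ω)⁻¹) ^ (n + 1) * (z - ω) = ((z - ω)⁻¹) ^ n := by
        rw [pow_succ, mul_assoc, inv_mul_cancel₀ hz', mul_one]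
      linear_combination dslope g ω z * hp - ((z - ω)⁻¹) ^ (n + 1) * this
    rcases Nat.eq_zero_or_pos n with rfl | hn
    · refine ⟨r + g ω, Q, h, hQ, hh, ?_⟩
      filter_upwards [hev, self_mem_nhdsWithin] with z hz hne
      rw [key z hne, hz]
      ring
    · have han : ∀ z, z ≠ ω → AnalyticAt ℂ (fun z => ((z - ω)⁻¹) ^ n) z := fun z hz =>
        ((analyticAt_id.sub analyticAt_const).inv (sub_ne_zero.2 hz)).pow n
      refine ⟨r, fun z => Q z + (-(g ω) / n) * ((z - ω)⁻¹) ^ n, h, fun z hz =>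
        (hQ z hz).add (analyticAt_const.mul (han z hz)), hh, ?_⟩
      filter_upwards [hev, self_mem_nhdsWithin] with z hz hne
      have hz' : z - ω ≠ 0 := sub_ne_zero.2 hne
      have hd : HasDerivAt (fun z => ((z - ω)⁻¹) ^ n)
          (n * ((z - ω)⁻¹) ^ (n - 1) * (-1 / (z - ω) ^ 2)) z := by
        have := (((hasDerivAt_id z).sub_const ω).inv hz').pow n
        simpa using! this
      have hn' : (n : ℂ) ≠ 0 := Nat.cast_ne_zero.2 hn.ne'
      have hD : HasDerivAt (fun z => Q z + (-(g ω) / n) * ((z - ω)⁻¹) ^ n) _ z :=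
        (hQ z hne).differentiableAt.hasDerivAt.add (hd.const_mul _)
      rw [key z hne, hz, hD.deriv]
      obtain ⟨m, rfl⟩ : ∃ m, n = m + 1 := ⟨n - 1, by omega⟩
      have e : -(g ω) / ((m + 1 : ℕ) : ℂ) * (((m + 1 : ℕ) : ℂ) * ((z - ω)⁻¹) ^ (m + 1 - 1) *
          (-1 / (z - ω) ^ 2)) = ((z - ω)⁻¹) ^ (m + 1 + 1) * g ω := by
        rw [Nat.add_sub_cancel, neg_div ((z - ω) ^ 2), one_div]
        rw [div_mul_eq_mul_div, div_eq_iff hn', ← inv_pow]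
        ring
      rw [e]
      ring

theorem exists_hasResidueAt_of_meromorphicAt {F : ℂ → ℂ} {ω : ℂ} (hF : MeromorphicAt F ω) :
    ∃ r, HasResidueAt F ω r := by
  obtain ⟨n, hn⟩ := hF
  obtain ⟨r, Q, h, hQ, hh, hev⟩ := exists_hasResidueAt_inv_pow_mul ω n _ hn
  refine ⟨r, Q, h, hQ, hh, ?_⟩
  filter_upwards [hev, self_mem_nhdsWithin] with z hz hne
  have hz' : z - ω ≠ 0 := sub_ne_zero.2 hne
  rw [← hz, smul_eq_mul, ← mul_assoc, ← mul_pow, inv_mul_cancel₀ hz', one_pow, one_mul]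

/-- By Cauchy's theorem in an annulus the circle integral does not depend on the radius, so the
family whose limit is `residue` is eventually constant. -/
theorem residue_eq_circleIntegral {F : ℂ → ℂ} {ω : ℂ} {R ρ : ℝ}
    (hF : ∀ z ∈ Metric.ball ω R, z ≠ ω → DifferentiableAt ℂ F z) (hρ : 0 < ρ) (hρR : ρ < R) :
    residue F ω = (2 * (Real.pi : ℂ) * Complex.I)⁻¹ * ∮ s in C(ω, ρ), F s := by
  have hev : (fun r : ℝ => (2 * (Real.pi : ℂ) * Complex.I)⁻¹ * ∮ s in C(ω, r), F s) =ᶠ[𝓝[>] 0]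
      fun _ => (2 * (Real.pi : ℂ) * Complex.I)⁻¹ * ∮ s in C(ω, ρ), F s := by
    filter_upwards [Ioo_mem_nhdsGT hρ] with r hr
    rw [Complex.circleIntegral_eq_of_differentiable_on_annulus_off_countable hr.1 hr.2.le
      countable_empty]
    · rintro z ⟨hz1, hz2⟩
      refine (hF z (Metric.closedBall_subset_ball hρR hz1) ?_).continuousAt.continuousWithinAt
      rintro rfl
      exact hz2 (Metric.mem_ball_self hr.1)
    · rintro z ⟨⟨hz1, hz2⟩, -⟩
      refine hF z (Metric.ball_subset_ball hρR.le hz1) ?_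
      rintro rfl
      exact hz2 (Metric.mem_closedBall_self hr.1.le)
  exact (tendsto_const_nhds.congr' hev.symm).limUnder_eq

/-- On a small circle the exact part and the analytic part integrate to zero; only the simple pole
remains. -/
theorem HasResidueAt.residue_eq {F : ℂ → ℂ} {ω r : ℂ} (hF : HasResidueAt F ω r) :
    residue F ω = r := by
  obtain ⟨Q, h, hQ, hh, hev⟩ := hF
  have hev2 : ∀ᶠ z in 𝓝 ω, (z ≠ ω → F z = r * (z - ω)⁻¹ + deriv Q z + h z) ∧
      AnalyticAt ℂ h z := (eventually_nhdsWithin_iff.1 hev).and hh.eventually_analyticAt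
  obtain ⟨R, hR, hball⟩ := Metric.eventually_nhds_iff_ball.1 hev2
  have hdiff : ∀ z, z ≠ ω → DifferentiableAt ℂ (fun z => r * (z - ω)⁻¹ + deriv Q z) z :=
    fun z hz => ((differentiableAt_const r).mul
      ((differentiableAt_id.sub_const ω).inv (sub_ne_zero.2 hz))).add
      (hQ z hz).deriv.differentiableAt
  have hF' : ∀ z ∈ Metric.ball ω R, z ≠ ω → DifferentiableAt ℂ F z := by
    intro z hz hne
    refine ((hdiff z hne).add (hball z hz).2.differentiableAt).congr_of_eventuallyEq ?_
    filter_upwards [Metric.isOpen_ball.mem_nhds hz, isOpen_ne.mem_nhds hne] with w hw hw'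
    exact (hball w hw).1 hw'
  have hρ : 0 < R / 2 := half_pos hR
  rw [residue_eq_circleIntegral hF' hρ (half_lt_self hR)]
  have hne : ∀ z ∈ Metric.sphere ω (R / 2), z ≠ ω := by
    rintro z hz rfl
    simp [hρ.ne] at hz
  have hsub : Metric.closedBall ω (R / 2) ⊆ Metric.ball ω R :=
    Metric.closedBall_subset_ball (half_lt_self hR)
  have e : (∮ s in C(ω, R / 2), F s) =
      ∮ s in C(ω, R / 2), ((r * (s - ω)⁻¹ + deriv Q s) + h s) :=
    circleIntegral.integral_congr hρ.le fun z hz =>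
      (hball z (hsub (Metric.sphere_subset_closedBall hz))).1 (hne z hz)
  have c1 : ContinuousOn (fun s => r * (s - ω)⁻¹) (Metric.sphere ω (R / 2)) := fun z hz =>
    (continuousAt_const.mul ((continuousAt_id.sub continuousAt_const).inv₀
      (sub_ne_zero.2 (hne z hz)))).continuousWithinAt
  have c2 : ContinuousOn (deriv Q) (Metric.sphere ω (R / 2)) := fun z hz =>
    (hQ z (hne z hz)).deriv.continuousAt.continuousWithinAt
  have c3 : ContinuousOn h (Metric.sphere ω (R / 2)) := fun z hz =>
    (hball z (hsub (Metric.sphere_subset_closedBall hz))).2.continuousAt.continuousWithinAt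
  rw [e, circleIntegral.integral_add (f := fun s => r * (s - ω)⁻¹ + deriv Q s)
    ((c1.add c2).circleIntegrable hρ.le)
    (c3.circleIntegrable hρ.le), circleIntegral.integral_add (c1.circleIntegrable hρ.le)
    (c2.circleIntegrable hρ.le), circleIntegral.integral_const_mul,
    circleIntegral.integral_sub_center_inv ω hρ.ne',
    circleIntegral.integral_eq_zero_of_hasDerivWithinAt (f := Q) hρ.le fun z hz =>
      (hQ z (hne z hz)).differentiableAt.hasDerivAt.hasDerivWithinAt,
    Complex.circleIntegral_eq_zero_of_differentiable_on_off_countable hρ.le countable_empty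
      (fun z hz => (hball z (hsub hz)).2.continuousAt.continuousWithinAt)
      fun z hz => (hball z (hsub (Metric.ball_subset_closedBall hz.1))).2.differentiableAt]
  have := Complex.two_pi_I_ne_zero
  field_simp
  ring

/-! ### The residue theorem beside a Lipschitz graph -/

section Boundary

variable {f : ℝ → ℝ} {a b c : ℝ} {F G : ℂ → ℂ} {K : NNReal}

/-- One primitive serves the three straight sides and another the screen, so the boundary integral
is the change of their difference between the two ends of the screen. Two primitives are allowed
because no single branch of the logarithm works on the whole boundary. -/
theorem boundaryIntegral_eq_of_hasDerivAt (hf : LipschitzWith K f) (hab : a ≤ b)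
    (hfc : ∀ t ∈ Icc a b, f t ≤ c) {G₁ G₂ : ℂ → ℂ} (hF : BoundaryIntegrable f a b c F)
    (hbot : ∀ σ ∈ Icc (f a) c, HasDerivAt G₁ (F (σ + a * Complex.I)) (σ + a * Complex.I))
    (htop : ∀ σ ∈ Icc (f b) c, HasDerivAt G₁ (F (σ + b * Complex.I)) (σ + b * Complex.I))
    (hright : ∀ t ∈ Icc a b, HasDerivAt G₁ (F (c + t * Complex.I)) (c + t * Complex.I))
    (han : ∀ t ∈ Icc a b, AnalyticAt ℂ G₂ (screenPoint f t))
    (hscreen : ∀ t ∈ Icc a b, HasDerivAt G₂ (F (screenPoint f t)) (screenPoint f t)) :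
    boundaryIntegral f a b c F = (G₁ (screenPoint f b) - G₂ (screenPoint f b))
      - (G₁ (screenPoint f a) - G₂ (screenPoint f a)) := by
  have ha := hfc a ⟨le_rfl, hab⟩
  have hb := hfc b ⟨hab, le_rfl⟩
  have hor : ∀ (y : ℝ), f y ≤ c →
      (∀ σ ∈ Icc (f y) c, HasDerivAt G₁ (F (σ + y * Complex.I)) (σ + y * Complex.I)) →
      IntervalIntegrable (fun σ : ℝ => F (σ + y * Complex.I)) volume (f y) c →
      ∫ σ in f y..c, F (σ + y * Complex.I) = G₁ (c + y * Complex.I) - G₁ (screenPoint f y) := by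
    intro y hy hd hint
    rw [intervalIntegral.integral_eq_sub_of_hasDerivAt
      (f := fun σ : ℝ => G₁ (σ + y * Complex.I)) _ hint]
    · rfl
    · intro σ hσ
      rw [uIcc_of_le hy] at hσ
      have h1 : HasDerivAt (fun σ : ℝ => (σ : ℂ) + y * Complex.I) 1 σ := by
        simpa using ((hasDerivAt_id σ).ofReal_comp).add_const ((y : ℂ) * Complex.I)
      simpa using! (hd σ hσ).scomp σ h1
  have hver : (∫ t in a..b, F (c + t * Complex.I)) * Complex.I =
      G₁ (c + b * Complex.I) - G₁ (c + a * Complex.I) := by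
    rw [← intervalIntegral.integral_mul_const, intervalIntegral.integral_eq_sub_of_hasDerivAt
      (f := fun t : ℝ => G₁ (c + t * Complex.I)) _ (hF.right.mul_const _)]
    intro t ht
    rw [uIcc_of_le hab] at ht
    have h1 : HasDerivAt (fun t : ℝ => (c : ℂ) + t * Complex.I) Complex.I t := by
      simpa using (((hasDerivAt_id t).ofReal_comp).mul_const Complex.I).const_add (c : ℂ)
    simpa [mul_comm] using! (hright t ht).scomp t h1
  have hscr := (integral_screenIntegrand_of_hasDerivAt (g := F) hf (a := a) (b := b)
    (by rwa [uIcc_of_le hab]) (by rwa [uIcc_of_le hab])).2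
  rw [boundaryIntegral, hor a ha hbot hF.bottom, hor b hb htop hF.top, hver, hscr]
  ring

/-- The points of `graphRegion f a b c` that are not on its boundary. -/
def graphInterior (f : ℝ → ℝ) (a b c : ℝ) : Set ℂ :=
  {z | a < z.im ∧ z.im < b ∧ f z.im < z.re ∧ z.re < c}

theorem boundary_ne_of_mem_graphInterior {ω : ℂ} (hω : ω ∈ graphInterior f a b c) :
    (∀ σ : ℝ, (σ + a * Complex.I : ℂ) ≠ ω) ∧ (∀ σ : ℝ, (σ + b * Complex.I : ℂ) ≠ ω) ∧
    (∀ t : ℝ, (c + t * Complex.I : ℂ) ≠ ω) ∧ ∀ t : ℝ, screenPoint f t ≠ ω := by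
  obtain ⟨h1, h2, h3, h4⟩ := hω
  refine ⟨?_, ?_, ?_, ?_⟩ <;> rintro t rfl <;> simp at h1 h2 h3 h4

theorem boundaryIntegrable_of_continuousAt_of_ne (hf : LipschitzWith K f) (hab : a ≤ b)
    (hfc : ∀ t ∈ Icc a b, f t ≤ c) {ω : ℂ} (hω : ω ∈ graphInterior f a b c)
    (hF : ∀ z, z ≠ ω → ContinuousAt F z) : BoundaryIntegrable f a b c F := by
  obtain ⟨h1, h2, h3, h4⟩ := boundary_ne_of_mem_graphInterior hω
  exact boundaryIntegrable_of_continuousOn hf hab hfc (fun t _ => hF _ (h1 t))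
    (fun t _ => hF _ (h2 t)) (fun t _ => hF _ (h3 t)) (fun t _ => hF _ (h4 t))

theorem boundaryIntegral_deriv (hf : LipschitzWith K f) (hab : a ≤ b)
    (hfc : ∀ t ∈ Icc a b, f t ≤ c) {ω : ℂ} (hω : ω ∈ graphInterior f a b c) {Q : ℂ → ℂ}
    (hQ : ∀ z, z ≠ ω → AnalyticAt ℂ Q z) : boundaryIntegral f a b c (deriv Q) = 0 := by
  obtain ⟨h1, h2, h3, h4⟩ := boundary_ne_of_mem_graphInterior hω
  have hd : ∀ z, z ≠ ω → HasDerivAt Q (deriv Q z) z := fun z hz =>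
    (hQ z hz).differentiableAt.hasDerivAt
  rw [boundaryIntegral_eq_of_hasDerivAt hf hab hfc (G₁ := Q) (G₂ := Q)
    (boundaryIntegrable_of_continuousAt_of_ne hf hab hfc hω fun z hz =>
      (hQ z hz).deriv.continuousAt) (fun t _ => hd _ (h1 t))
    (fun t _ => hd _ (h2 t)) (fun t _ => hd _ (h3 t)) (fun t _ => hQ _ (h4 t))
    (fun t _ => hd _ (h4 t))]
  simp

/-- On the straight sides `log (z - ω)`, cut along the ray to the left of `ω`, is a primitive; on
the screen `log (ω - z)`, cut along the ray to the right, is one. Their difference is `πi` above the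
height of `ω` and `-πi` below it, and the jump is `2πi`. -/
theorem boundaryIntegral_inv_sub (hf : LipschitzWith K f) (hab : a ≤ b)
    (hfc : ∀ t ∈ Icc a b, f t ≤ c) {ω : ℂ} (hω : ω ∈ graphInterior f a b c) :
    boundaryIntegral f a b c (fun z => (z - ω)⁻¹) = 2 * Real.pi * Complex.I := by
  have hne := hω
  obtain ⟨ha, hb, hl, hr⟩ := hω
  have hd1 : ∀ z, z - ω ∈ Complex.slitPlane →
      HasDerivAt (fun z => Complex.log (z - ω)) (z - ω)⁻¹ z := fun z hz => by
    simpa using ((hasDerivAt_id z).sub_const ω).clog hz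
  have hd2 : ∀ z, ω - z ∈ Complex.slitPlane →
      HasDerivAt (fun z => Complex.log (ω - z)) (z - ω)⁻¹ z := fun z hz => by
    have := ((hasDerivAt_id z).const_sub ω).clog hz
    refine this.congr_deriv ?_
    rw [id, ← neg_sub ω z, inv_neg, neg_div, one_div]
  have hscr : ∀ t, ω - screenPoint f t ∈ Complex.slitPlane := fun t => by
    rw [Complex.mem_slitPlane_iff]
    simp only [Complex.sub_re, Complex.sub_im, screenPoint_re, screenPoint_im]
    rcases eq_or_ne ω.im t with h | h
    · left; rw [← h]; linarith
    · right; exact sub_ne_zero.2 h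
  rw [boundaryIntegral_eq_of_hasDerivAt hf hab hfc (G₁ := fun z => Complex.log (z - ω))
    (G₂ := fun z => Complex.log (ω - z))
    (F := fun z => (z - ω)⁻¹)
    (boundaryIntegrable_of_continuousAt_of_ne hf hab hfc hne fun z hz =>
      (continuousAt_id.sub continuousAt_const).inv₀ (sub_ne_zero.2 hz))
    (fun σ _ => hd1 _ ?_) (fun σ _ => hd1 _ ?_) (fun t _ => hd1 _ ?_) (fun t _ => ?_)
    (fun t _ => hd2 _ (hscr t))]
  · have hB : 0 < (screenPoint f b - ω).im := by simpa using hb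
    have hA : (screenPoint f a - ω).im < 0 := by simpa using ha
    rw [← neg_sub (screenPoint f b) ω, ← neg_sub (screenPoint f a) ω]
    simp only [Complex.log, norm_neg, Complex.arg_neg_eq_arg_sub_pi_of_im_pos hB,
      Complex.arg_neg_eq_arg_add_pi_of_im_neg hA]
    push_cast
    ring
  · rw [Complex.mem_slitPlane_iff]
    right
    simpa [sub_eq_zero] using ha.ne
  · rw [Complex.mem_slitPlane_iff]
    right
    simpa [sub_eq_zero] using hb.ne'
  · rw [Complex.mem_slitPlane_iff]
    left
    simpa using hr
  · exact (analyticAt_const.sub analyticAt_id).clog (hscr t)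

theorem isCompact_graphRegion (hf : Continuous f) (hfc : ∀ t ∈ Icc a b, f t ≤ c) :
    IsCompact (graphRegion f a b c) := by
  have hΓ : Continuous fun p : ℝ × ℝ => interpolatedCurve f c p.1 p.2 := by
    unfold interpolatedCurve; fun_prop
  have : graphRegion f a b c =
      (fun p : ℝ × ℝ => interpolatedCurve f c p.1 p.2) '' (Icc 0 1 ×ˢ Icc a b) := by
    ext z
    constructor
    · rintro ⟨h1, h2, h3, h4⟩
      -- Where the horizontal slice is a single point the quotient is `0` by the convention `x / 0 =
      -- 0`, and this parameter still gives `z`.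
      refine ⟨((z.re - f z.im) / (c - f z.im), z.im), ⟨⟨?_, ?_⟩, h1, h2⟩, ?_⟩
      · exact div_nonneg (by linarith) (by linarith)
      · exact div_le_one_of_le₀ (by linarith) (by linarith)
      · apply Complex.ext
        · rcases eq_or_ne (c - f z.im) 0 with h | h
          · simp [h]; linarith
          · simp [div_mul_cancel₀ _ h]
        · simp
    · rintro ⟨p, ⟨hp1, hp2⟩, rfl⟩
      exact interpolatedCurve_mem_graphRegion hp1 hp2 (hfc _ hp2)
  rw [this]
  exact (isCompact_Icc.prod isCompact_Icc).image hΓ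

/-- `F` agrees near `z`, apart from its value at `z`, with a function analytic at `z`. -/
def IsRegularAt (F : ℂ → ℂ) (z : ℂ) : Prop := ∃ h : ℂ → ℂ, AnalyticAt ℂ h z ∧ F =ᶠ[𝓝[≠] z] h

theorem IsRegularAt.meromorphicAt {z : ℂ} (hF : IsRegularAt F z) : MeromorphicAt F z := by
  obtain ⟨h, hh, he⟩ := hF
  exact hh.meromorphicAt.congr he.symm

theorem _root_.AnalyticAt.isRegularAt {z : ℂ} (hF : AnalyticAt ℂ F z) : IsRegularAt F z :=
  ⟨F, hF, EventuallyEq.rfl⟩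

theorem IsRegularAt.sub {z : ℂ} (hF : IsRegularAt F z) (hG : IsRegularAt G z) :
    IsRegularAt (fun z => F z - G z) z := by
  obtain ⟨h, hh, he⟩ := hF
  obtain ⟨k, hk, he'⟩ := hG
  exact ⟨fun z => h z - k z, hh.sub hk, he.sub he'⟩

/-- The meromorphic normal form is the analytic representative. It agrees with `F` on a punctured
neighbourhood of every point of `s`, so the points of disagreement cannot accumulate in the compact
set. -/
theorem exists_finite_and_analyticAt_of_isRegularAt {s : Set ℂ} (hs : IsCompact s)
    (hF : ∀ z ∈ s, IsRegularAt F z) :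
    ∃ (E : Set ℂ) (h : ℂ → ℂ), E.Finite ∧ (∀ z ∈ s, AnalyticAt ℂ h z) ∧
      ∀ z ∈ s, z ∉ E → F z = h z := by
  have hmer : MeromorphicOn F s := fun z hz => (hF z hz).meromorphicAt
  refine ⟨{z ∈ s | F z ≠ toMeromorphicNFOn F s z}, toMeromorphicNFOn F s, ?_, ?_, ?_⟩
  · by_contra hinf
    obtain ⟨x, hx, hacc⟩ := Set.Infinite.exists_accPt_of_subset_isCompact hinf hs (sep_subset _ _)
    rw [accPt_iff_frequently_nhdsNE] at hacc
    refine hacc ?_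
    filter_upwards [hmer.toMeromorphicNFOn_eq_self_on_nhdsNE hx] with z hz
    simp [hz]
  · intro z hz
    rw [← (meromorphicNFOn_toMeromorphicNFOn F s hz).meromorphicOrderAt_nonneg_iff_analyticAt,
      meromorphicOrderAt_congr (hmer.toMeromorphicNFOn_eq_self_on_nhdsNE hz),
      (hmer z hz).meromorphicOrderAt_nonneg_iff]
    exact hF z hz
  · intro z hz hE
    by_contra hne
    exact hE ⟨hz, hne⟩

/-- The residue theorem for the region between a Lipschitz graph and a vertical line. -/
theorem boundaryIntegral_eq_sum_residues (hf : LipschitzWith K f) (hab : a ≤ b)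
    (hfc : ∀ t ∈ Icc a b, f t ≤ c) (S : Finset ℂ) (r : ℂ → ℂ) : ∀ F : ℂ → ℂ,
    (∀ ω ∈ S, ω ∈ graphInterior f a b c) → (∀ ω ∈ S, HasResidueAt F ω (r ω)) →
    (∀ z ∈ graphRegion f a b c, z ∉ S → IsRegularAt F z) →
    BoundaryIntegrable f a b c F ∧
      boundaryIntegral f a b c F = 2 * Real.pi * Complex.I * ∑ ω ∈ S, r ω := by
  classical
  induction S using Finset.induction_on with
  | empty =>
    intro F _ _ hreg
    obtain ⟨E, h, hE, hh, hEq⟩ := exists_finite_and_analyticAt_of_isRegularAt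
      (isCompact_graphRegion hf.continuous hfc) fun z hz => hreg z hz (by simp)
    constructor
    · exact (boundaryIntegrable_of_continuousAt hf hab hfc
        fun z hz => (hh z hz).continuousAt).congr_of_finite hab hfc hE
          fun z hz hzE => (hEq z hz hzE).symm
    · rw [boundaryIntegral_congr_of_finite hab hfc hE hEq,
        boundaryIntegral_eq_zero_of_analyticAt hf hab hfc hh]
      simp
  | insert ω S hω ih =>
    intro F hint hres hreg
    obtain ⟨Q, h, hQ, hh, hev⟩ := hres ω (Finset.mem_insert_self _ _)
    have hωint := hint ω (Finset.mem_insert_self _ _)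
    have hinv : ∀ z, z ≠ ω → AnalyticAt ℂ (fun z => (z - ω)⁻¹) z := fun z hz =>
      (analyticAt_id.sub analyticAt_const).inv (sub_ne_zero.2 hz)
    -- Subtracting the polar part at `ω` makes `ω` a regular point. As this part is analytic
    -- elsewhere, the residues at the other points do not change and the induction hypothesis
    -- applies.
    set P : ℂ → ℂ := fun z => r ω * (z - ω)⁻¹ + deriv Q z with hP
    have hPan : ∀ z, z ≠ ω → AnalyticAt ℂ P z := fun z hz =>
      (analyticAt_const.mul (hinv z hz)).add (hQ z hz).deriv
    have i1 : BoundaryIntegrable f a b c (fun z => r ω * (z - ω)⁻¹) :=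
      (boundaryIntegrable_of_continuousAt_of_ne hf hab hfc hωint fun z hz =>
        (hinv z hz).continuousAt).const_mul _
    have i2 : BoundaryIntegrable f a b c (deriv Q) :=
      boundaryIntegrable_of_continuousAt_of_ne hf hab hfc hωint fun z hz =>
        (hQ z hz).deriv.continuousAt
    obtain ⟨iF, eF⟩ := ih (fun z => F z - P z)
      (fun ω' h' => hint ω' (Finset.mem_insert_of_mem h'))
      (fun ω' h' => by
        have hne : ω' ≠ ω := fun e => hω (e ▸ h')
        obtain ⟨Q', k, hQ', hk, hev'⟩ := hres ω' (Finset.mem_insert_of_mem h')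
        refine ⟨Q', fun z => k z - P z, hQ', hk.sub (hPan ω' hne), ?_⟩
        filter_upwards [hev'] with z hz
        rw [hz]; ring)
      (fun z hz hzS => by
        rcases eq_or_ne z ω with rfl | hne
        · refine ⟨h, hh, ?_⟩
          filter_upwards [hev] with w hw
          rw [hw]; simp only [hP]; ring
        · exact (hreg z hz (by simp [hne, hzS])).sub (hPan z hne).isRegularAt)
    have hFe : F = fun z => (F z - P z) + P z := by ext z; ring
    constructor
    · rw [hFe]
      exact iF.add (i1.add i2)
    · rw [hFe, boundaryIntegral_add iF (i1.add i2), eF, boundaryIntegral_add i1 i2,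
        boundaryIntegral_const_mul, boundaryIntegral_inv_sub hf hab hfc hωint,
        boundaryIntegral_deriv hf hab hfc hωint hQ, Finset.sum_insert hω]
      ring

end Boundary

end FractalSpray


namespace FractalSpray

/-! ### Inner tubes of sprays -/

section Tubes

variable {d : ℕ}

theorem ne_univ_of_isBounded (hd : 1 ≤ d) {A : Set (EuclideanSpace ℝ (Fin d))} (hA : Bornology.IsBounded A) :
    A ≠ univ := by
  have : Nonempty (Fin d) := ⟨⟨0, hd⟩⟩
  rintro rfl
  exact NormedSpace.unbounded_univ ℝ (EuclideanSpace ℝ (Fin d)) hA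

theorem infDist_frontier_le_infDist_compl {A : Set (EuclideanSpace ℝ (Fin d))} (hA : A ≠ univ) {x : (EuclideanSpace ℝ (Fin d))} (hx : x ∈ A) :
    Metric.infDist x (frontier A) ≤ Metric.infDist x Aᶜ := by
  obtain ⟨y, hy, he⟩ := exists_mem_frontier_infDist_compl_eq_dist hx hA
  rw [he]
  exact Metric.infDist_le_dist_of_mem hy

/-- A boundary point of one tile lies in no other tile, since these are open and disjoint from it;
hence it is a boundary point of the union. Conversely the boundary of the union lies outside the
tile, and from inside the tile its complement is no nearer than its frontier. -/
theorem infDist_frontier_iUnion {Ω : ℕ → Set (EuclideanSpace ℝ (Fin d))}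
    (hdisj : Pairwise fun m n => Disjoint (Ω m) (Ω n)) (hopen : ∀ n, IsOpen (Ω n)) {n : ℕ}
    (hne : Ω n ≠ univ) {x : (EuclideanSpace ℝ (Fin d))} (hx : x ∈ Ω n) :
    Metric.infDist x (frontier (⋃ m, Ω m)) = Metric.infDist x (frontier (Ω n)) := by
  have hfr : (frontier (Ω n)).Nonempty := nonempty_frontier_iff.2 ⟨⟨x, hx⟩, hne⟩
  have hsub : frontier (Ω n) ⊆ frontier (⋃ m, Ω m) := by
    intro y hy
    rw [(hopen n).frontier_eq] at hy
    rw [(isOpen_iUnion hopen).frontier_eq]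
    refine ⟨closure_mono (subset_iUnion Ω n) hy.1, fun hmem => ?_⟩
    obtain ⟨m, hm⟩ := mem_iUnion.1 hmem
    have hmn : n ≠ m := fun e => hy.2 (e ▸ hm)
    exact (hdisj hmn).closure_left (hopen m) |>.le_bot ⟨hy.1, hm⟩
  refine le_antisymm (Metric.infDist_le_infDist_of_subset hsub hfr) ?_
  refine (infDist_frontier_le_infDist_compl hne hx).trans
    (Metric.infDist_le_infDist_of_subset ?_ (hfr.mono hsub))
  rw [(isOpen_iUnion hopen).frontier_eq]
  exact fun y hy hmem => hy.2 (mem_iUnion.2 ⟨n, hmem⟩)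

/-- Lebesgue measure is a normalised Hausdorff measure, hence invariant under every isometry; no
affine form of `e` is needed. -/
theorem innerTubeVolume_image_isometryEquiv (e : (EuclideanSpace ℝ (Fin d)) ≃ᵢ (EuclideanSpace ℝ (Fin d))) (A : Set (EuclideanSpace ℝ (Fin d))) (ε : ℝ) :
    innerTubeVolume (e '' A) ε = innerTubeVolume A ε := by
  have hset : {x ∈ e '' A | Metric.infDist x (frontier (e '' A)) ≤ ε} =
      e '' {x ∈ A | Metric.infDist x (frontier A) ≤ ε} := by
    have hfr : frontier (e '' A) = e '' frontier A := (e.toHomeomorph.image_frontier A).symm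
    ext y
    constructor
    · rintro ⟨⟨x, hx, rfl⟩, h⟩
      rw [hfr, Metric.infDist_image e.isometry] at h
      exact ⟨x, ⟨hx, h⟩, rfl⟩
    · rintro ⟨x, ⟨hx, h⟩, rfl⟩
      refine ⟨⟨x, hx, rfl⟩, ?_⟩
      rwa [hfr, Metric.infDist_image e.isometry]
  rw [innerTubeVolume, innerTubeVolume, hset, measureReal_def, measureReal_def,
    ← EuclideanSpace.euclideanHausdorffMeasure_eq_volume d,
    e.isometry.euclideanHausdorffMeasure_image]

theorem volume_real_image_isometryEquiv (e : (EuclideanSpace ℝ (Fin d)) ≃ᵢ (EuclideanSpace ℝ (Fin d))) (A : Set (EuclideanSpace ℝ (Fin d))) :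
    (volume : Measure (EuclideanSpace ℝ (Fin d))).real (e '' A) = (volume : Measure (EuclideanSpace ℝ (Fin d))).real A := by
  rw [measureReal_def, measureReal_def, ← EuclideanSpace.euclideanHausdorffMeasure_eq_volume d,
    e.isometry.euclideanHausdorffMeasure_image]

theorem volume_real_smul {l : ℝ} (hl : 0 < l) (A : Set (EuclideanSpace ℝ (Fin d))) :
    (volume : Measure (EuclideanSpace ℝ (Fin d))).real (l • A) = l ^ d * (volume : Measure (EuclideanSpace ℝ (Fin d))).real A := by
  rw [measureReal_def, measureReal_def, Measure.addHaar_smul, ENNReal.toReal_mul,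
    finrank_euclideanSpace_fin, abs_of_pos (pow_pos hl d), ENNReal.toReal_ofReal (by positivity)]

theorem innerTubeVolume_smul {l : ℝ} (hl : 0 < l) (A : Set (EuclideanSpace ℝ (Fin d))) (ε : ℝ) :
    innerTubeVolume (l • A) ε = l ^ d * innerTubeVolume A (ε / l) := by
  have hset : {x ∈ l • A | Metric.infDist x (frontier (l • A)) ≤ ε} =
      l • {x ∈ A | Metric.infDist x (frontier A) ≤ ε / l} := by
    have hfr : frontier (l • A) = l • frontier A :=
      ((Homeomorph.smulOfNeZero l hl.ne').image_frontier A).symm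
    have hle : ∀ x : (EuclideanSpace ℝ (Fin d)), Metric.infDist (l • x) (frontier (l • A)) ≤ ε ↔
        Metric.infDist x (frontier A) ≤ ε / l := fun x => by
      rw [hfr, infDist_smul₀ hl.ne', Real.norm_of_nonneg hl.le, le_div_iff₀' hl]
    ext y
    constructor
    · rintro ⟨⟨x, hx, rfl⟩, h⟩
      exact ⟨x, ⟨hx, (hle x).1 h⟩, rfl⟩
    · rintro ⟨x, ⟨hx, h⟩, rfl⟩
      exact ⟨⟨x, hx, rfl⟩, (hle x).2 h⟩
  rw [innerTubeVolume, hset, volume_real_smul hl, innerTubeVolume]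

theorem innerTubeVolume_nonneg (A : Set (EuclideanSpace ℝ (Fin d))) (ε : ℝ) : 0 ≤ innerTubeVolume A ε :=
  measureReal_nonneg

theorem innerTubeVolume_le_volume {A : Set (EuclideanSpace ℝ (Fin d))} (hA : Bornology.IsBounded A) (ε : ℝ) :
    innerTubeVolume A ε ≤ (volume : Measure (EuclideanSpace ℝ (Fin d))).real A :=
  measureReal_mono (sep_subset _ _) hA.measure_lt_top.ne

theorem monotone_innerTubeVolume {A : Set (EuclideanSpace ℝ (Fin d))} (hA : Bornology.IsBounded A) :
    Monotone (innerTubeVolume A) := fun _ _ h =>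
  measureReal_mono (fun _ hx => ⟨hx.1, hx.2.trans h⟩)
    ((hA.subset (sep_subset _ _)).measure_lt_top.ne)

theorem hasSum_volume_real_iUnion {B : ℕ → Set (EuclideanSpace ℝ (Fin d))} (hB : ∀ n, MeasurableSet (B n))
    (hdisj : Pairwise fun m n => Disjoint (B m) (B n)) (hbdd : Bornology.IsBounded (⋃ n, B n)) :
    HasSum (fun n => (volume : Measure (EuclideanSpace ℝ (Fin d))).real (B n)) ((volume : Measure (EuclideanSpace ℝ (Fin d))).real (⋃ n, B n)) := by
  have h := measure_iUnion (μ := (volume : Measure (EuclideanSpace ℝ (Fin d)))) hdisj hB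
  have hfin : ∑' n, (volume : Measure (EuclideanSpace ℝ (Fin d))) (B n) ≠ ⊤ := h ▸ hbdd.measure_lt_top.ne
  have hne : ∀ n, (volume : Measure (EuclideanSpace ℝ (Fin d))) (B n) ≠ ⊤ := fun n => ENNReal.ne_top_of_tsum_ne_top hfin n
  simp only [measureReal_def, h]
  rw [ENNReal.tsum_toReal_eq hne]
  exact ENNReal.hasSum_toReal hfin

/-- A ball of radius `r` contains its centre and a point at distance `r / 2` from it, so `r ≤ 2 *
diam G`. Boundedness makes the supremum in `inradius` a true one. -/
theorem inradius_set_bddAbove (hd : 1 ≤ d) {G : Set (EuclideanSpace ℝ (Fin d))} (hG : Bornology.IsBounded G) :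
    BddAbove {ε : ℝ | 0 < ε ∧ ∃ x, Metric.ball x ε ⊆ G} := by
  have : Nonempty (Fin d) := ⟨⟨0, hd⟩⟩
  refine ⟨2 * Metric.diam G, ?_⟩
  rintro r ⟨hr, x, hx⟩
  obtain ⟨v, hv⟩ := exists_norm_eq (EuclideanSpace ℝ (Fin d)) (c := r / 2) (by positivity)
  have h1 : x + v ∈ G := hx (by simp [hv, hr])
  have h2 := Metric.dist_le_diam_of_mem hG h1 (hx (Metric.mem_ball_self hr))
  rw [dist_eq_norm, add_sub_cancel_left, hv] at h2
  linarith

theorem inradius_pos (hd : 1 ≤ d) {G : Set (EuclideanSpace ℝ (Fin d))} (hG : IsGenerator G) : 0 < inradius G := by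
  obtain ⟨x, hx⟩ := hG.nonempty
  obtain ⟨r, hr, hball⟩ := Metric.isOpen_iff.1 hG.isOpen x hx
  exact hr.trans_le (le_csSup (inradius_set_bddAbove hd hG.isBounded) ⟨hr, x, hball⟩)

/-- The ball about `x` of radius the distance to the complement lies in `G`, so this distance is at
most the inradius, and the tube exhausts `G`. -/
theorem innerTubeVolume_of_inradius_le (hd : 1 ≤ d) {G : Set (EuclideanSpace ℝ (Fin d))} (hG : IsGenerator G) {ε : ℝ}
    (hε : inradius G ≤ ε) : innerTubeVolume G ε = (volume : Measure (EuclideanSpace ℝ (Fin d))).real G := by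
  have hne := ne_univ_of_isBounded hd hG.isBounded
  have : {x ∈ G | Metric.infDist x (frontier G) ≤ ε} = G := by
    refine sep_eq_self_iff_mem_true.2 fun x hx => ?_
    refine (infDist_frontier_le_infDist_compl hne hx).trans (le_trans ?_ hε)
    refine le_csSup (inradius_set_bddAbove hd hG.isBounded) ⟨?_, x, Metric.ball_infDist_compl_subset⟩
    exact (hG.isOpen.isClosed_compl.notMem_iff_infDist_pos (nonempty_compl.2 hne)).1 (by simpa)
  rw [innerTubeVolume, this]

theorem volume_real_pos_of_isGenerator {G : Set (EuclideanSpace ℝ (Fin d))} (hG : IsGenerator G) :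
    0 < (volume : Measure (EuclideanSpace ℝ (Fin d))).real G :=
  ENNReal.toReal_pos (hG.isOpen.measure_pos volume hG.nonempty).ne' hG.isBounded.measure_lt_top.ne

variable {T G : Set (EuclideanSpace ℝ (Fin d))} {ℓ : ℕ → ℝ}

theorem IsFractalSpray.hasSum_volume (hT : IsFractalSpray T G ℓ) (hG : IsGenerator G) :
    HasSum (fun n => ℓ n ^ d * (volume : Measure (EuclideanSpace ℝ (Fin d))).real G) ((volume : Measure (EuclideanSpace ℝ (Fin d))).real T) := by
  obtain ⟨Ω, hdisj, rfl, he⟩ := hT.tiles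
  have hvol : ∀ n, (volume : Measure (EuclideanSpace ℝ (Fin d))).real (Ω n) = ℓ n ^ d * (volume : Measure (EuclideanSpace ℝ (Fin d))).real G := by
    intro n
    obtain ⟨e, he⟩ := he n
    rw [he, volume_real_image_isometryEquiv, volume_real_smul (hT.ratio_pos n)]
  have hopen : ∀ n, IsOpen (Ω n) := fun n => by
    obtain ⟨e, he⟩ := he n
    rw [he]
    exact e.toHomeomorph.isOpenMap _ (hG.isOpen.smul₀ (hT.ratio_pos n).ne')
  simpa only [hvol] using hasSum_volume_real_iUnion (fun n => (hopen n).measurableSet) hdisj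
    hT.isBounded

/-- Inside each tile the distance to the boundary of `T` is the distance to the boundary of the
tile, so the tube of `T` is the disjoint union of the tubes of the tiles. -/
theorem IsFractalSpray.hasSum_innerTubeVolume (hd : 1 ≤ d) (hT : IsFractalSpray T G ℓ)
    (hG : IsGenerator G) (ε : ℝ) :
    HasSum (fun n => ℓ n ^ d * innerTubeVolume G (ε / ℓ n)) (innerTubeVolume T ε) := by
  obtain ⟨Ω, hdisj, rfl, he⟩ := hT.tiles
  have hopen : ∀ n, IsOpen (Ω n) := fun n => by
    obtain ⟨e, he⟩ := he n
    rw [he]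
    exact e.toHomeomorph.isOpenMap _ (hG.isOpen.smul₀ (hT.ratio_pos n).ne')
  have hne : ∀ n, Ω n ≠ univ := fun n =>
    ne_univ_of_isBounded hd (hT.isBounded.subset (subset_iUnion Ω n))
  set B : ℕ → Set (EuclideanSpace ℝ (Fin d)) := fun n => {x ∈ Ω n | Metric.infDist x (frontier (Ω n)) ≤ ε} with hB
  have hvol : ∀ n, (volume : Measure (EuclideanSpace ℝ (Fin d))).real (B n) = ℓ n ^ d * innerTubeVolume G (ε / ℓ n) := by
    intro n
    obtain ⟨e, he⟩ := he n
    rw [← innerTubeVolume_smul (hT.ratio_pos n), ← innerTubeVolume_image_isometryEquiv e, ← he]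
    rfl
  have hunion : {x ∈ ⋃ n, Ω n | Metric.infDist x (frontier (⋃ n, Ω n)) ≤ ε} = ⋃ n, B n := by
    ext x
    simp only [mem_sep_iff, mem_iUnion, hB]
    constructor
    · rintro ⟨⟨n, hn⟩, h⟩
      rw [infDist_frontier_iUnion hdisj hopen (hne n) hn] at h
      exact ⟨n, hn, h⟩
    · rintro ⟨n, hn, h⟩
      rw [← infDist_frontier_iUnion hdisj hopen (hne n) hn] at h
      exact ⟨⟨n, hn⟩, h⟩
  have hmeas : ∀ n, MeasurableSet (B n) := fun n =>
    (hopen n).measurableSet.inter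
      (measurableSet_le (Metric.continuous_infDist_pt _).measurable measurable_const)
  rw [innerTubeVolume, hunion]
  simp only [← hvol]
  refine hasSum_volume_real_iUnion hmeas
    (fun m n h => (hdisj h).mono (sep_subset _ _) (sep_subset _ _)) ?_
  exact hT.isBounded.subset (iUnion_mono fun n => sep_subset _ _)

/-- The tiles have finite total volume. This is the source of the convergence of the Dirichlet
series for `Re s ≥ d`. -/
theorem IsFractalSpray.summable_pow (hT : IsFractalSpray T G ℓ) (hG : IsGenerator G) :
    Summable fun n => ℓ n ^ d := by
  have h := (hT.hasSum_volume hG).summable.mul_right ((volume : Measure (EuclideanSpace ℝ (Fin d))).real G)⁻¹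
  refine h.congr fun n => ?_
  rw [mul_assoc, mul_inv_cancel₀ (volume_real_pos_of_isGenerator hG).ne', mul_one]

end Tubes

end FractalSpray


namespace FractalSpray

/-! ### Mellin transforms of test functions -/

theorem testFunction_eq_zero_of_notMem (φ : 𝓓(posReals, ℂ)) {K : Set ℝ} (hK : tsupport φ ⊆ K)
    {x : ℝ} (hx : x ∉ K) : φ x = 0 :=
  image_eq_zero_of_notMem_tsupport fun h => hx (hK h)

/-- The derivative of test functions on the half-line. -/
noncomputable def testDeriv : 𝓓(posReals, ℂ) →L[ℂ] 𝓓(posReals, ℂ) :=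
  TestFunction.lineDerivCLM ℂ (1 : ℝ)

theorem coe_testDeriv (φ : 𝓓(posReals, ℂ)) : ⇑(testDeriv φ) = deriv φ := by
  ext x
  rw [testDeriv, TestFunction.lineDerivCLM_apply_of_le (by simp), lineDeriv, deriv]
  have hd : DifferentiableAt ℝ φ x :=
    (φ.contDiff.differentiable (by simp)).differentiableAt
  have h := hd.hasDerivAt
  have h2 : HasDerivAt (fun t : ℝ => φ (x + t • (1 : ℝ))) (deriv φ x) 0 := by
    have h3 : HasDerivAt (fun t : ℝ => x + t • (1 : ℝ)) 1 0 := by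
      simpa using (hasDerivAt_id (0 : ℝ)).const_add x
    have h' : HasDerivAt φ (deriv φ x) (x + (0 : ℝ) • (1 : ℝ)) := by simpa using h
    simpa using! h'.scomp (0 : ℝ) h3
  exact h2.deriv

theorem tsupport_testDeriv_subset (φ : 𝓓(posReals, ℂ)) : tsupport (testDeriv φ) ⊆ tsupport φ := by
  rw [coe_testDeriv]
  exact tsupport_deriv_subset

theorem tsupport_testDeriv_pow_subset (φ : 𝓓(posReals, ℂ)) (N : ℕ) :
    tsupport ((testDeriv ^ N) φ) ⊆ tsupport φ := by
  induction N with
  | zero => simp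
  | succ N ih =>
    rw [pow_succ', mul_apply_eq_comp]
    exact (tsupport_testDeriv_subset _).trans ih

/-- The supremum norm of a test function. -/
noncomputable def testNorm (φ : 𝓓(posReals, ℂ)) : ℝ :=
  ‖TestFunction.toBoundedContinuousFunctionCLM ℂ φ‖

theorem norm_apply_le_testNorm (φ : 𝓓(posReals, ℂ)) (x : ℝ) : ‖φ x‖ ≤ testNorm φ :=
  (TestFunction.toBoundedContinuousFunctionCLM ℂ φ).norm_coe_le_norm x

theorem continuous_testNorm : Continuous testNorm :=
  (TestFunction.toBoundedContinuousFunctionCLM ℂ).continuous.norm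

theorem exists_subset_Icc_of_isCompact {K : Set ℝ} (hK : IsCompact K) (hK0 : K ⊆ Ioi 0) :
    ∃ M : ℝ, 1 ≤ M ∧ K ⊆ Icc M⁻¹ M := by
  rcases K.eq_empty_or_nonempty with rfl | hne
  · exact ⟨1, le_rfl, empty_subset _⟩
  obtain ⟨a, ha, hmin⟩ := hK.exists_isMinOn hne continuousOn_id
  obtain ⟨b, hb, hmax⟩ := hK.exists_isMaxOn hne continuousOn_id
  have ha0 : 0 < a := hK0 ha
  refine ⟨max 1 (max a⁻¹ b), le_max_left _ _, fun x hx => ⟨?_, ?_⟩⟩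
  · have h1 : a ≤ x := hmin hx
    refine le_trans ?_ h1
    rw [inv_le_comm₀ (by positivity) ha0]
    exact (le_max_left _ _).trans (le_max_right _ _)
  · have h1 : x ≤ b := hmax hx
    exact h1.trans ((le_max_right _ _).trans (le_max_right _ _))

theorem rpow_le_rpow_of_mem_Icc {M x B t : ℝ} (hM : 1 ≤ M) (hx : x ∈ Icc M⁻¹ M) (ht : |t| ≤ B) :
    x ^ t ≤ M ^ B := by
  have hM0 : 0 < M := by linarith
  have hx0 : 0 < x := (inv_pos.2 hM0).trans_le hx.1
  obtain ⟨h1, h2⟩ := abs_le.1 ht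
  rcases le_total 0 t with h | h
  · exact (Real.rpow_le_rpow hx0.le hx.2 h).trans (Real.rpow_le_rpow_of_exponent_le hM h2)
  · calc x ^ t ≤ (M⁻¹) ^ t := Real.rpow_le_rpow_of_nonpos (inv_pos.2 hM0) hx.1 h
      _ = M ^ (-t) := by rw [Real.inv_rpow hM0.le, Real.rpow_neg hM0.le]
      _ ≤ M ^ B := Real.rpow_le_rpow_of_exponent_le hM (by linarith)

theorem exists_tsupport_subset_Icc (φ : 𝓓(posReals, ℂ)) :
    ∃ M : ℝ, 1 ≤ M ∧ tsupport φ ⊆ Icc M⁻¹ M :=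
  exists_subset_Icc_of_isCompact φ.hasCompactSupport φ.tsupport_subset

theorem eventually_atTop_eq_zero (φ : 𝓓(posReals, ℂ)) : ∀ᶠ x in atTop, φ x = 0 := by
  obtain ⟨M, hM, hsub⟩ := exists_tsupport_subset_Icc φ
  filter_upwards [eventually_gt_atTop M] with x hx
  exact testFunction_eq_zero_of_notMem φ hsub fun h => hx.not_ge h.2

theorem eventually_nhds_zero_eq_zero (φ : 𝓓(posReals, ℂ)) : ∀ᶠ x in 𝓝 (0 : ℝ), φ x = 0 := by
  obtain ⟨M, hM, hsub⟩ := exists_tsupport_subset_Icc φ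
  have : (0 : ℝ) < M⁻¹ := inv_pos.2 (by linarith)
  filter_upwards [Iio_mem_nhds this] with x hx
  exact testFunction_eq_zero_of_notMem φ hsub fun h => hx.not_ge h.1

theorem isBigO_atTop_testFunction (φ : 𝓓(posReals, ℂ)) (a : ℝ) :
    φ =O[atTop] fun x : ℝ => x ^ a :=
  (Asymptotics.isBigO_zero (fun x : ℝ => x ^ a) atTop).congr'
    ((eventually_atTop_eq_zero φ).mono fun _ h => h.symm) EventuallyEq.rfl

theorem isBigO_nhdsGT_testFunction (φ : 𝓓(posReals, ℂ)) (a : ℝ) :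
    φ =O[𝓝[>] 0] fun x : ℝ => x ^ a :=
  (Asymptotics.isBigO_zero (fun x : ℝ => x ^ a) (𝓝[>] 0)).congr'
    ((eventually_nhdsWithin_of_eventually_nhds (eventually_nhds_zero_eq_zero φ)).mono
      fun _ h => h.symm) EventuallyEq.rfl

theorem mellinConvergent_testFunction (φ : 𝓓(posReals, ℂ)) (z : ℂ) : MellinConvergent φ z :=
  mellinConvergent_of_isBigO_rpow (a := z.re + 1) (b := z.re - 1)
    (φ.continuous.locallyIntegrable.locallyIntegrableOn _) (isBigO_atTop_testFunction φ _)
    (by linarith) (isBigO_nhdsGT_testFunction φ _) (by linarith)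

theorem differentiable_mellin_testFunction (φ : 𝓓(posReals, ℂ)) : Differentiable ℂ (mellin φ) :=
  fun z => mellin_differentiableAt_of_isBigO_rpow (a := z.re + 1) (b := z.re - 1)
    (φ.continuous.locallyIntegrable.locallyIntegrableOn _) (isBigO_atTop_testFunction φ _)
    (by linarith) (isBigO_nhdsGT_testFunction φ _) (by linarith)

theorem norm_mellin_testFunction_le {M B : ℝ} (hM : 1 ≤ M) {φ : 𝓓(posReals, ℂ)}
    (hφ : tsupport φ ⊆ Icc M⁻¹ M) {z : ℂ} (hz : |z.re| ≤ B) :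
    ‖mellin φ z‖ ≤ M ^ (B + 1) * (M - M⁻¹) * testNorm φ := by
  have hM0 : 0 < M := by linarith
  have hinv : (0 : ℝ) < M⁻¹ := inv_pos.2 hM0
  have hle : M⁻¹ ≤ M := (inv_le_one_of_one_le₀ hM).trans hM
  have e : mellin φ z = ∫ x in Icc M⁻¹ M, (x : ℂ) ^ (z - 1) • φ x := by
    rw [mellin]
    refine setIntegral_eq_of_subset_of_forall_sdiff_eq_zero measurableSet_Ioi
      (fun x hx => hinv.trans_le hx.1) fun x hx => ?_
    rw [testFunction_eq_zero_of_notMem φ hφ hx.2, smul_zero]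
  rw [e]
  refine (norm_setIntegral_le_of_norm_le_const (C := M ^ (B + 1) * testNorm φ)
    (by simp) fun x hx => ?_).trans ?_
  · rw [norm_smul, Complex.norm_cpow_eq_rpow_re_of_pos (hinv.trans_le hx.1)]
    refine mul_le_mul (rpow_le_rpow_of_mem_Icc hM hx ?_) (norm_apply_le_testNorm φ x)
      (norm_nonneg _) (by positivity)
    simp only [Complex.sub_re, Complex.one_re]
    exact (abs_sub _ _).trans (by simpa using hz)
  · rw [Real.volume_real_Icc_of_le hle]
    exact le_of_eq (by ring)

/-- Integration by parts; the boundary terms vanish because `φ` is zero near `0` and near infinity.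
-/
theorem mellin_testDeriv (φ : 𝓓(posReals, ℂ)) (z : ℂ) :
    mellin (testDeriv φ) (z + 1) = -(z * mellin φ z) := by
  have hd : ∀ x ∈ Ioi (0 : ℝ), HasDerivAt (fun x : ℝ => (x : ℂ) ^ z * φ x)
      (z * ((x : ℂ) ^ (z - 1) • φ x) + (x : ℂ) ^ (z + 1 - 1) • testDeriv φ x) x := by
    intro x hx
    have h1 : HasDerivAt (fun x : ℝ => (x : ℂ) ^ z) (z * (x : ℂ) ^ (z - 1)) x := by
      have := (hasDerivAt_id (x : ℂ)).cpow_const (c := z)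
        (Or.inl (by simpa using hx))
      simpa using! this.comp_ofReal
    have h2 : HasDerivAt φ (deriv φ x) x :=
      ((φ.contDiff.differentiable (by simp)).differentiableAt).hasDerivAt
    refine (h1.mul h2).congr_deriv ?_
    rw [coe_testDeriv, add_sub_cancel_right, smul_eq_mul, smul_eq_mul]
    ring
  have i1 := (mellinConvergent_testFunction φ z).const_mul z
  have i2 := mellinConvergent_testFunction (testDeriv φ) (z + 1)
  have hev0 : (fun x : ℝ => (x : ℂ) ^ z * φ x) =ᶠ[𝓝 0] fun _ => 0 := by
    filter_upwards [eventually_nhds_zero_eq_zero φ] with x hx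
    rw [hx, mul_zero]
  have hevt : (fun x : ℝ => (x : ℂ) ^ z * φ x) =ᶠ[atTop] fun _ => 0 := by
    filter_upwards [eventually_atTop_eq_zero φ] with x hx
    rw [hx, mul_zero]
  have h := integral_Ioi_of_hasDerivAt_of_tendsto (m := 0)
    (continuousAt_const.congr hev0.symm).continuousWithinAt hd (i1.add i2)
    (tendsto_const_nhds.congr' hevt.symm)
  rw [hev0.eq_of_nhds] at h
  rw [integral_add i1 i2, integral_const_mul, sub_zero] at h
  rw [mellin, mellin]
  linear_combination h

/-- Iterated integration by parts. Each step shifts `z` by `1`, which leaves its imaginary part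
alone, so every factor is at least `|z.im|`. -/
theorem abs_im_pow_mul_norm_mellin_le (N : ℕ) : ∀ (φ : 𝓓(posReals, ℂ)) (z : ℂ),
    |z.im| ^ N * ‖mellin φ z‖ ≤ ‖mellin ((testDeriv ^ N) φ) (z + N)‖ := by
  induction N with
  | zero => intro φ z; simp
  | succ N ih =>
    intro φ z
    have h := ih (testDeriv φ) (z + 1)
    rw [mellin_testDeriv, norm_neg, norm_mul] at h
    rw [pow_succ testDeriv, mul_apply_eq_comp]
    have e : z + ((N + 1 : ℕ) : ℂ) = z + 1 + N := by push_cast; ring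
    rw [e]
    refine le_trans ?_ h
    have him : (z + 1).im = z.im := by simp
    rw [him, pow_succ, mul_assoc]
    gcongr
    exact Complex.abs_im_le_norm z

/-- The basic decay estimate: the trivial bounds for `φ` and for its `N`-th derivative together
control both small and large heights. The constant depends only on the compact set `K`, the strip
and `N`, which is what continuity in `φ` requires. -/
theorem exists_norm_mellin_testFunction_le {K : Set ℝ} (hK : IsCompact K) (hK0 : K ⊆ Ioi 0)
    (B : ℝ) (N : ℕ) : ∃ C : ℝ, ∀ φ : 𝓓(posReals, ℂ), tsupport φ ⊆ K → ∀ z : ℂ, |z.re| ≤ B →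
      ‖mellin φ z‖ ≤ C * (testNorm φ + testNorm ((testDeriv ^ N) φ)) * ((1 + |z.im|) ^ N)⁻¹ := by
  obtain ⟨M, hM, hsub⟩ := exists_subset_Icc_of_isCompact hK hK0
  have hM0 : 0 < M := by linarith
  have hle : M⁻¹ ≤ M := (inv_le_one_of_one_le₀ hM).trans hM
  refine ⟨2 ^ N * (M ^ (B + N + 1) * (M - M⁻¹)), fun φ hφ z hz => ?_⟩
  have h1 := norm_mellin_testFunction_le hM (hφ.trans hsub) (z := z) (B := B + N)
    (hz.trans (by simp))
  have h2 := norm_mellin_testFunction_le hM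
    (((tsupport_testDeriv_pow_subset φ N).trans hφ).trans hsub) (z := z + N) (B := B + N) (by
      simp only [Complex.add_re, Complex.natCast_re]
      exact (abs_add_le _ _).trans (by simpa using hz))
  have h3 := (abs_im_pow_mul_norm_mellin_le N φ z).trans h2
  rw [← div_eq_mul_inv, le_div_iff₀ (by positivity)]
  have h4 : (1 + |z.im|) ^ N ≤ 2 ^ N * (1 + |z.im| ^ N) := by
    have h5 : (1 + |z.im|) ^ N ≤ (2 * max 1 |z.im|) ^ N := by
      gcongr
      have := le_max_left 1 |z.im|
      have := le_max_right 1 |z.im|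
      linarith
    refine h5.trans ?_
    rw [mul_pow]
    gcongr
    rcases max_cases 1 |z.im| with h | h
    · rw [h.1, one_pow]
      have : 0 ≤ |z.im| ^ N := by positivity
      linarith
    · rw [h.1]
      linarith
  calc ‖mellin φ z‖ * (1 + |z.im|) ^ N ≤ ‖mellin φ z‖ * (2 ^ N * (1 + |z.im| ^ N)) := by gcongr
    _ = 2 ^ N * (‖mellin φ z‖ + |z.im| ^ N * ‖mellin φ z‖) := by ring
    _ ≤ 2 ^ N * (M ^ (B + N + 1) * (M - M⁻¹) * testNorm φ +
        M ^ (B + N + 1) * (M - M⁻¹) * testNorm ((testDeriv ^ N) φ)) := by gcongr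
    _ = _ := by ring

/-! ### Functionals given by integrals of Mellin transforms -/

/-- Continuity on the test function space is tested on the functions supported in each compact set;
there an additive map need only be continuous at `0`, and the bound is continuous in `φ` and
vanishes at `0`. -/
theorem isDistribution_of_bound {A : (ℝ → ℂ) → ℂ}
    (hadd : ∀ φ ψ : 𝓓(posReals, ℂ), A (⇑(φ + ψ)) = A φ + A ψ)
    (hsmul : ∀ (c : ℂ) (φ : 𝓓(posReals, ℂ)), A (⇑(c • φ)) = c * A φ)
    (hbound : ∀ K : Set ℝ, IsCompact K → K ⊆ Ioi 0 → ∃ (N : ℕ) (C : ℝ), ∀ φ : 𝓓(posReals, ℂ),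
      tsupport φ ⊆ K → ‖A φ‖ ≤ C * (testNorm φ + testNorm ((testDeriv ^ N) φ))) :
    IsDistribution A := by
  refine ⟨TestFunction.mkCLM ℂ (fun φ : 𝓓(posReals, ℂ) => A φ) hadd
    (fun c φ => by simpa using hsmul c φ) fun K hK => ?_, fun φ => rfl⟩
  let L : ContDiffMapSupportedIn ℝ ℂ ⊤ K →+ ℂ :=
    { toFun := (fun φ : 𝓓(posReals, ℂ) => A φ) ∘ TestFunction.ofSupportedIn hK
      map_zero' := by
        have := hsmul 0 0
        simp only [zero_smul, zero_mul] at this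
        exact this
      map_add' := fun φ ψ =>
        hadd (TestFunction.ofSupportedIn hK φ) (TestFunction.ofSupportedIn hK ψ) }
  change Continuous L
  refine continuous_of_continuousAt_zero L ?_
  obtain ⟨N, C, hC⟩ := hbound K K.isCompact hK
  have hcont : Continuous fun φ : ContDiffMapSupportedIn ℝ ℂ ⊤ K =>
      C * (testNorm (TestFunction.ofSupportedIn hK φ) +
        testNorm ((testDeriv ^ N) (TestFunction.ofSupportedIn hK φ))) := by
    have h1 := TestFunction.continuous_ofSupportedIn (F := ℂ) (n := ⊤) hK
    exact continuous_const.mul ((continuous_testNorm.comp h1).add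
      (continuous_testNorm.comp ((testDeriv ^ N).continuous.comp h1)))
  rw [ContinuousAt, map_zero]
  refine squeeze_zero_norm (fun φ => hC _ φ.tsupport_subset) ?_
  have h0 := hcont.tendsto 0
  have hz : TestFunction.ofSupportedIn hK (0 : ContDiffMapSupportedIn ℝ ℂ ⊤ K) = 0 := rfl
  have hn : testNorm 0 = 0 := by simp only [testNorm, map_zero, norm_zero]
  rwa [hz, map_zero, hn, add_zero, mul_zero] at h0

theorem IsDistribution.congr {A A' : (ℝ → ℂ) → ℂ} (hA : IsDistribution A)
    (h : ∀ φ : 𝓓(posReals, ℂ), A' φ = A φ) : IsDistribution A' := by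
  obtain ⟨L, hL⟩ := hA
  exact ⟨L, fun φ => (hL φ).trans (h φ).symm⟩

theorem IsDistribution.const_mul {A : (ℝ → ℂ) → ℂ} (hA : IsDistribution A) (c : ℂ) :
    IsDistribution fun φ => c * A φ := by
  obtain ⟨L, hL⟩ := hA
  exact ⟨c • L, fun φ => by simp [hL]⟩

section MellinIntegral

variable {α : Type*} [MeasurableSpace α] {μ : Measure α} {w z : α → ℂ} {B : ℝ} {N : ℕ}

theorem integrable_mul_mellin (hw : AEStronglyMeasurable w μ) (hz : AEStronglyMeasurable z μ)
    (hB : ∀ t, |(z t).re| ≤ B) (hint : Integrable (fun t => ‖w t‖ * ((1 + |(z t).im|) ^ N)⁻¹) μ)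
    (φ : 𝓓(posReals, ℂ)) : Integrable (fun t => w t * mellin φ (z t)) μ := by
  obtain ⟨C, hC⟩ := exists_norm_mellin_testFunction_le φ.hasCompactSupport φ.tsupport_subset B N
  refine (hint.const_mul (C * (testNorm φ + testNorm ((testDeriv ^ N) φ)))).mono'
    (hw.mul ((differentiable_mellin_testFunction φ).continuous.comp_aestronglyMeasurable hz))
    (Eventually.of_forall fun t => ?_)
  rw [norm_mul]
  refine (mul_le_mul_of_nonneg_left (hC φ Subset.rfl (z t) (hB t)) (norm_nonneg _)).trans
    (le_of_eq (by ring))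

/-- A common source for both kinds of distribution: a circle around a pole gives the residues, the
screen gives the error term. -/
theorem isDistribution_integral_mul_mellin (hw : AEStronglyMeasurable w μ)
    (hz : AEStronglyMeasurable z μ) (hB : ∀ t, |(z t).re| ≤ B)
    (hint : Integrable (fun t => ‖w t‖ * ((1 + |(z t).im|) ^ N)⁻¹) μ) :
    IsDistribution fun φ => ∫ t, w t * mellin φ (z t) ∂μ := by
  have hi := integrable_mul_mellin hw hz hB hint
  refine isDistribution_of_bound (fun φ ψ => ?_) (fun c φ => ?_) fun K hK hK0 => ?_
  · rw [← integral_add (hi φ) (hi ψ)]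
    congr 1 with t
    have := (hasMellin_add (mellinConvergent_testFunction φ (z t))
      (mellinConvergent_testFunction ψ (z t))).2
    rw [FunLike.coe_add, ← mul_add, ← this]
    rfl
  · rw [← integral_const_mul]
    congr 1 with t
    have := mellin_const_smul φ (z t) c
    rw [smul_eq_mul] at this
    rw [FunLike.coe_smul, mul_left_comm, ← this]
    rfl
  · obtain ⟨C, hC⟩ := exists_norm_mellin_testFunction_le hK hK0 B N
    refine ⟨N, C * ∫ t, ‖w t‖ * ((1 + |(z t).im|) ^ N)⁻¹ ∂μ, fun φ hφ => ?_⟩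
    refine (norm_integral_le_of_norm_le
      (hint.const_mul (C * (testNorm φ + testNorm ((testDeriv ^ N) φ))))
      (Eventually.of_forall fun t => ?_)).trans ?_
    · rw [norm_mul]
      refine (mul_le_mul_of_nonneg_left (hC φ hφ (z t) (hB t)) (norm_nonneg _)).trans
        (le_of_eq (by ring))
    · rw [integral_const_mul]
      exact le_of_eq (by ring)

end MellinIntegral

end FractalSpray


namespace FractalSpray

/-! ### The scaling zeta function as a Dirichlet series -/

section Zeta

variable {ℓ : ℕ → ℝ} {d : ℕ}

/-- The sum `∑ k ≤ d, g ^ (s - k) / (s - k) * κ k`, the shifted Mellin transform of the defect of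
the tube volume of the generator. -/
noncomputable def tubeTransform (d : ℕ) (g : ℝ) (κ : ℕ → ℝ) (s : ℂ) : ℂ :=
  ∑ k ∈ Finset.range (d + 1), (g : ℂ) ^ (s - (k : ℂ)) / (s - (k : ℂ)) * (κ k : ℂ)

theorem pairing_tubularZeta (d : ℕ) (g : ℝ) (κ : ℕ → ℝ) (ζ : ℂ → ℂ) (s : ℂ) (φ : ℝ → ℂ) :
    pairing (fun ε => tubularZeta d g κ ζ ε s) φ =
      ζ s * tubeTransform d g κ s * mellin φ (d + 1 - s) := by
  rw [pairing, mellin, ← integral_const_mul]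
  refine integral_congr_ae (Eventually.of_forall fun ε => ?_)
  have e : (d : ℂ) + 1 - s - 1 = d - s := by ring
  simp only [tubularZeta, tubeTransform, e, smul_eq_mul]
  ring

theorem rpow_le_add_rpow {x a b σ : ℝ} (hx : 0 < x) (ha : a ≤ σ) (hb : σ ≤ b) :
    x ^ σ ≤ x ^ a + x ^ b := by
  rcases le_total x 1 with h | h
  · have := Real.rpow_le_rpow_of_exponent_ge hx h ha
    have := Real.rpow_nonneg hx.le b
    linarith
  · have := Real.rpow_le_rpow_of_exponent_le h hb
    have := Real.rpow_nonneg hx.le a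
    linarith

/-- The terms tend to zero, so all but finitely many ratios are at most `1`, and for these a larger
exponent gives a smaller power. -/
theorem summable_rpow_of_summable_pow (hpos : ∀ n, 0 < ℓ n)
    (h : Summable fun n => ℓ n ^ d) {σ : ℝ} (hσ : d ≤ σ) : Summable fun n => ℓ n ^ σ := by
  refine summable_of_isBigO_nat h (Asymptotics.IsBigO.of_bound 1 ?_)
  have h1 : ∀ᶠ n in atTop, ℓ n ^ d < 1 := h.tendsto_atTop_zero.eventually (gt_mem_nhds one_pos)
  filter_upwards [h1] with n hn
  have hle : ℓ n ≤ 1 := by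
    by_contra hc
    exact absurd hn (one_le_pow₀ (not_le.1 hc).le).not_gt
  rw [Real.norm_of_nonneg (Real.rpow_nonneg (hpos n).le _),
    Real.norm_of_nonneg (pow_nonneg (hpos n).le _), one_mul, ← Real.rpow_natCast]
  exact Real.rpow_le_rpow_of_exponent_ge (hpos n) hle hσ

theorem restrict_scalingMeasure (hpos : ∀ n, 0 < ℓ n) :
    (scalingMeasure ℓ).restrict (Ioi 0) =
      -- The trivial weights give the shape expected by `integrable_sum_dirac` and
      -- `hasSum_integral_sum_dirac`.
      Measure.sum fun n => (1 : ENNReal) • Measure.dirac (1 / ℓ n) := by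
  rw [scalingMeasure, Measure.restrict_sum _ measurableSet_Ioi]
  congr 1
  ext1 n
  rw [one_smul, restrict_dirac' measurableSet_Ioi]
  simp [hpos n]

theorem one_div_cpow_neg {x : ℝ} (hx : 0 < x) (s : ℂ) :
    (((1 / x : ℝ)) : ℂ) ^ (-s) = (x : ℂ) ^ s := by
  rw [one_div, Complex.ofReal_inv, Complex.inv_cpow _ _ (by
    rw [Complex.arg_ofReal_of_nonneg hx.le]; exact Real.pi_ne_zero.symm), Complex.cpow_neg, inv_inv]

theorem IsScalingZeta.hasSum {W : Set ℂ} {ζ : ℂ → ℂ} (hζ : IsScalingZeta ℓ W ζ)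
    (hpos : ∀ n, 0 < ℓ n) {s : ℂ} (hs : Summable fun n => ℓ n ^ s.re) :
    HasSum (fun n => (ℓ n : ℂ) ^ s) (ζ s) := by
  have hsum : Summable fun n => (1 : ENNReal).toReal * ‖((1 / ℓ n : ℝ) : ℂ) ^ (-s)‖ := by
    refine hs.congr fun n => ?_
    rw [one_div_cpow_neg (hpos n), Complex.norm_cpow_eq_rpow_re_of_pos (hpos n)]
    simp
  have h1 := integrable_sum_dirac (f := fun x : ℝ => (x : ℂ) ^ (-s)) (x := fun n => 1 / ℓ n)
    (c := fun _ => 1) (fun _ => ENNReal.one_ne_top) hsum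
  have h2 := hasSum_integral_sum_dirac (f := fun x : ℝ => (x : ℂ) ^ (-s)) (x := fun n => 1 / ℓ n)
    (c := fun _ => 1) (fun _ => ENNReal.one_ne_top) hsum
  rw [← restrict_scalingMeasure hpos] at h1 h2
  rw [hζ.eq_mellin s h1]
  refine h2.congr_fun fun n => ?_
  rw [one_div_cpow_neg (hpos n)]
  simp

/-- The strip includes its left edge `Re s = d`, so that poles on that line are excluded too. -/
theorem IsScalingZeta.norm_le {W : Set ℂ} {ζ : ℂ → ℂ} (hζ : IsScalingZeta ℓ W ζ)
    (hpos : ∀ n, 0 < ℓ n) (h : Summable fun n => ℓ n ^ d) (c : ℝ) :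
    ∃ C, ∀ s : ℂ, (d : ℝ) ≤ s.re → s.re ≤ c → ‖ζ s‖ ≤ C := by
  refine ⟨∑' n, (ℓ n ^ (d : ℝ) + ℓ n ^ c), fun s hs hsc => ?_⟩
  have hs1 := summable_rpow_of_summable_pow hpos h hs
  have hs2 := (summable_rpow_of_summable_pow hpos h le_rfl).add
    (summable_rpow_of_summable_pow hpos h (hs.trans hsc))
  rw [← (hζ.hasSum hpos hs1).tsum_eq]
  refine tsum_of_norm_bounded hs2.hasSum fun n => ?_
  rw [Complex.norm_cpow_eq_rpow_re_of_pos (hpos n)]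
  exact rpow_le_add_rpow (hpos n) hs hsc

end Zeta

/-! ### The Mellin transform of the tube volume -/

section Tube

variable {d : ℕ} {T G : Set (EuclideanSpace ℝ (Fin d))} {ℓ κ : ℕ → ℝ}

/-- The tube volume minus the total volume. -/
noncomputable def tubeDefect (A : Set (EuclideanSpace ℝ (Fin d))) (ε : ℝ) : ℂ :=
  ((innerTubeVolume A ε - (volume : Measure (EuclideanSpace ℝ (Fin d))).real A : ℝ) : ℂ)

/-- The case of the unit interval, rescaled by `u = g t`. -/
theorem hasMellin_monomial_Ioc {g : ℝ} (hg : 0 < g) (m : ℕ) {z : ℂ} (hz : 0 < z.re) :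
    HasMellin ((Ioc 0 g).indicator fun u : ℝ => ((u : ℂ) ^ m)) z ((g : ℂ) ^ (z + m) / (z + m)) := by
  have h := hasMellin_cpow_Ioc (m : ℂ) (s := z) (by simp; positivity)
  have hg' : (0 : ℝ) < g⁻¹ := inv_pos.2 hg
  have hgc : (g : ℂ) ≠ 0 := Complex.ofReal_ne_zero.2 hg.ne'
  have e : ((Ioc 0 g).indicator fun u : ℝ => ((u : ℂ) ^ m)) = fun u : ℝ => (g : ℂ) ^ m •
      ((Ioc (0 : ℝ) 1).indicator (fun t : ℝ => (t : ℂ) ^ (m : ℂ)) (g⁻¹ * u)) := by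
    ext u
    have hiff : g⁻¹ * u ∈ Ioc (0 : ℝ) 1 ↔ u ∈ Ioc 0 g := by
      rw [mem_Ioc, mem_Ioc, mul_pos_iff_of_pos_left hg', inv_mul_le_iff₀ hg, mul_one]
    by_cases hu : u ∈ Ioc 0 g
    · rw [indicator_of_mem hu, indicator_of_mem (hiff.2 hu)]
      simp only [Complex.cpow_natCast, smul_eq_mul, Complex.ofReal_mul, Complex.ofReal_inv]
      rw [← mul_pow, mul_inv_cancel_left₀ hgc]
    · rw [indicator_of_notMem hu, indicator_of_notMem (fun h => hu (hiff.1 h)), smul_zero]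
  have h1 := (MellinConvergent.comp_mul_left hg').2 h.1
  have h2 := hasMellin_const_smul h1 ((g : ℂ) ^ m)
  rw [mellin_comp_mul_left _ _ hg', h.2] at h2
  rw [e]
  refine ⟨h2.1, h2.2.trans ?_⟩
  rw [Complex.ofReal_inv, Complex.inv_cpow _ _ (by
    rw [Complex.arg_ofReal_of_nonneg hg.le]; exact Real.pi_ne_zero.symm), Complex.cpow_neg, inv_inv,
    Complex.cpow_add _ _ hgc, Complex.cpow_natCast, smul_eq_mul, smul_eq_mul]
  ring

theorem HasMellin.finset_sum {ι : Type*} (S : Finset ι) {F : ι → ℝ → ℂ} {m : ι → ℂ} {z : ℂ}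
    (h : ∀ i ∈ S, HasMellin (F i) z (m i)) : HasMellin (fun u => ∑ i ∈ S, F i u) z (∑ i ∈ S, m i) := by
  classical
  induction S using Finset.induction_on with
  | empty => simp [HasMellin, MellinConvergent, mellin]
  | insert a S ha ih =>
    have h1 := h a (Finset.mem_insert_self a S)
    have h2 := ih fun i hi => h i (Finset.mem_insert_of_mem hi)
    have := hasMellin_add h1.1 h2.1
    rw [h1.2, h2.2] at this
    simpa only [Finset.sum_insert ha] using this

/-- Below the inradius the convention `κ d = -vol G` makes the subtracted volume the missing term of
the polynomial; above it the tube is full. At the inradius itself the polynomial formula is not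
assumed, and a single point does not affect integrals. -/
theorem tubeDefect_generator (hd : 1 ≤ d) (hG : IsGenerator G) (hκ : IsMonophase G κ) {u : ℝ}
    (hu : 0 < u) (hne : u ≠ inradius G) :
    tubeDefect G u = ∑ k ∈ Finset.range (d + 1),
      (κ k : ℂ) • (Ioc 0 (inradius G)).indicator (fun u : ℝ => ((u : ℂ) ^ (d - k))) u := by
  rcases lt_or_gt_of_ne hne with h | h
  · have hmem : u ∈ Ioc 0 (inradius G) := ⟨hu, h.le⟩
    simp only [indicator_of_mem hmem]
    rw [Finset.sum_range_succ, tubeDefect, hκ.tube u hu h, hκ.top]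
    push_cast
    simp
    ring
  · have hmem : u ∉ Ioc 0 (inradius G) := fun h' => h.not_ge h'.2
    simp [indicator_of_notMem hmem, tubeDefect, innerTubeVolume_of_inradius_le hd hG h.le]

theorem hasMellin_tubeDefect_generator (hd : 1 ≤ d) (hG : IsGenerator G) (hκ : IsMonophase G κ)
    {z : ℂ} (hz : 0 < z.re) :
    HasMellin (tubeDefect G) z (tubeTransform d (inradius G) κ (z + d)) := by
  have h := HasMellin.finset_sum (Finset.range (d + 1)) (z := z)
    (F := fun k u => (κ k : ℂ) • (Ioc 0 (inradius G)).indicator (fun u : ℝ => ((u : ℂ) ^ (d - k))) u)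
    (m := fun k => (inradius G : ℂ) ^ (z + d - (k : ℂ)) / (z + d - (k : ℂ)) * (κ k : ℂ))
    fun k hk => by
      have h1 := hasMellin_monomial_Ioc (inradius_pos hd hG) (d - k) hz
      have h2 := hasMellin_const_smul h1.1 (κ k : ℂ)
      rw [h1.2] at h2
      have hk' : k ≤ d := Nat.lt_succ_iff.1 (Finset.mem_range.1 hk)
      refine ⟨h2.1, h2.2.trans ?_⟩
      rw [smul_eq_mul, Nat.cast_sub hk', ← add_sub_assoc]
      ring
  have hae : ∀ᵐ u : ℝ ∂(volume : Measure ℝ).restrict (Ioi 0),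
      (u : ℂ) ^ (z - 1) • (∑ k ∈ Finset.range (d + 1), (κ k : ℂ) •
        (Ioc 0 (inradius G)).indicator (fun u : ℝ => ((u : ℂ) ^ (d - k))) u) =
      (u : ℂ) ^ (z - 1) • tubeDefect G u := by
    filter_upwards [ae_restrict_mem measurableSet_Ioi,
      ae_restrict_of_ae ((measure_eq_zero_iff_ae_notMem.1
        (Real.volume_singleton (a := inradius G))))] with u hu hne
    rw [tubeDefect_generator hd hG hκ hu (by simpa using hne)]
  refine ⟨h.1.congr hae, ?_⟩
  rw [tubeTransform, ← h.2]
  exact (integral_congr_ae hae).symm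

theorem hasSum_tubeDefect (hd : 1 ≤ d) (hT : IsFractalSpray T G ℓ) (hG : IsGenerator G) (u : ℝ) :
    HasSum (fun n => (ℓ n : ℂ) ^ d * tubeDefect G ((ℓ n)⁻¹ * u)) (tubeDefect T u) := by
  have h := (hT.hasSum_innerTubeVolume hd hG u).sub (hT.hasSum_volume hG)
  have h2 := Complex.hasSum_ofReal.2 h
  refine h2.congr_fun fun n => ?_
  simp only [tubeDefect]
  push_cast
  rw [div_eq_inv_mul]
  ring

theorem locallyIntegrable_tubeDefect {A : Set (EuclideanSpace ℝ (Fin d))}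
    (hA : Bornology.IsBounded A) : LocallyIntegrable (tubeDefect A) := by
  have h : LocallyIntegrable
      (fun ε => innerTubeVolume A ε - (volume : Measure (EuclideanSpace ℝ (Fin d))).real A) :=
    (monotone_innerTubeVolume hA).locallyIntegrable.sub (locallyIntegrable_const _)
  intro x
  obtain ⟨s, hs, hint⟩ := h x
  exact ⟨s, hs, hint.ofReal⟩

theorem norm_tubeDefect_le {A : Set (EuclideanSpace ℝ (Fin d))} (hA : Bornology.IsBounded A)
    (u : ℝ) : ‖tubeDefect A u‖ ≤ (volume : Measure (EuclideanSpace ℝ (Fin d))).real A := by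
  rw [tubeDefect, Complex.norm_real, Real.norm_eq_abs, abs_le]
  constructor
  · linarith [innerTubeVolume_nonneg A u]
  · linarith [innerTubeVolume_le_volume hA u, innerTubeVolume_nonneg A u]

/-- The ratios are bounded: either `ℓ n ≤ 1`, or `ℓ n ≤ ℓ n ^ d ≤ ∑ ℓ n ^ d` because `d ≥ 1`. Hence
all tiles are filled from a common `u` on, and the Mellin integral of the defect has no trouble at
infinity. -/
theorem eventually_tubeDefect_eq_zero (hd : 1 ≤ d) (hT : IsFractalSpray T G ℓ)
    (hG : IsGenerator G) : ∀ᶠ u in atTop, tubeDefect T u = 0 := by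
  have hsum := hT.summable_pow hG
  filter_upwards [eventually_ge_atTop ((1 + ∑' n, ℓ n ^ d) * inradius G)] with u hu
  have h := hasSum_tubeDefect hd hT hG u
  have hz : ∀ n, (ℓ n : ℂ) ^ d * tubeDefect G ((ℓ n)⁻¹ * u) = 0 := fun n => by
    have hle : ℓ n ≤ 1 + ∑' n, ℓ n ^ d := by
      have h1 : ℓ n ^ d ≤ ∑' n, ℓ n ^ d :=
        hsum.le_tsum n fun m _ => pow_nonneg (hT.ratio_pos m).le d
      rcases le_total (ℓ n) 1 with h2 | h2
      · have := pow_nonneg (hT.ratio_pos n).le d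
        linarith
      · have := le_self_pow₀ h2 (by omega : d ≠ 0)
        linarith
    have : inradius G ≤ (ℓ n)⁻¹ * u := by
      rw [le_inv_mul_iff₀ (hT.ratio_pos n)]
      exact (mul_le_mul_of_nonneg_right hle (inradius_pos hd hG).le).trans hu
    simp [tubeDefect, innerTubeVolume_of_inradius_le hd hG this]
  simp only [hz] at h
  exact h.unique hasSum_zero

theorem mellinConvergent_tubeDefect (hd : 1 ≤ d) (hT : IsFractalSpray T G ℓ)
    (hG : IsGenerator G) {z : ℂ} (hz : 0 < z.re) : MellinConvergent (tubeDefect T) z := by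
  refine mellinConvergent_of_isBigO_rpow (a := z.re + 1) (b := 0)
    ((locallyIntegrable_tubeDefect hT.isBounded).locallyIntegrableOn _) ?_ (by linarith) ?_ hz
  · exact (Asymptotics.isBigO_zero (fun x : ℝ => x ^ (-(z.re + 1))) atTop).congr'
      ((eventually_tubeDefect_eq_zero hd hT hG).mono fun _ h => h.symm) EventuallyEq.rfl
  · refine Asymptotics.IsBigO.of_bound ((volume : Measure (EuclideanSpace ℝ (Fin d))).real T)
      (Eventually.of_forall fun u => ?_)
    simpa using norm_tubeDefect_le hT.isBounded u

/-- The sum over the tiles is integrated term by term: dilating by `ℓ n` contributes `ℓ n ^ (s - d)`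
and the volume factor `ℓ n ^ d`, leaving the Dirichlet series of `ζ` times the transform for the
generator. -/
theorem mellin_tubeDefect (hd : 1 ≤ d) (hT : IsFractalSpray T G ℓ) (hG : IsGenerator G)
    (hκ : IsMonophase G κ) {W : Set ℂ} {ζ : ℂ → ℂ} (hζ : IsScalingZeta ℓ W ζ) {s : ℂ}
    (hs : d < s.re) :
    mellin (tubeDefect T) (s - d) = ζ s * tubeTransform d (inradius G) κ s := by
  set z : ℂ := s - d with hzdef
  have hz : 0 < z.re := by simp [hzdef, hs]
  obtain ⟨hGc, hGm⟩ := hasMellin_tubeDefect_generator hd hG hκ hz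
  have hsum := summable_rpow_of_summable_pow hT.ratio_pos (hT.summable_pow hG) hs.le
  set F : ℕ → ℝ → ℂ := fun n u =>
    (u : ℂ) ^ (z - 1) • ((ℓ n : ℂ) ^ d • tubeDefect G ((ℓ n)⁻¹ * u)) with hF
  have hinv : ∀ n, 0 < (ℓ n)⁻¹ := fun n => inv_pos.2 (hT.ratio_pos n)
  have hint : ∀ n, Integrable (F n) (volume.restrict (Ioi 0)) := fun n =>
    ((MellinConvergent.comp_mul_left (hinv n)).2 hGc).const_smul ((ℓ n : ℂ) ^ d)
  have hval : ∀ n, ∫ u in Ioi 0, F n u = (ℓ n : ℂ) ^ s * mellin (tubeDefect G) z := fun n => by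
    have h1 := mellin_const_smul (fun u => tubeDefect G ((ℓ n)⁻¹ * u)) z ((ℓ n : ℂ) ^ d)
    rw [mellin_comp_mul_left _ _ (hinv n)] at h1
    refine h1.trans ?_
    have hl : (ℓ n : ℂ) ≠ 0 := Complex.ofReal_ne_zero.2 (hT.ratio_pos n).ne'
    rw [Complex.ofReal_inv, Complex.inv_cpow _ _ (by
      rw [Complex.arg_ofReal_of_nonneg (hT.ratio_pos n).le]; exact Real.pi_ne_zero.symm),
      Complex.cpow_neg, inv_inv, hzdef, Complex.cpow_sub _ _ hl, Complex.cpow_natCast,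
      smul_eq_mul, smul_eq_mul]
    field_simp
  -- The L¹ norms scale by `ℓ n ^ Re s`, a summable sequence; this justifies exchanging sum and
  -- integral.
  have hnorm : ∀ n, ∫ u in Ioi 0, ‖F n u‖ =
      ℓ n ^ s.re * ∫ u in Ioi (0 : ℝ), ‖(u : ℂ) ^ (z - 1) • tubeDefect G u‖ := fun n => by
    have hl := hT.ratio_pos n
    have h1 : ∀ u ∈ Ioi (0 : ℝ), ‖F n u‖ = ℓ n ^ (s.re - 1) *
        (fun y : ℝ => ‖(y : ℂ) ^ (z - 1) • tubeDefect G y‖) ((ℓ n)⁻¹ * u) := fun u hu => by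
      have hu' : 0 < (ℓ n)⁻¹ * u := mul_pos (hinv n) hu
      simp only [hF, norm_smul, norm_pow, Complex.norm_real, Real.norm_of_nonneg hl.le]
      rw [Complex.norm_cpow_eq_rpow_re_of_pos hu, Complex.norm_cpow_eq_rpow_re_of_pos hu',
        Real.mul_rpow (hinv n).le (le_of_lt hu), Real.inv_rpow hl.le]
      have e : ℓ n ^ (s.re - 1) = ℓ n ^ d * ℓ n ^ (z - 1).re := by
        rw [← Real.rpow_natCast, ← Real.rpow_add hl]
        congr 1
        simp [hzdef]
        ring
      rw [e]
      have : ℓ n ^ (z - 1).re ≠ 0 := (Real.rpow_pos_of_pos hl _).ne'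
      field_simp
    rw [setIntegral_congr_fun measurableSet_Ioi h1, integral_const_mul,
      integral_comp_mul_left_Ioi (fun y : ℝ => ‖(y : ℂ) ^ (z - 1) • tubeDefect G y‖) 0 (hinv n),
      mul_zero, inv_inv, smul_eq_mul, ← mul_assoc]
    congr 1
    rw [Real.rpow_sub hl, Real.rpow_one]
    field_simp
  have h := hasSum_integral_of_summable_integral_norm hint
    ((hsum.mul_right _).congr fun n => (hnorm n).symm)
  simp only [hval] at h
  have hlhs : ∫ u in Ioi 0, ∑' n, F n u = mellin (tubeDefect T) z := by
    refine integral_congr_ae (Eventually.of_forall fun u => ?_)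
    exact ((hasSum_tubeDefect hd hT hG u).const_smul ((u : ℂ) ^ (z - 1))).tsum_eq
  rw [hlhs, hGm] at h
  have h2 := (hζ.hasSum hT.ratio_pos hsum).mul_right (tubeTransform d (inradius G) κ (z + d))
  rw [h.unique h2, hzdef, sub_add_cancel]

end Tube

/-! ### Parseval's formula for Mellin transforms -/

section Parseval

theorem integrable_inv_one_add_abs_pow {N : ℕ} (hN : 2 ≤ N) :
    Integrable fun t : ℝ => ((1 + |t|) ^ N)⁻¹ := by
  have h := integrable_one_add_norm (μ := (volume : Measure ℝ)) (r := (N : ℝ)) (by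
    simp only [Module.finrank_self, Nat.cast_one]
    exact_mod_cast hN)
  refine h.congr (Eventually.of_forall fun t => ?_)
  simp only [Real.norm_eq_abs]
  rw [Real.rpow_neg (by positivity), Real.rpow_natCast]

theorem integrable_mellin_vertical (φ : 𝓓(posReals, ℂ)) (a : ℝ) (c : ℂ) (hc : c.re = 0)
    (hc1 : |c.im| = 1) : Integrable fun t : ℝ => mellin φ (a + t * c) := by
  have h := integrable_mul_mellin (μ := (volume : Measure ℝ)) (w := fun _ => 1)
    (z := fun t : ℝ => (a : ℂ) + t * c) (B := |a|) (N := 2) aestronglyMeasurable_const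
    (by fun_prop) (fun t => by simp [hc]) (by
      simpa [abs_mul, hc1] using integrable_inv_one_add_abs_pow le_rfl) φ
  simpa using h

/-- Parseval's formula for the Mellin transform. -/
theorem integral_mellin_mul_mellin {w : ℝ → ℂ} {a : ℝ} (hw : MellinConvergent w a)
    (φ : 𝓓(posReals, ℂ)) :
    Integrable (fun t : ℝ => mellin w (a + t * Complex.I) *
      mellin φ (1 - (a + t * Complex.I))) ∧
    ∫ t : ℝ, mellin w (a + t * Complex.I) * mellin φ (1 - (a + t * Complex.I)) =
      2 * Real.pi * ∫ x in Ioi (0 : ℝ), w x * φ x := by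
  set Φ : ℝ → ℂ := fun t => mellin φ (1 - (a + t * Complex.I)) with hΦ
  have hΦi : Integrable Φ := by
    have := integrable_mellin_vertical φ (1 - a) (-Complex.I) (by simp) (by simp)
    refine this.congr (Eventually.of_forall fun t => ?_)
    simp only [hΦ]
    congr 1
    push_cast
    ring
  set K : ℝ → ℝ → ℂ := fun t x => (x : ℂ) ^ ((a : ℂ) + t * Complex.I - 1) • w x * Φ t with hK
  -- As `x ^ (it)` has modulus `1` for `x > 0`, the kernel is dominated by a product of integrable
  -- functions of `t` and of `x`. Only the transform of `φ`, not that of `w`, has to be integrable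
  -- on the line.
  have hK' : Integrable (Function.uncurry K) (volume.prod (volume.restrict (Ioi 0))) := by
    have h1 : Integrable (fun p : ℝ × ℝ => Φ p.1 * ((p.2 : ℂ) ^ ((a : ℂ) - 1) • w p.2))
        (volume.prod (volume.restrict (Ioi 0))) := hΦi.mul_prod hw
    have h2 : AEStronglyMeasurable (fun p : ℝ × ℝ => (p.2 : ℂ) ^ ((p.1 : ℂ) * Complex.I))
        (volume.prod (volume.restrict (Ioi (0 : ℝ)))) := by
      apply Measurable.aestronglyMeasurable
      fun_prop
    have hpos : ∀ᵐ p : ℝ × ℝ ∂volume.prod (volume.restrict (Ioi (0 : ℝ))), 0 < p.2 :=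
      Measure.quasiMeasurePreserving_snd.ae (ae_restrict_mem measurableSet_Ioi)
    have h3 := h1.bdd_mul (c := 1) h2 (by
      filter_upwards [hpos] with p hp
      rw [Complex.norm_cpow_eq_rpow_re_of_pos hp]
      simp)
    refine h3.congr ?_
    filter_upwards [hpos] with p hp
    have hp' : (p.2 : ℂ) ≠ 0 := Complex.ofReal_ne_zero.2 hp.ne'
    have e : (a : ℂ) + p.1 * Complex.I - 1 = (p.1 * Complex.I) + (a - 1) := by ring
    simp only [Function.uncurry, hK]
    rw [e, Complex.cpow_add _ _ hp', smul_eq_mul, smul_eq_mul]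
    ring
  have hswap := integral_integral_swap hK'
  have hl : ∀ t : ℝ, ∫ x in Ioi (0 : ℝ), K t x = mellin w (a + t * Complex.I) * Φ t := fun t => by
    simp only [hK]
    rw [integral_mul_const, mellin]
  simp only [hl] at hswap
  refine ⟨hK'.integral_prod_left.congr (Eventually.of_forall hl), ?_⟩
  rw [hswap, ← integral_const_mul]
  refine setIntegral_congr_fun measurableSet_Ioi fun x hx => ?_
  have hx' : (x : ℂ) ≠ 0 := Complex.ofReal_ne_zero.2 (ne_of_gt hx)
  have hinv := mellinInv_mellin_eq (1 - a) φ hx (mellinConvergent_testFunction φ _)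
    (integrable_mellin_vertical φ (1 - a) Complex.I (by simp) (by simp)) φ.continuous.continuousAt
  -- The inner integral is Mellin inversion for `φ` on `Re = 1 - a`, with the line traversed
  -- downwards; hence the reflection of `t`.
  rw [mellinInv, ← integral_neg_eq_self] at hinv
  have e : ∀ t : ℝ, K t x = w x * ((x : ℂ) ^ (-(((1 - a : ℝ) : ℂ) + ((-t : ℝ) : ℂ) * Complex.I)) •
      mellin φ (((1 - a : ℝ) : ℂ) + ((-t : ℝ) : ℂ) * Complex.I)) := fun t => by
    have e1 : (a : ℂ) + t * Complex.I - 1 =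
      -(((1 - a : ℝ) : ℂ) + ((-t : ℝ) : ℂ) * Complex.I) := by push_cast; ring
    have e2 : 1 - ((a : ℂ) + t * Complex.I) =
      ((1 - a : ℝ) : ℂ) + ((-t : ℝ) : ℂ) * Complex.I := by push_cast; ring
    simp only [hK, hΦ, e1, e2, smul_eq_mul]
    ring
  simp only [e]
  have hpi : (Real.pi : ℂ) ≠ 0 := Complex.ofReal_ne_zero.2 Real.pi_ne_zero
  have key : ∀ J : ℂ, w x * J = 2 * Real.pi * (w x * (((1 / (2 * Real.pi) : ℝ) : ℂ) * J)) := by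
    intro J
    push_cast
    field_simp
  rw [integral_const_mul, ← hinv, Complex.real_smul]
  exact key _

end Parseval

end FractalSpray


namespace FractalSpray

/-! ### Poles and regular points of meromorphic functions -/

section Poles

theorem IsRegularAt.mul {F G : ℂ → ℂ} {z : ℂ} (hF : IsRegularAt F z) (hG : IsRegularAt G z) :
    IsRegularAt (fun z => F z * G z) z := by
  obtain ⟨h, hh, he⟩ := hF
  obtain ⟨k, hk, he'⟩ := hG
  exact ⟨fun z => h z * k z, hh.mul hk, he.mul he'⟩

/-- Failure of the norm to blow up means nonnegative meromorphic order, and then the normal form is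
the analytic representative. -/
theorem isRegularAt_of_not_tendsto {F : ℂ → ℂ} {z : ℂ} (hF : MeromorphicAt F z)
    (h : ¬Tendsto (fun s => ‖F s‖) (𝓝[≠] z) atTop) : IsRegularAt F z := by
  rw [tendsto_norm_atTop_iff_cobounded, tendsto_cobounded_iff_meromorphicOrderAt_neg hF,
    not_lt] at h
  exact ⟨_, (hF.meromorphicOrderAt_nonneg_iff_analyticAt_toMeromorphicNFAt).1 h,
    hF.eq_nhdsNE_toMeromorphicNFAt⟩

theorem not_tendsto_norm_atTop_of_frequently_le {F : ℂ → ℂ} {z : ℂ} {C : ℝ}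
    (h : ∃ᶠ s in 𝓝[≠] z, ‖F s‖ ≤ C) : ¬Tendsto (fun s => ‖F s‖) (𝓝[≠] z) atTop := fun ht =>
  h ((ht.eventually (eventually_gt_atTop C)).mono fun _ hs => hs.not_ge)

theorem tendsto_add_ofReal_nhdsNE (z : ℂ) :
    Tendsto (fun x : ℝ => z + x) (𝓝[>] 0) (𝓝[≠] z) := by
  refine tendsto_nhdsWithin_iff.2 ⟨?_, ?_⟩
  · have : Continuous fun x : ℝ => z + (x : ℂ) := by fun_prop
    have h := this.tendsto 0
    rw [Complex.ofReal_zero, add_zero] at h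
    exact h.mono_left nhdsWithin_le_nhds
  · filter_upwards [self_mem_nhdsWithin] with x hx
    simpa using (ne_of_gt hx : x ≠ 0)

/-- A function bounded on a horizontal segment to the right of `z` has no pole at `z`. -/
theorem not_tendsto_norm_atTop_of_horizontal {F : ℂ → ℂ} {z : ℂ} {C : ℝ}
    (h : ∀ x : ℝ, 0 < x → x ≤ 1 → ‖F (z + x)‖ ≤ C) :
    ¬Tendsto (fun s => ‖F s‖) (𝓝[≠] z) atTop := by
  refine not_tendsto_norm_atTop_of_frequently_le (C := C) ?_
  refine (tendsto_add_ofReal_nhdsNE z).frequently (Eventually.frequently ?_)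
  filter_upwards [Ioc_mem_nhdsGT one_pos] with x hx using h x hx.1 hx.2

/-- A meromorphic function is analytic on a punctured neighbourhood of each point, so poles cannot
accumulate in the compact set. -/
theorem finite_poles_inter_of_isCompact {F : ℂ → ℂ} {s : Set ℂ} (hs : IsCompact s)
    (hF : ∀ z ∈ s, MeromorphicAt F z) :
    (s ∩ {ω | Tendsto (fun z => ‖F z‖) (𝓝[≠] ω) atTop}).Finite := by
  by_contra hinf
  obtain ⟨x, hx, hacc⟩ := Set.Infinite.exists_accPt_of_subset_isCompact hinf hs inter_subset_left
  rw [accPt_iff_frequently_nhdsNE] at hacc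
  refine hacc ?_
  filter_upwards [(hF x hx).eventually_analyticAt] with y hy hy'
  exact not_tendsto_nhds_of_tendsto_atTop hy'.2 _
    (hy.continuousAt.norm.tendsto.mono_left nhdsWithin_le_nhds)

theorem hasResidueAt_div {G : ℂ → ℂ} {ω : ℂ} (hG : AnalyticAt ℂ G ω) :
    HasResidueAt (fun z => G z / (z - ω)) ω (G ω) := by
  obtain ⟨p, hp⟩ := hG
  refine ⟨0, dslope G ω, fun _ _ => analyticAt_const, hp.has_fpower_series_dslope_fslope.analyticAt,
    ?_⟩
  filter_upwards [self_mem_nhdsWithin] with z hz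
  have hz' : z - ω ≠ 0 := sub_ne_zero.2 hz
  rw [dslope_of_ne _ hz, slope_def_field]
  simp
  field_simp
  ring

theorem HasResidueAt.congr {F G : ℂ → ℂ} {ω r : ℂ} (hF : HasResidueAt F ω r)
    (h : G =ᶠ[𝓝[≠] ω] F) : HasResidueAt G ω r := by
  obtain ⟨Q, k, hQ, hk, hev⟩ := hF
  refine ⟨Q, k, hQ, hk, ?_⟩
  filter_upwards [hev, h] with z h1 h2 using h2.trans h1

end Poles

/-! ### Regularity and bounds for `tubeTransform` -/

section Transform

variable {d : ℕ} {g : ℝ} {κ : ℕ → ℝ}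

theorem analyticAt_cpow_sub (hg : 0 < g) (a s : ℂ) : AnalyticAt ℂ (fun s => (g : ℂ) ^ (s - a)) s :=
  (analyticAt_const).cpow (analyticAt_id.sub analyticAt_const)
    (Complex.ofReal_mem_slitPlane.2 hg)

theorem analyticAt_tubeTransform (hg : 0 < g) {s : ℂ} (hs : ∀ k : ℕ, k ≤ d → s ≠ k) :
    AnalyticAt ℂ (tubeTransform d g κ) s := by
  unfold tubeTransform
  refine Finset.analyticAt_fun_sum _ fun k hk => ?_
  refine ((analyticAt_cpow_sub hg _ s).div (analyticAt_id.sub analyticAt_const) ?_).mul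
    analyticAt_const
  exact sub_ne_zero.2 (hs k (Nat.lt_succ_iff.1 (Finset.mem_range.1 hk)))

theorem meromorphicAt_tubeTransform (hg : 0 < g) (s : ℂ) :
    MeromorphicAt (tubeTransform d g κ) s := by
  unfold tubeTransform
  refine MeromorphicAt.fun_sum fun k _ => ?_
  exact ((analyticAt_cpow_sub hg _ s).meromorphicAt.div
    (analyticAt_id.sub analyticAt_const).meromorphicAt).mul analyticAt_const.meromorphicAt

/-- At heights of modulus at least `1` every denominator has norm at least `1`. So the factor is
bounded there and leaves the growth exponent of `ζ` unchanged. -/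
theorem exists_norm_tubeTransform_le (d : ℕ) (hg : 0 < g) (κ : ℕ → ℝ) (B : ℝ) :
    ∃ C, 0 ≤ C ∧ ∀ s : ℂ, |s.re| ≤ B → 1 ≤ |s.im| → ‖tubeTransform d g κ s‖ ≤ C := by
  refine ⟨∑ k ∈ Finset.range (d + 1), (g ^ (-B - k) + g ^ (B - k)) * |κ k|,
    Finset.sum_nonneg fun k _ => by positivity, fun s hs hs1 => ?_⟩
  refine norm_sum_le_of_le _ fun k _ => ?_
  obtain ⟨h1, h2⟩ := abs_le.1 hs
  rw [norm_mul, norm_div, Complex.norm_cpow_eq_rpow_re_of_pos hg, Complex.norm_real,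
    Real.norm_eq_abs]
  have hden : 1 ≤ ‖s - (k : ℂ)‖ := by
    have := Complex.abs_im_le_norm (s - (k : ℂ))
    simp only [Complex.sub_im, Complex.natCast_im, sub_zero] at this
    linarith
  refine mul_le_mul_of_nonneg_right ?_ (abs_nonneg _)
  refine (div_le_self (Real.rpow_nonneg hg.le _) hden).trans (rpow_le_add_rpow hg ?_ ?_)
  · simpa using h1
  · simpa using h2

end Transform

/-! ### Visible dimensions and the residue at `d` -/

section Zeta

variable {d : ℕ} {ℓ : ℕ → ℝ} {f : ℝ → ℝ} {ζ : ℂ → ℂ}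

/-- The Dirichlet series is bounded on a segment going right from any point with `Re ≥ d`, so there
is no pole at such a point. -/
theorem re_lt_of_mem_scalingDims (hζ : IsScalingZeta ℓ (window f) ζ) (hpos : ∀ n, 0 < ℓ n)
    (h : Summable fun n => ℓ n ^ d) {ω : ℂ} (hω : ω ∈ scalingDims ζ f) : ω.re < d := by
  by_contra hc
  rw [not_lt] at hc
  obtain ⟨C, hC⟩ := hζ.norm_le hpos h (ω.re + 1)
  refine not_tendsto_norm_atTop_of_horizontal (C := C) (fun x hx hx1 => hC _ ?_ ?_) hω.2
  · simp only [Complex.add_re, Complex.ofReal_re]; linarith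
  · simp only [Complex.add_re, Complex.ofReal_re]; linarith

theorem re_lt_of_mem_visibleDims (hζ : IsScalingZeta ℓ (window f) ζ) (hpos : ∀ n, 0 < ℓ n)
    (h : Summable fun n => ℓ n ^ d) {ω : ℂ} (hω : ω ∈ visibleDims d ζ f) : ω.re < d := by
  rcases hω with hω | ⟨-, k, hk, rfl⟩
  · exact re_lt_of_mem_scalingDims hζ hpos h hω
  · simpa using hk

theorem isRegularAt_zeta (hζ : IsScalingZeta ℓ (window f) ζ) {z : ℂ} (hz : z ∈ window f)
    (hz' : z ∉ scalingDims ζ f) : IsRegularAt ζ z :=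
  isRegularAt_of_not_tendsto (hζ.meromorphic z hz) fun h => hz' ⟨hz, h⟩

theorem isRegularAt_zeta_mul_tubeTransform {g : ℝ} (hg : 0 < g) (κ : ℕ → ℝ)
    (hζ : IsScalingZeta ℓ (window f) ζ) {z : ℂ} (hz : z ∈ window f)
    (hz' : z ∉ visibleDims d ζ f) (hzd : z ≠ d) :
    IsRegularAt (fun s => ζ s * tubeTransform d g κ s) z := by
  refine (isRegularAt_zeta hζ hz fun h => hz' (Or.inl h)).mul
    (analyticAt_tubeTransform hg fun k hk hzk => ?_).isRegularAt
  rcases hk.lt_or_eq with hk | rfl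
  · exact hz' (Or.inr ⟨hz, k, hk, hzk⟩)
  · exact hzd hzk

/-- All visible dimensions have real part below `d`, so the poles between two heights lie in a
compact region cut off on the right at or beyond `d`. -/
theorem finite_visibleDims (hζ : IsScalingZeta ℓ (window f) ζ) (hpos : ∀ n, 0 < ℓ n)
    (h : Summable fun n => ℓ n ^ d) (hf : Continuous f) (a b : ℝ) :
    {ω ∈ visibleDims d ζ f | a < ω.im ∧ ω.im < b}.Finite := by
  obtain ⟨c, hc⟩ := (isCompact_Icc (a := a) (b := b)).bddAbove_image hf.continuousOn
  have hfc : ∀ t ∈ Icc a b, f t ≤ max c d := fun t ht =>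
    (hc (mem_image_of_mem f ht)).trans (le_max_left _ _)
  have hK := isCompact_graphRegion hf hfc
  have h1 := finite_poles_inter_of_isCompact hK fun z hz => hζ.meromorphic z hz.2.2.1
  have h2 : ((fun k : ℕ => (k : ℂ)) '' Iio d).Finite := (finite_Iio d).image _
  refine (h1.union h2).subset ?_
  rintro ω ⟨hω | ⟨-, k, hk, rfl⟩, ha, hb⟩
  · exact Or.inl ⟨⟨ha.le, hb.le, hω.1,
      (re_lt_of_mem_scalingDims hζ hpos h hω).le.trans (le_max_right _ _)⟩, hω.2⟩
  · exact Or.inr ⟨k, hk, rfl⟩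

/-- Dominated convergence with majorant `ℓ n ^ d + ℓ n ^ (d + 1)`. The limit identifies the regular
value of `ζ` at `d`, which yields the volume of `T`. -/
theorem tendsto_zeta_right (hζ : IsScalingZeta ℓ (window f) ζ) (hpos : ∀ n, 0 < ℓ n)
    (h : Summable fun n => ℓ n ^ d) :
    Tendsto (fun x : ℝ => ζ (d + x)) (𝓝[>] 0) (𝓝 ((∑' n, ℓ n ^ d : ℝ) : ℂ)) := by
  have hb := (summable_rpow_of_summable_pow hpos h le_rfl).add
    (summable_rpow_of_summable_pow hpos h (le_add_of_nonneg_right (zero_le_one (α := ℝ))))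
  have ht := tendsto_tsum_of_dominated_convergence (𝓕 := 𝓝[>] (0 : ℝ))
    (f := fun (x : ℝ) n => (ℓ n : ℂ) ^ ((d : ℂ) + x)) (g := fun n => (ℓ n : ℂ) ^ (d : ℂ)) hb
    (fun n => ?_) ?_
  · have e : ((∑' n, ℓ n ^ d : ℝ) : ℂ) = ∑' n, (ℓ n : ℂ) ^ (d : ℂ) := by
      rw [Complex.ofReal_tsum]
      simp
    rw [e]
    refine ht.congr' ?_
    filter_upwards [self_mem_nhdsWithin] with x hx
    refine (hζ.hasSum hpos (summable_rpow_of_summable_pow hpos h ?_)).tsum_eq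
    simpa using le_of_lt hx
  · have hl : (ℓ n : ℂ) ≠ 0 := Complex.ofReal_ne_zero.2 (hpos n).ne'
    have hc : Continuous fun x : ℝ => (ℓ n : ℂ) ^ ((d : ℂ) + x) :=
      (continuous_const.add Complex.continuous_ofReal).const_cpow (Or.inl hl)
    have := hc.tendsto 0
    simp only [Complex.ofReal_zero, add_zero] at this
    exact this.mono_left nhdsWithin_le_nhds
  · filter_upwards [Ioc_mem_nhdsGT one_pos] with x hx n
    rw [Complex.norm_cpow_eq_rpow_re_of_pos (hpos n)]
    refine rpow_le_add_rpow (hpos n) ?_ ?_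
    · simpa using hx.1.le
    · simpa using hx.2

/-- Only the summand `k = d` of the transform is singular at `d`. Written over the common
denominator `s - d`, the function has an analytic numerator whose value at `d` is the residue. -/
theorem hasResidueAt_dimension {g : ℝ} (hg : 0 < g) (κ : ℕ → ℝ)
    (hζ : IsScalingZeta ℓ (window f) ζ) (hpos : ∀ n, 0 < ℓ n)
    (h : Summable fun n => ℓ n ^ d) (hfd : f 0 < d) (φ : 𝓓(posReals, ℂ)) :
    HasResidueAt (fun s => ζ s * tubeTransform d g κ s * mellin φ (d + 1 - s)) d
      ((∑' n, ℓ n ^ d : ℝ) * κ d * mellin φ 1) := by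
  have hdw : (d : ℂ) ∈ window f := by simpa [window] using hfd.le
  obtain ⟨Z, hZ, he⟩ := isRegularAt_zeta hζ hdw fun hω =>
    (re_lt_of_mem_scalingDims hζ hpos h hω).ne (by simp)
  -- The representative `Z` is only known to agree with `ζ` off `d`, so its value at `d` is found as
  -- a limit from the right along the real axis.
  have hZd : Z d = ((∑' n, ℓ n ^ d : ℝ) : ℂ) := by
    refine tendsto_nhds_unique ?_ (tendsto_zeta_right hζ hpos h)
    have h1 : Tendsto ζ (𝓝[≠] (d : ℂ)) (𝓝 (Z d)) :=
      (hZ.continuousAt.tendsto.mono_left nhdsWithin_le_nhds).congr' he.symm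
    exact h1.comp (tendsto_add_ofReal_nhdsNE _)
  set A : ℂ → ℂ := fun s => ∑ k ∈ Finset.range d, (g : ℂ) ^ (s - (k : ℂ)) / (s - (k : ℂ)) * (κ k : ℂ)
  have hA : AnalyticAt ℂ A d := by
    refine Finset.analyticAt_fun_sum _ fun k hk => ?_
    refine ((analyticAt_cpow_sub hg _ _).div (analyticAt_id.sub analyticAt_const) ?_).mul
      analyticAt_const
    exact sub_ne_zero.2 (Nat.cast_injective.ne (Finset.mem_range.1 hk).ne')
  have hφ : AnalyticAt ℂ (fun s : ℂ => mellin φ (d + 1 - s)) d :=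
    ((differentiable_mellin_testFunction φ).comp
      (by fun_prop : Differentiable ℂ fun s : ℂ => (d : ℂ) + 1 - s)).analyticAt _
  have hG : AnalyticAt ℂ (fun s : ℂ => Z s * (A s * (s - d) + (g : ℂ) ^ (s - (d : ℂ)) * κ d) *
      mellin φ (d + 1 - s)) d :=
    (hZ.mul ((hA.mul (analyticAt_id.sub analyticAt_const)).add
      ((analyticAt_cpow_sub hg _ _).mul analyticAt_const))).mul hφ
  have hres := hasResidueAt_div hG
  simp only [sub_self, mul_zero, zero_add, Complex.cpow_zero, one_mul, add_sub_cancel_left,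
    hZd] at hres
  refine hres.congr ?_
  filter_upwards [he, self_mem_nhdsWithin] with s hs hne
  have hne' : s - d ≠ 0 := sub_ne_zero.2 hne
  rw [hs, tubeTransform, Finset.sum_range_succ]
  simp only [A]
  field_simp

end Zeta

end FractalSpray


namespace FractalSpray

/-! ### Integrals along the screen, around poles and along horizontal segments -/

section Screen

variable {f : ℝ → ℝ} {Z : ℂ → ℂ}

theorem locallyIntegrable_comp_screenPoint (hf : Continuous f)
    (hZ : ∀ t, IsRegularAt Z (screenPoint f t)) :
    LocallyIntegrable fun t => Z (screenPoint f t) := by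
  refine locallyIntegrable_iff.2 fun k hk => ?_
  have hc := continuous_screenPoint hf
  obtain ⟨E, h, hE, hh, hEq⟩ := exists_finite_and_analyticAt_of_isRegularAt (hk.image hc)
    (by rintro _ ⟨t, -, rfl⟩; exact hZ t)
  have hcont : ContinuousOn (fun t => h (screenPoint f t)) k := fun t ht =>
    ((hh _ (mem_image_of_mem _ ht)).continuousAt.comp hc.continuousAt).continuousWithinAt
  refine (hcont.integrableOn_compact hk).congr ((ae_restrict_iff' hk.measurableSet).2 ?_)
  filter_upwards [ae_comp_of_finite_ne (F := Z) (G := h) hE (injective_screenPoint (f := f))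
    (s := k) fun t ht => hEq _ (mem_image_of_mem _ ht)] with t ht hmem
  exact (ht hmem).symm

theorem rpow_abs_le_one_add_pow {t : ℝ} (ht : 1 ≤ |t|) (M : ℝ) :
    |t| ^ M ≤ (1 + |t|) ^ ⌈M⌉₊ := by
  refine (Real.rpow_le_rpow_of_exponent_le ht (Nat.le_ceil M)).trans ?_
  rw [Real.rpow_natCast]
  exact pow_le_pow_left₀ (abs_nonneg t) (by linarith) _

theorem aestronglyMeasurable_screenWeight (hloc : LocallyIntegrable fun t => Z (screenPoint f t)) :
    AEStronglyMeasurable (fun t => Z (screenPoint f t) * (((deriv f t : ℝ) : ℂ) + Complex.I)) :=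
  hloc.aestronglyMeasurable.mul measurable_deriv_add_I.aestronglyMeasurable

/-- The growth bound says nothing for `|t| < 1`, where local integrability is used instead. In the
exponent, `⌈M⌉₊` absorbs the growth of `Z` and the additional `2` leaves the integrable function `(1
+ |t|)^(-2)`. -/
theorem integrable_screenWeight {K : NNReal} (hf : LipschitzWith K f)
    (hloc : LocallyIntegrable fun t => Z (screenPoint f t)) {C M : ℝ} (hC : 0 ≤ C)
    (hZ : ∀ t : ℝ, 1 ≤ |t| → ‖Z (screenPoint f t)‖ ≤ C * |t| ^ M) :
    Integrable fun t => ‖Z (screenPoint f t) * (((deriv f t : ℝ) : ℂ) + Complex.I)‖ *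
      ((1 + |t|) ^ (⌈M⌉₊ + 2))⁻¹ := by
  have h1 : Integrable ((Icc (-1 : ℝ) 1).indicator fun t => ‖Z (screenPoint f t)‖ * (K + 1)) :=
    IntegrableOn.integrable_indicator
      ((hloc.integrableOn_isCompact isCompact_Icc).norm.mul_const _) measurableSet_Icc
  have h2 := (integrable_inv_one_add_abs_pow le_rfl).const_mul (C * (K + 1))
  refine (h1.add h2).mono' ?_ (Eventually.of_forall fun t => ?_)
  · refine (aestronglyMeasurable_screenWeight hloc).norm.mul ?_
    apply Measurable.aestronglyMeasurable
    fun_prop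
  have hpos : 0 < 1 + |t| := by positivity
  rw [Real.norm_of_nonneg (by positivity), norm_mul]
  have hd := norm_deriv_add_I_le hf t
  have hdn : ‖Z (screenPoint f t)‖ * ‖((deriv f t : ℝ) : ℂ) + Complex.I‖ ≤
      ‖Z (screenPoint f t)‖ * (K + 1) := mul_le_mul_of_nonneg_left hd (norm_nonneg _)
  by_cases ht : |t| ≤ 1
  · have hmem : t ∈ Icc (-1 : ℝ) 1 := abs_le.1 ht
    simp only [Pi.add_apply, indicator_of_mem hmem]
    have h3 : ((1 + |t|) ^ (⌈M⌉₊ + 2))⁻¹ ≤ 1 :=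
      inv_le_one_of_one_le₀ (one_le_pow₀ (by linarith [abs_nonneg t]))
    have h4 : 0 ≤ C * (K + 1) * ((1 + |t|) ^ 2)⁻¹ := by positivity
    have h5 := mul_le_mul hdn h3 (by positivity) (by positivity)
    linarith
  · have hmem : t ∉ Icc (-1 : ℝ) 1 := fun h => ht (abs_le.2 h)
    simp only [Pi.add_apply, indicator_of_notMem hmem, zero_add]
    have ht1 : 1 ≤ |t| := (not_le.1 ht).le
    have h3 : ‖Z (screenPoint f t)‖ ≤ C * (1 + |t|) ^ ⌈M⌉₊ :=
      (hZ t ht1).trans (mul_le_mul_of_nonneg_left (rpow_abs_le_one_add_pow ht1 M) hC)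
    calc _ ≤ C * (1 + |t|) ^ ⌈M⌉₊ * (K + 1) * ((1 + |t|) ^ (⌈M⌉₊ + 2))⁻¹ := by gcongr
      _ = C * (K + 1) * ((1 + |t|) ^ 2)⁻¹ := by
        rw [pow_add]
        field_simp

/-- The radius is chosen from `Z` alone, because `mellin φ` is entire; the residue is then, for
every `φ`, an integral over one fixed circle. -/
theorem isDistribution_residue {d : ℕ} {ω : ℂ} (hZ : MeromorphicAt Z ω) :
    IsDistribution fun φ => residue (fun s => Z s * mellin φ (d + 1 - s)) ω := by
  obtain ⟨R, hR, hball⟩ := Metric.eventually_nhds_iff_ball.1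
    (eventually_nhdsWithin_iff.1 hZ.eventually_analyticAt)
  have hρ : 0 < R / 2 := by positivity
  set w : ℝ → ℂ := fun θ => deriv (circleMap ω (R / 2)) θ * Z (circleMap ω (R / 2) θ) with hw
  have hwc : Continuous w := by
    refine continuous_iff_continuousAt.2 fun θ => ?_
    have hmem : circleMap ω (R / 2) θ ∈ Metric.ball ω R :=
      Metric.closedBall_subset_ball (half_lt_self hR) (circleMap_mem_closedBall ω hρ.le θ)
    have h1 : ContinuousAt (fun θ => Z (circleMap ω (R / 2) θ)) θ :=
      (hball _ hmem (circleMap_ne_center hρ.ne')).continuousAt.comp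
        (f := circleMap ω (R / 2)) (continuous_circleMap _ _).continuousAt
    have h2 : Continuous (deriv (circleMap ω (R / 2))) := by
      have e : deriv (circleMap ω (R / 2)) = fun θ => circleMap 0 (R / 2) θ * Complex.I :=
        funext fun θ => deriv_circleMap _ _ _
      rw [e]
      fun_prop
    exact h2.continuousAt.mul h1
  have hB : ∀ θ : ℝ, |((d : ℂ) + 1 - circleMap ω (R / 2) θ).re| ≤ d + 1 + (‖ω‖ + R) := fun θ => by
    refine (Complex.abs_re_le_norm _).trans ((norm_sub_le _ _).trans ?_)
    have h1 : ‖(d : ℂ) + 1‖ ≤ d + 1 := by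
      refine (norm_add_le _ _).trans ?_
      simp
    have h2 : ‖circleMap ω (R / 2) θ‖ ≤ ‖ω‖ + R := by
      have : ‖circleMap ω (R / 2) θ - ω‖ = R / 2 := by
        rw [← dist_eq_norm]
        exact circleMap_mem_sphere ω hρ.le θ
      have h3 := norm_add_le ω (circleMap ω (R / 2) θ - ω)
      rw [add_sub_cancel] at h3
      linarith
    linarith
  have hint : Integrable (fun θ => ‖w θ‖ *
      ((1 + |((d : ℂ) + 1 - circleMap ω (R / 2) θ).im|) ^ 0)⁻¹)
      (volume.restrict (Ioc 0 (2 * Real.pi))) := by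
    simpa using (hwc.integrableOn_Icc.mono_set Ioc_subset_Icc_self).norm
  have hdist := isDistribution_integral_mul_mellin (N := 0)
    (z := fun θ : ℝ => (d : ℂ) + 1 - circleMap ω (R / 2) θ) hwc.aestronglyMeasurable
    (by fun_prop) hB hint
  refine (hdist.const_mul (2 * (Real.pi : ℂ) * Complex.I)⁻¹).congr fun φ => ?_
  have hdiff : ∀ z ∈ Metric.ball ω R, z ≠ ω →
      DifferentiableAt ℂ (fun s => Z s * mellin φ (d + 1 - s)) z := fun z hz hne =>
    (hball z hz hne).differentiableAt.mul (((differentiable_mellin_testFunction φ).comp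
      (by fun_prop : Differentiable ℂ fun s : ℂ => (d : ℂ) + 1 - s)) z)
  rw [residue_eq_circleIntegral hdiff hρ (half_lt_self hR), circleIntegral,
    intervalIntegral.integral_of_le Real.two_pi_pos.le]
  simp only [hw, smul_eq_mul, mul_assoc]

theorem screenIntegrand_mul_mellin (d : ℕ) (φ : ℝ → ℂ) (t : ℝ) :
    screenIntegrand f (fun s => Z s * mellin φ (d + 1 - s)) t =
      (Z (screenPoint f t) * (((deriv f t : ℝ) : ℂ) + Complex.I)) *
        mellin φ (d + 1 - screenPoint f t) := by
  simp only [screenIntegrand]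
  ring

theorem abs_re_sub_screenPoint_le {B : ℝ} (hB : ∀ t, |f t| ≤ B) (d : ℕ) (t : ℝ) :
    |((d : ℂ) + 1 - screenPoint f t).re| ≤ d + 1 + B := by
  simp only [Complex.sub_re, Complex.add_re, Complex.natCast_re, Complex.one_re, screenPoint_re]
  refine (abs_sub _ _).trans ?_
  rw [abs_of_nonneg (by positivity : (0 : ℝ) ≤ d + 1)]
  linarith [hB t]

theorem aestronglyMeasurable_sub_screenPoint (hf : Continuous f) (d : ℕ) :
    AEStronglyMeasurable fun t => (d : ℂ) + 1 - screenPoint f t :=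
  (continuous_const.sub (continuous_screenPoint hf)).aestronglyMeasurable

variable {d : ℕ} {K : NNReal} {B C M : ℝ}

theorem integrable_screenIntegrand (hf : LipschitzWith K f) (hB : ∀ t, |f t| ≤ B)
    (hloc : LocallyIntegrable fun t => Z (screenPoint f t)) (hC : 0 ≤ C)
    (hZ : ∀ t : ℝ, 1 ≤ |t| → ‖Z (screenPoint f t)‖ ≤ C * |t| ^ M) (φ : 𝓓(posReals, ℂ)) :
    Integrable (screenIntegrand f fun s => Z s * mellin φ (d + 1 - s)) := by
  have h := integrable_mul_mellin (aestronglyMeasurable_screenWeight hloc)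
    (aestronglyMeasurable_sub_screenPoint hf.continuous d) (abs_re_sub_screenPoint_le hB d)
    (N := ⌈M⌉₊ + 2) (by simpa using integrable_screenWeight hf hloc hC hZ) φ
  exact h.congr (Eventually.of_forall fun t => (screenIntegrand_mul_mellin d φ t).symm)

theorem isDistribution_screenIntegral (hf : LipschitzWith K f) (hB : ∀ t, |f t| ≤ B)
    (hloc : LocallyIntegrable fun t => Z (screenPoint f t)) (hC : 0 ≤ C)
    (hZ : ∀ t : ℝ, 1 ≤ |t| → ‖Z (screenPoint f t)‖ ≤ C * |t| ^ M) :
    IsDistribution fun φ => screenIntegral f fun s => Z s * mellin φ (d + 1 - s) := by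
  have h := isDistribution_integral_mul_mellin (aestronglyMeasurable_screenWeight hloc)
    (aestronglyMeasurable_sub_screenPoint hf.continuous d) (abs_re_sub_screenPoint_le hB d)
    (N := ⌈M⌉₊ + 2) (by simpa using integrable_screenWeight hf hloc hC hZ)
  refine h.congr fun φ => ?_
  simp only [screenIntegral, screenIntegrand_mul_mellin]

theorem mellin_rescale {a : ℝ} (ha : 0 < a) (φ : ℝ → ℂ) (z : ℂ) :
    mellin (fun x => (a : ℂ)⁻¹ * φ (x / a)) z = (a : ℂ) ^ (z - 1) * mellin φ z := by
  have h := mellin_const_smul (fun x => φ (a⁻¹ * x)) z ((a : ℂ)⁻¹)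
  rw [mellin_comp_mul_left _ _ (inv_pos.2 ha)] at h
  simp only [smul_eq_mul, ← div_eq_inv_mul] at h
  simp only [← div_eq_inv_mul]
  rw [h, Complex.ofReal_inv, Complex.inv_cpow _ _ (by
    rw [Complex.arg_ofReal_of_nonneg ha.le]; exact Real.pi_ne_zero.symm), Complex.cpow_neg, inv_inv,
    Complex.cpow_sub _ _ (Complex.ofReal_ne_zero.2 ha.ne'), Complex.cpow_one]
  ring

/-- Rescaling multiplies the integrand by a power of `a` with modulus `a ^ (d - f t)`, at most `a ^
(d - sup f)` for `a ≤ 1`; the remaining integral does not involve `a`. -/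
theorem isBigO_screenIntegral_rescale (hB : ∀ t, |f t| ≤ B) (φ : ℝ → ℂ)
    (hint : Integrable (screenIntegrand f fun s => Z s * mellin φ (d + 1 - s))) :
    (fun a : ℝ => screenIntegral f fun s =>
      Z s * mellin (fun x => (a : ℂ)⁻¹ * φ (x / a)) (d + 1 - s)) =O[𝓝[>] (0 : ℝ)]
      fun a => a ^ ((d : ℝ) - supScreen f) := by
  have hbdd : BddAbove (range f) := ⟨B, by rintro _ ⟨t, rfl⟩; exact (le_abs_self _).trans (hB t)⟩
  refine Asymptotics.IsBigO.of_bound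
    (∫ t, ‖screenIntegrand f (fun s => Z s * mellin φ (d + 1 - s)) t‖) ?_
  filter_upwards [Ioc_mem_nhdsGT one_pos] with a ha
  rw [Real.norm_of_nonneg (Real.rpow_nonneg ha.1.le _), mul_comm, ← integral_const_mul]
  refine norm_integral_le_of_norm_le (hint.norm.const_mul _) (Eventually.of_forall fun t => ?_)
  rw [screenIntegrand_mul_mellin, screenIntegrand_mul_mellin, mellin_rescale ha.1, mul_left_comm,
    norm_mul, Complex.norm_cpow_eq_rpow_re_of_pos ha.1]
  refine mul_le_mul_of_nonneg_right ?_ (norm_nonneg _)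
  refine Real.rpow_le_rpow_of_exponent_ge ha.1 ha.2 ?_
  have : f t ≤ supScreen f := le_ciSup hbdd t
  simp only [Complex.sub_re, Complex.add_re, Complex.natCast_re, Complex.one_re, screenPoint_re]
  linarith

/-- The integrals along horizontal segments, at heights tending to infinity along which `Z` grows
at most polynomially, tend to zero. -/
theorem tendsto_horizontalIntegral {c : ℝ} (hB : ∀ t, |f t| ≤ B) (hBc : B ≤ c) (hC : 0 ≤ C)
    {y : ℕ → ℝ} (hy : Tendsto (fun n => |y n|) atTop atTop)
    (hZ : ∀ᶠ n in atTop, ∀ σ : ℝ, f (y n) ≤ σ → σ ≤ c →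
      ‖Z (σ + y n * Complex.I)‖ ≤ C * (|y n| + 1) ^ M) (φ : 𝓓(posReals, ℂ)) :
    Tendsto (fun n => ∫ σ in f (y n)..c, (fun s => Z s * mellin φ (d + 1 - s)) (σ + y n * Complex.I))
      atTop (𝓝 0) := by
  -- One power of decay beyond the growth exponent suffices here, since the segments have length at
  -- most `2 * c`.
  obtain ⟨D, hD⟩ : ∃ D, ∀ z : ℂ, |z.re| ≤ d + 1 + c →
      ‖mellin φ z‖ ≤ D * ((1 + |z.im|) ^ (⌈M⌉₊ + 1))⁻¹ := by
    obtain ⟨D, hD⟩ := exists_norm_mellin_testFunction_le φ.hasCompactSupport φ.tsupport_subset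
      (d + 1 + c) (⌈M⌉₊ + 1)
    exact ⟨_, hD φ Subset.rfl⟩
  have hlim : Tendsto (fun n => C * D * (2 * c) * (1 + |y n|)⁻¹) atTop (𝓝 0) := by
    have h1 : Tendsto (fun n => (1 + |y n|)⁻¹) atTop (𝓝 0) :=
      tendsto_inv_atTop_zero.comp (tendsto_atTop_add_const_left _ _ hy)
    simpa using h1.const_mul (C * D * (2 * c))
  refine squeeze_zero_norm' ?_ hlim
  filter_upwards [hZ] with n hn
  have hfc : f (y n) ≤ c := (le_abs_self _).trans ((hB _).trans hBc)
  have hpos : 0 < 1 + |y n| := by positivity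
  have hbound : ∀ σ ∈ uIoc (f (y n)) c,
      ‖(fun s => Z s * mellin φ (d + 1 - s)) (σ + y n * Complex.I)‖ ≤ C * D * (1 + |y n|)⁻¹ := by
    intro σ hσ
    rw [uIoc_of_le hfc] at hσ
    have h1 := hn σ hσ.1.le hσ.2
    have h2 : ‖mellin φ ((d : ℂ) + 1 - (σ + y n * Complex.I))‖ ≤
        D * ((1 + |y n|) ^ (⌈M⌉₊ + 1))⁻¹ := by
      have hre : |((d : ℂ) + 1 - (σ + y n * Complex.I)).re| ≤ d + 1 + c := by
        have e : ((d : ℂ) + 1 - (σ + y n * Complex.I)).re = d + 1 - σ := by simp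
        rw [e, abs_le]
        have := (abs_le.1 (hB (y n))).1
        have : (0 : ℝ) ≤ d := Nat.cast_nonneg d
        constructor <;> linarith [hσ.1, hσ.2]
      simpa using hD _ hre
    have h3 : (|y n| + 1) ^ M ≤ (1 + |y n|) ^ ⌈M⌉₊ := by
      rw [add_comm]
      refine (Real.rpow_le_rpow_of_exponent_le (by linarith [abs_nonneg (y n)])
        (Nat.le_ceil M)).trans ?_
      rw [Real.rpow_natCast]
    rw [norm_mul]
    calc _ ≤ (C * (1 + |y n|) ^ ⌈M⌉₊) * (D * ((1 + |y n|) ^ (⌈M⌉₊ + 1))⁻¹) :=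
          mul_le_mul (h1.trans (mul_le_mul_of_nonneg_left h3 hC)) h2 (norm_nonneg _)
            (by positivity)
      _ = C * D * (1 + |y n|)⁻¹ := by
          rw [pow_succ]
          field_simp
  refine (intervalIntegral.norm_integral_le_of_norm_le_const hbound).trans ?_
  -- The sign of `D` is not given. It is read off from the bound at the end `c` of the segment or,
  -- when the segment is a point and the half-open interval empty, from the bound at `0`.
  have h0 : 0 ≤ C * D * (1 + |y n|)⁻¹ := by
    rcases hfc.eq_or_lt with h | h
    · have := hbound c
      rw [h] at this
      have hD0 : 0 ≤ D := by
        have := (norm_nonneg _).trans (hD 0 (by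
          simp only [Complex.zero_re, abs_zero]
          have := (abs_nonneg _).trans ((hB 0).trans hBc)
          positivity))
        simpa using this
      positivity
    · exact (norm_nonneg _).trans (hbound c (by rw [uIoc_of_le hfc]; exact ⟨h, le_rfl⟩))
  have h1 : |c - f (y n)| ≤ 2 * c := by
    rw [abs_of_nonneg (by linarith)]
    linarith [(abs_le.1 (hB (y n))).1]
  calc _ ≤ C * D * (1 + |y n|)⁻¹ * (2 * c) := mul_le_mul_of_nonneg_left h1 h0
    _ = _ := by ring

end Screen

end FractalSpray


namespace FractalSpray

/-! ### Shifting the contour and passing to the limit -/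

section Main

variable {d : ℕ} {T G : Set (EuclideanSpace ℝ (Fin d))} {ℓ κ : ℕ → ℝ} {f : ℝ → ℝ} {ζ : ℂ → ℂ}

/-- Parseval's formula at the abscissa `c - d > 0`, in the variable `s = z + d`. -/
theorem integral_vertical_tube (hd : 1 ≤ d) (hT : IsFractalSpray T G ℓ) (hG : IsGenerator G)
    (hκ : IsMonophase G κ) {W : Set ℂ} (hζ : IsScalingZeta ℓ W ζ) {c : ℝ} (hc : d < c)
    (φ : 𝓓(posReals, ℂ)) :
    Integrable (fun t : ℝ => (fun s => ζ s * tubeTransform d (inradius G) κ s *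
      mellin φ (d + 1 - s)) (c + t * Complex.I)) ∧
    ∫ t : ℝ, (fun s => ζ s * tubeTransform d (inradius G) κ s *
      mellin φ (d + 1 - s)) (c + t * Complex.I) =
        2 * Real.pi * ∫ x in Ioi (0 : ℝ), tubeDefect T x * φ x := by
  have hconv : MellinConvergent (tubeDefect T) ((c - d : ℝ) : ℂ) :=
    mellinConvergent_tubeDefect hd hT hG (by
      rw [Complex.ofReal_re]
      linarith)
  have h := integral_mellin_mul_mellin hconv φ
  have e : (fun t : ℝ => mellin (tubeDefect T) (((c - d : ℝ) : ℂ) + t * Complex.I) *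
      mellin φ (1 - (((c - d : ℝ) : ℂ) + t * Complex.I))) =
      fun t : ℝ => (fun s => ζ s * tubeTransform d (inradius G) κ s *
        mellin φ (d + 1 - s)) (c + t * Complex.I) := by
    ext t
    have e1 : ((c - d : ℝ) : ℂ) + t * Complex.I = (c + t * Complex.I) - d := by push_cast; ring
    have e2 : 1 - (((c : ℂ) + t * Complex.I) - d) = d + 1 - (c + t * Complex.I) := by ring
    rw [e1, e2, mellin_tubeDefect hd hT hG hκ hζ (by simpa using hc)]
  rw [e] at h
  exact h

theorem integral_tubeDefect_mul (hA : Bornology.IsBounded T) (φ : 𝓓(posReals, ℂ)) :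
    ∫ x in Ioi (0 : ℝ), tubeDefect T x * φ x =
      pairing (fun ε => (innerTubeVolume T ε : ℂ)) φ -
        (volume : Measure (EuclideanSpace ℝ (Fin d))).real T * mellin φ 1 := by
  have hφ : Integrable φ (volume.restrict (Ioi 0)) :=
    (φ.continuous.integrable_of_hasCompactSupport φ.hasCompactSupport).restrict
  have hV : Integrable (fun ε => (innerTubeVolume T ε : ℂ) * φ ε) (volume.restrict (Ioi 0)) := by
    refine hφ.bdd_mul (c := (volume : Measure (EuclideanSpace ℝ (Fin d))).real T)
      (Complex.measurable_ofReal.comp (monotone_innerTubeVolume hA).measurable).aestronglyMeasurable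
      (Eventually.of_forall fun ε => ?_)
    rw [Complex.norm_real, Real.norm_of_nonneg (innerTubeVolume_nonneg T ε)]
    exact innerTubeVolume_le_volume hA ε
  have h1 : mellin φ 1 = ∫ x in Ioi (0 : ℝ), φ x := by simp [mellin]
  rw [h1, pairing, ← integral_const_mul, ← integral_sub hV (hφ.const_mul _)]
  congr 1 with x
  rw [tubeDefect]
  push_cast
  ring

theorem abs_tendsto_of_isHeightSeq {H : ℤ → ℝ} (hH : IsHeightSeq H) :
    Tendsto (fun n : ℕ => |H n|) atTop atTop ∧ Tendsto (fun n : ℕ => |H (-n)|) atTop atTop :=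
  ⟨tendsto_abs_atTop_atTop.comp hH.tendsto_top, tendsto_abs_atBot_atTop.comp hH.tendsto_bot⟩

/-- The bound of languidity on a horizontal half-line rules out poles on it, and the integral
dimensions have height `0`. Hence no visible dimension lies on the horizontal sides of the contour.
-/
theorem im_ne_of_mem_visibleDims {M : ℝ} {H : ℤ → ℝ} (hL : IsLanguidAlong ζ f M H) {n : ℤ}
    (hn : H n ≠ 0) {ω : ℂ} (hω : ω ∈ visibleDims d ζ f) : ω.im ≠ H n := by
  obtain ⟨c, -, hL1, -⟩ := hL
  intro him
  rcases hω with hω | ⟨-, k, -, rfl⟩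
  · have hw : f ω.im ≤ ω.re := hω.1
    refine not_tendsto_norm_atTop_of_horizontal (C := c * (|H n| + 1) ^ M) (fun x hx _ => ?_) hω.2
    have h := hL1 n (ω.re + x) (by rw [← him]; linarith)
    rw [← him] at h ⊢
    have e : (((ω.re + x : ℝ)) : ℂ) + ω.im * Complex.I = ω + x := by
      conv_rhs => rw [← Complex.re_add_im ω]
      push_cast
      ring
    rwa [e] at h
  · exact hn (by simpa using him.symm)

/-- The point `d` is a possible pole of the transform without being a visible dimension, so it is
excluded separately: the screen crosses the real axis strictly to its left. -/
theorem locallyIntegrable_zeta_mul_tubeTransform {g : ℝ} (hg : 0 < g) (κ : ℕ → ℝ)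
    (hf : Continuous f) (hζ : IsScalingZeta ℓ (window f) ζ)
    (havoid : ∀ t : ℝ, screenPoint f t ∉ visibleDims d ζ f) (hfd : f 0 < d) :
    LocallyIntegrable fun t => (fun s => ζ s * tubeTransform d g κ s) (screenPoint f t) := by
  refine locallyIntegrable_comp_screenPoint hf fun t =>
    isRegularAt_zeta_mul_tubeTransform hg κ hζ (by simp [window]) (havoid t) fun h => ?_
  have h1 := congrArg Complex.im h
  have h2 := congrArg Complex.re h
  simp only [screenPoint_im, screenPoint_re, Complex.natCast_im, Complex.natCast_re] at h1 h2
  rw [h1] at h2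
  exact hfd.ne h2

theorem exists_norm_screen_le {g B M : ℝ} (hg : 0 < g) (κ : ℕ → ℝ) (hB : ∀ t, |f t| ≤ B)
    {H : ℤ → ℝ} (hL : IsLanguidAlong ζ f M H) :
    ∃ C, 0 ≤ C ∧ ∀ t : ℝ, 1 ≤ |t| →
      ‖(fun s => ζ s * tubeTransform d g κ s) (screenPoint f t)‖ ≤ C * |t| ^ M := by
  obtain ⟨c, hc, -, hL2⟩ := hL
  obtain ⟨P, hP, hPb⟩ := exists_norm_tubeTransform_le d hg κ B
  refine ⟨c * P, by positivity, fun t ht => ?_⟩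
  simp only [norm_mul]
  calc _ ≤ c * |t| ^ M * P := mul_le_mul (hL2 t ht) (hPb _ (by simpa using hB t) (by simpa using ht))
        (norm_nonneg _) (by positivity)
    _ = _ := by ring

theorem exists_norm_horizontal_le {g B c M : ℝ} (hg : 0 < g) (κ : ℕ → ℝ) (hB : ∀ t, |f t| ≤ B)
    (hBc : B ≤ c) {H : ℤ → ℝ} (hL : IsLanguidAlong ζ f M H) :
    ∃ C, 0 ≤ C ∧ ∀ n : ℤ, 1 ≤ |H n| → ∀ σ : ℝ, f (H n) ≤ σ → σ ≤ c →
      ‖(fun s => ζ s * tubeTransform d g κ s) (σ + H n * Complex.I)‖ ≤ C * (|H n| + 1) ^ M := by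
  obtain ⟨c0, hc0, hL1, -⟩ := hL
  obtain ⟨P, hP, hPb⟩ := exists_norm_tubeTransform_le d hg κ c
  refine ⟨c0 * P, by positivity, fun n hn σ hσ hσc => ?_⟩
  simp only [norm_mul]
  have hre : |((σ : ℂ) + H n * Complex.I).re| ≤ c := by
    have e : ((σ : ℂ) + H n * Complex.I).re = σ := by simp
    rw [e, abs_le]
    exact ⟨by linarith [(abs_le.1 (hB (H n))).1], hσc⟩
  calc _ ≤ c0 * (|H n| + 1) ^ M * P := mul_le_mul (hL1 n σ hσ) (hPb _ hre (by simpa using hn))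
        (norm_nonneg _) (by positivity)
    _ = _ := by ring

/-- The residue theorem between the heights `a < 0 < b`. -/
theorem boundaryIntegral_tube {K : NNReal} {B c a b : ℝ} (hd : 1 ≤ d) (hT : IsFractalSpray T G ℓ)
    (hG : IsGenerator G) (hκ : IsMonophase G κ) (hf : LipschitzWith K f) (hB : ∀ t, |f t| ≤ B)
    (hζ : IsScalingZeta ℓ (window f) ζ)
    (havoid : ∀ t : ℝ, screenPoint f t ∉ visibleDims d ζ f) (hfd : f 0 < d) (hBc : B ≤ c)
    (hc : d < c) (ha : a < 0) (hb : 0 < b)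
    (hab : ∀ ω ∈ visibleDims d ζ f, ω.im ≠ a ∧ ω.im ≠ b) (φ : 𝓓(posReals, ℂ)) :
    boundaryIntegral f a b c
        (fun s => ζ s * tubeTransform d (inradius G) κ s * mellin φ (d + 1 - s)) =
      2 * Real.pi * Complex.I *
        (∑ᶠ ω ∈ {ω ∈ visibleDims d ζ f | a < ω.im ∧ ω.im < b},
          residueAction d (inradius G) κ ζ ω φ -
          (volume : Measure (EuclideanSpace ℝ (Fin d))).real T * mellin φ 1) := by
  classical
  have hg := inradius_pos hd hG
  have hsum := hT.summable_pow hG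
  have hpos := hT.ratio_pos
  set F : ℂ → ℂ := fun s => ζ s * tubeTransform d (inradius G) κ s * mellin φ (d + 1 - s) with hF
  have hfin := finite_visibleDims hζ hpos hsum hf.continuous a b
  have hφ : ∀ z, AnalyticAt ℂ (fun s : ℂ => mellin φ (d + 1 - s)) z := fun z =>
    ((differentiable_mellin_testFunction φ).comp
      (by fun_prop : Differentiable ℂ fun s : ℂ => (d : ℂ) + 1 - s)).analyticAt _
  have hdres := hasResidueAt_dimension (f := f) hg κ hζ hpos hsum hfd φ
  -- Since `κ d = -vol G` and the tiles have volumes `ℓ n ^ d * vol G`, the residue at `d` is the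
  -- total volume with a minus sign.
  have hvol : ((∑' n, ℓ n ^ d : ℝ) : ℂ) * κ d * mellin φ 1 =
      -((volume : Measure (EuclideanSpace ℝ (Fin d))).real T * mellin φ 1) := by
    rw [hκ.top, ← (hT.hasSum_volume hG).tsum_eq, tsum_mul_right]
    push_cast
    ring
  rw [hvol] at hdres
  have hdn : (d : ℂ) ∉ hfin.toFinset := fun h => by
    have := re_lt_of_mem_visibleDims hζ hpos hsum (hfin.mem_toFinset.1 h).1
    simp at this
  have hwin : ∀ ω ∈ visibleDims d ζ f, ω ∈ window f := by
    rintro ω (h | h)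
    · exact h.1
    · exact h.1
  have hres := (boundaryIntegral_eq_sum_residues hf (ha.trans hb).le
    (fun t _ => (le_abs_self _).trans ((hB t).trans hBc)) (insert (d : ℂ) hfin.toFinset)
    (residue F) F (c := c) ?_ ?_ ?_).2
  · rw [hres, Finset.sum_insert hdn, hdres.residue_eq, finsum_mem_eq_finite_toFinset_sum _ hfin]
    have e : ∀ ω, residueAction d (inradius G) κ ζ ω φ = residue F ω := fun ω => by
      simp only [residueAction, pairing_tubularZeta, hF]
    simp only [e]
    ring
  · intro ω hω
    rcases Finset.mem_insert.1 hω with rfl | hω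
    · simpa [graphInterior, ha, hb, hc] using hfd
    · obtain ⟨hω, h1, h2⟩ := hfin.mem_toFinset.1 hω
      refine ⟨h1, h2, lt_of_le_of_ne (hwin ω hω) fun he => havoid ω.im ?_,
        (re_lt_of_mem_visibleDims hζ hpos hsum hω).trans hc⟩
      have : screenPoint f ω.im = ω := Complex.ext (by simpa using he) (by simp)
      rwa [this]
  · intro ω hω
    have hmer : MeromorphicAt F ω := by
      have hw : ω ∈ window f := by
        rcases Finset.mem_insert.1 hω with rfl | hω
        · simpa [window] using hfd.le
        · exact hwin ω (hfin.mem_toFinset.1 hω).1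
      exact ((hζ.meromorphic ω hw).mul (meromorphicAt_tubeTransform hg ω)).mul
        (hφ ω).meromorphicAt
    obtain ⟨r, hr⟩ := exists_hasResidueAt_of_meromorphicAt hmer
    rwa [hr.residue_eq]
  · intro z hz hzS
    rw [Finset.mem_insert, not_or] at hzS
    refine (isRegularAt_zeta_mul_tubeTransform hg κ hζ hz.2.2.1 (fun h => hzS.2 ?_) hzS.1).mul
      (hφ z).isRegularAt
    exact hfin.mem_toFinset.2 ⟨h, lt_of_le_of_ne hz.1 (hab z h).1.symm,
      lt_of_le_of_ne hz.2.1 (hab z h).2⟩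

theorem tendsto_sum_residues {B : ℝ} {K : NNReal} (hd : 1 ≤ d) (hT : IsFractalSpray T G ℓ)
    (hG : IsGenerator G) (hκ : IsMonophase G κ) (hf : LipschitzWith K f) (hB : ∀ t, |f t| ≤ B)
    (hζ : IsScalingZeta ℓ (window f) ζ)
    (havoid : ∀ t : ℝ, screenPoint f t ∉ visibleDims d ζ f) (hfd : f 0 < d)
    {M : ℝ} {H : ℤ → ℝ} (hH : IsHeightSeq H) (hL : IsLanguidAlong ζ f M H) (φ : 𝓓(posReals, ℂ)) :
    Tendsto (fun n : ℕ => (∑ᶠ ω ∈ {ω ∈ visibleDims d ζ f | H (-n) < ω.im ∧ ω.im < H n},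
        residueAction d (inradius G) κ ζ ω φ) + errorAction d (inradius G) κ ζ f φ)
      atTop (𝓝 (pairing (fun ε => (innerTubeVolume T ε : ℂ)) φ)) := by
  have hg := inradius_pos hd hG
  -- The line must lie to the right of `d`, where the Dirichlet series represents `ζ`, and not to
  -- the left of any point of the screen.
  set c : ℝ := max B (d + 1) with hcdef
  have hBc : B ≤ c := le_max_left _ _
  have hc : (d : ℝ) < c := (lt_add_one _).trans_le (le_max_right _ _)
  set F : ℂ → ℂ := fun s => ζ s * tubeTransform d (inradius G) κ s * mellin φ (d + 1 - s) with hF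
  obtain ⟨hvint, hveq⟩ := integral_vertical_tube hd hT hG hκ hζ hc φ
  obtain ⟨C, hC, hCb⟩ := exists_norm_screen_le (d := d) hg κ hB hL
  have hloc := locallyIntegrable_zeta_mul_tubeTransform hg κ hf.continuous hζ havoid hfd
  have hsint : Integrable (screenIntegrand f F) := integrable_screenIntegrand
    (Z := fun s => ζ s * tubeTransform d (inradius G) κ s) hf hB hloc hC hCb φ
  obtain ⟨C', hC', hCb'⟩ := exists_norm_horizontal_le (d := d) hg κ hB hBc hL
  obtain ⟨habs1, habs2⟩ := abs_tendsto_of_isHeightSeq hH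
  have hbot : Tendsto (fun n : ℕ => ∫ σ in f (H (-n))..c, F (σ + H (-n) * Complex.I))
      atTop (𝓝 0) := tendsto_horizontalIntegral
    (Z := fun s => ζ s * tubeTransform d (inradius G) κ s) (y := fun n : ℕ => H (-n)) hB hBc hC' habs2
    ((habs2.eventually_ge_atTop 1).mono fun n hn => hCb' _ hn) φ
  have htop : Tendsto (fun n : ℕ => ∫ σ in f (H n)..c, F (σ + H n * Complex.I))
      atTop (𝓝 0) := tendsto_horizontalIntegral
    (Z := fun s => ζ s * tubeTransform d (inradius G) κ s) (y := fun n : ℕ => H n) hB hBc hC' habs1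
    ((habs1.eventually_ge_atTop 1).mono fun n hn => hCb' _ hn) φ
  have hver := intervalIntegral_tendsto_integral hvint hH.tendsto_bot hH.tendsto_top
  have hscr := intervalIntegral_tendsto_integral hsint hH.tendsto_bot hH.tendsto_top
  have hlim : Tendsto (fun n : ℕ => boundaryIntegral f (H (-n)) (H n) c F) atTop
      (𝓝 (0 + (2 * Real.pi * ∫ x in Ioi (0 : ℝ), tubeDefect T x * φ x) * Complex.I - 0 -
        screenIntegral f F)) := by
    rw [hveq] at hver
    exact ((hbot.add (hver.mul_const Complex.I)).sub htop).sub hscr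
  have hpi : 2 * (Real.pi : ℂ) * Complex.I ≠ 0 := Complex.two_pi_I_ne_zero
  have herr : errorAction d (inradius G) κ ζ f φ =
      (2 * (Real.pi : ℂ) * Complex.I)⁻¹ * screenIntegral f F := by
    simp only [errorAction, pairing_tubularZeta, hF]
  have hfinal := ((hlim.const_mul (2 * (Real.pi : ℂ) * Complex.I)⁻¹).add_const
    ((volume : Measure (EuclideanSpace ℝ (Fin d))).real T * mellin φ 1)).add_const
      (errorAction d (inradius G) κ ζ f φ)
  have hval : (2 * (Real.pi : ℂ) * Complex.I)⁻¹ * (0 + (2 * Real.pi *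
      ∫ x in Ioi (0 : ℝ), tubeDefect T x * φ x) * Complex.I - 0 - screenIntegral f F) +
      (volume : Measure (EuclideanSpace ℝ (Fin d))).real T * mellin φ 1 +
      errorAction d (inradius G) κ ζ f φ = pairing (fun ε => (innerTubeVolume T ε : ℂ)) φ := by
    rw [herr, integral_tubeDefect_mul hT.isBounded φ]
    field_simp
    ring
  rw [hval] at hfinal
  refine hfinal.congr' ?_
  filter_upwards [eventually_ge_atTop 1] with n hn
  rw [boundaryIntegral_tube hd hT hG hκ hf hB hζ havoid hfd hBc hc (hH.neg n hn) (hH.pos n hn)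
    (fun ω hω => ⟨im_ne_of_mem_visibleDims hL (hH.neg n hn).ne hω,
      im_ne_of_mem_visibleDims hL (hH.pos n hn).ne' hω⟩) φ, inv_mul_cancel_left₀ hpi, sub_add_cancel]
  rfl

end Main

end FractalSpray

theorem theorem7p2 {d : ℕ} (hd : 1 ≤ d)
    -- a fractal spray on a monophase generator
    (G T : Set (EuclideanSpace ℝ (Fin d))) (κ : ℕ → ℝ) (ℓ : ℕ → ℝ)
    (hG : FractalSpray.IsGenerator G) (hκ : FractalSpray.IsMonophase G κ)
    (hT : FractalSpray.IsFractalSpray T G ℓ)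
    -- a screen, and the scaling zeta function on its window
    (f : ℝ → ℝ) (hf : FractalSpray.IsScreen f)
    (ζ : ℂ → ℂ) (hζ : FractalSpray.IsScalingZeta ℓ (FractalSpray.window f) ζ)
    (hlang : FractalSpray.IsLanguid ζ f)
    -- the screen avoids the visible complex dimensions, and passes to the left of `d`
    (havoid : ∀ t : ℝ, FractalSpray.screenPoint f t ∉ FractalSpray.visibleDims d ζ f)
    (hfd : f 0 < d) :
    -- the tube volume, the residues and the error term are well-defined distributions
    LocallyIntegrableOn (FractalSpray.innerTubeVolume T) (Ioi 0) ∧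
    (∀ ω ∈ FractalSpray.visibleDims d ζ f, FractalSpray.IsDistribution
      (FractalSpray.residueAction d (FractalSpray.inradius G) κ ζ ω)) ∧
    (∀ φ : 𝓓(FractalSpray.posReals, ℂ), Integrable (FractalSpray.screenIntegrand f fun s =>
      FractalSpray.pairing
        (fun ε => FractalSpray.tubularZeta d (FractalSpray.inradius G) κ ζ ε s) φ)) ∧
    FractalSpray.IsDistribution
      (FractalSpray.errorAction d (FractalSpray.inradius G) κ ζ f) ∧
    -- the tube formula; the sum over the visible dimensions is the limit of the finite sums
    -- over those between the heights `H (-n)` and `H n` of any sequence as in languidity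
    (∀ (M : ℝ) (H : ℤ → ℝ), FractalSpray.IsHeightSeq H → FractalSpray.IsLanguidAlong ζ f M H →
      (∀ n : ℕ, {ω ∈ FractalSpray.visibleDims d ζ f | H (-n) < ω.im ∧ ω.im < H n}.Finite) ∧
      ∀ φ : 𝓓(FractalSpray.posReals, ℂ),
        Tendsto
          (fun n : ℕ =>
            (∑ᶠ ω ∈ {ω ∈ FractalSpray.visibleDims d ζ f | H (-n) < ω.im ∧ ω.im < H n},
              FractalSpray.residueAction d (FractalSpray.inradius G) κ ζ ω φ) +
            FractalSpray.errorAction d (FractalSpray.inradius G) κ ζ f φ)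
          atTop
          (𝓝 (FractalSpray.pairing (fun ε => (FractalSpray.innerTubeVolume T ε : ℂ)) φ))) ∧
    -- the error estimate
    FractalSpray.IsDistributionalBigO
      (FractalSpray.errorAction d (FractalSpray.inradius G) κ ζ f)
      (d - FractalSpray.supScreen f) := by
  have hg := FractalSpray.inradius_pos hd hG
  obtain ⟨K, hK⟩ := hf.lipschitz
  obtain ⟨B, hB⟩ := hf.bounded
  -- Properties of the error term use only the growth along the screen, which does not involve the
  -- heights; any exponent and sequence witnessing languidity will do.
  obtain ⟨M₀, H₀, -, hL₀⟩ := hlang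
  obtain ⟨C, hC, hCb⟩ := FractalSpray.exists_norm_screen_le (d := d) hg κ hB hL₀
  have hloc := FractalSpray.locallyIntegrable_zeta_mul_tubeTransform hg κ hK.continuous hζ
    havoid hfd
  have hsint := FractalSpray.integrable_screenIntegrand (d := d)
    (Z := fun s => ζ s * FractalSpray.tubeTransform d (FractalSpray.inradius G) κ s) hK hB hloc hC hCb
  have herr : ∀ φ : ℝ → ℂ, FractalSpray.errorAction d (FractalSpray.inradius G) κ ζ f φ =
      (2 * (Real.pi : ℂ) * Complex.I)⁻¹ * FractalSpray.screenIntegral f fun s =>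
        ζ s * FractalSpray.tubeTransform d (FractalSpray.inradius G) κ s *
          mellin φ (d + 1 - s) := fun φ => by
    simp only [FractalSpray.errorAction, FractalSpray.pairing_tubularZeta]
  refine ⟨?_, fun ω hω => ?_, fun φ => ?_, ?_, fun M H hH hL => ⟨fun n => ?_, fun φ => ?_⟩,
    fun φ => ?_⟩
  · exact (FractalSpray.monotone_innerTubeVolume hT.isBounded).locallyIntegrable.locallyIntegrableOn _
  · have hw : ω ∈ FractalSpray.window f := by
      rcases hω with h | h
      · exact h.1
      · exact h.1
    refine (FractalSpray.isDistribution_residue (d := d) ((hζ.meromorphic ω hw).mul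
      (FractalSpray.meromorphicAt_tubeTransform (d := d) (κ := κ) hg ω))).congr fun φ => ?_
    simp only [FractalSpray.residueAction, FractalSpray.pairing_tubularZeta, Pi.mul_apply]
  · simpa only [FractalSpray.pairing_tubularZeta] using hsint φ
  · exact ((FractalSpray.isDistribution_screenIntegral (d := d)
      (Z := fun s => ζ s * FractalSpray.tubeTransform d (FractalSpray.inradius G) κ s) hK hB hloc hC hCb).const_mul
      (2 * (Real.pi : ℂ) * Complex.I)⁻¹).congr fun φ => herr φ
  · exact FractalSpray.finite_visibleDims hζ hT.ratio_pos (hT.summable_pow hG) hK.continuous _ _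
  · exact FractalSpray.tendsto_sum_residues hd hT hG hκ hK hB hζ havoid hfd hH hL φ
  · simp only [herr]
    exact (FractalSpray.isBigO_screenIntegral_rescale hB φ (hsint φ)).const_mul_left _
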